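/- Let $d\ge 2$, let $\mathcal S(\mathbb S^{d-1})=C^\infty(\mathbb S^{d-1},\mathbb C)$ with the Fréchet topology of the norms $\|(\mathrm{Id}-\Delta)^k h\|_\infty$, $k\in\mathbb N$ ($\Delta$ the Laplace–Beltrami operator), let $\mathcal S'(\mathbb S^{d-1})$ be its topological dual, with duality product $\langle\cdot|\cdot\rangle$, and let $\langle f,g\rangle=\int_{\mathbb S^{d-1}}f\,\overline g$. For $n\in\mathbb N$ let $\{Y_n^m\}_m$ be an orthonormal basis of the space $\mathrm{Harm}_n=\{Y:\Delta Y=-n(n+d-2)Y\}$ of spherical harmonics of order $n$. A *pseudo-differential operator* with symbol $\{\hat D_n\}_{n\in\mathbb N}\subset\mathbb R$ and spectral growth order $p\ge 0$ is a linear operator $\mathcal D:\mathcal S(\mathbb S^{d-1})\to\mathcal S(\mathbb S^{d-1})$ with $\mathcal Dh=\sum_{n\ge 0}\hat D_n\sum_m\langle h,Y_n^m\rangle Y_n^m$ for all $h$, where $\hat D_n=0$ for at most finitely many $n$ and $|\hat D_n|=\Theta(n^p)$. It acts on $f\in\mathcal S'(\mathbb S^{d-1})$ by $\langle\mathcal Df|\varphi\rangle=\langle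 f|\mathcal D\varphi\rangle$. It is *positive-definite* if $\langle\mathcal Dh,h\rangle>0$ for all $h\ne 0$. A *$\mathcal D$-spline* is an $\mathfrak s\in\mathcal S'(\mathbb S^{d-1})$ such that $\mathcal D\mathfrak s=\sum_{i=1}^M\alpha_i\delta_{\mathbf r_i}$ for some $M\in\mathbb N$, $\alpha_i\in\mathbb C$, $\mathbf r_i\in\mathbb S^{d-1}$. **Proposition 9 (native space for $\mathcal D$-splines).** Let $\mathcal D$ be a positive-definite pseudo-differential operator on $\mathbb S^{d-1}$ with symbol $\{\hat D_n\}$ and spectral growth order $p>d-1$. Then $\hat D_n>0$ for all $n$, and $\mathcal D$ has a unique Hermitian square root $\mathcal D^{1/2}$ (a self-adjoint, positive semi-definite linear operator $\mathcal S(\mathbb S^{d-1})\to\mathcal S(\mathbb S^{d-1})$ with $\mathcal D^{1/2}\mathcal D^{1/2}=\mathcal D$). It is a pseudo-differential operator with symbol $\{\sqrt{\hat D_n}\}$ and spectral growth order $p/2$. Moreover, the generalised Sobolev space $$\mathcal H_{\mathcal D^{1/2}}(\mathbb S^{d-1})=\{f\in\mathcal S'(\mathbb S^{d-1}):\mathcal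 D^{1/2}f\in\mathcal L^2(\mathbb S^{d-1})\},\qquad \langle f,g\rangle_{\mathcal D^{1/2}}=\langle\mathcal D^{1/2}f,\mathcal D^{1/2}g\rangle,$$ is a reproducing kernel Hilbert space: the form $\langle\cdot,\cdot\rangle_{\mathcal D^{1/2}}$ is an inner product for which it is complete, each of its elements is (given by integration against) a continuous function on $\mathbb S^{d-1}$, and evaluation at each point of $\mathbb S^{d-1}$ is a continuous linear functional on it. It contains all $\mathcal D$-splines. -/

import Mathlib

open MeasureTheory Metric Set Filter Topology Module
open scoped Manifold ContDiff ComplexConjugate Laplacian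

namespace Spherical

/-- The ambient Euclidean space `ℝ^d`. -/
abbrev Amb (d : ℕ) : Type := EuclideanSpace ℝ (Fin d)

/-- The hypersphere `S^{d-1}`, the unit sphere of `ℝ^d`. -/
abbrev Sph (d : ℕ) : Type := sphere (0 : Amb d) 1

variable {d : ℕ}

instance instFactFinrank [h : Fact (2 ≤ d)] : Fact (finrank ℝ (Amb d) = (d - 1) + 1) :=
  ⟨by have := h.out; simp; omega⟩

/-- The surface measure of `S^{d-1}`. -/
noncomputable def surf (d : ℕ) : Measure (Sph d) := (volume : Measure (Amb d)).toSphere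

instance : IsFiniteMeasure (surf d) := inferInstanceAs (IsFiniteMeasure (volume.toSphere))

/-! ### Smooth functions and the Laplace-Beltrami operator -/

/-- The extension of `h : S^{d-1} → ℂ` to a function on `ℝ^d` which is constant along
the rays from the origin (and vanishes at the origin). -/
noncomputable def radialExt (h : Sph d → ℂ) (x : Amb d) : ℂ :=
  if hx : x = 0 then 0 else h ⟨‖x‖⁻¹ • x, by simp [norm_smul, hx]⟩

/-- The Laplace-Beltrami operator of the unit sphere: the Euclidean Laplacian of the extension
constant along rays, evaluated on the sphere. -/
noncomputable def lapBeltramiFun (h : Sph d → ℂ) : Sph d → ℂ :=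
  fun r => (Δ (radialExt h)) (r : Amb d)

instance : (surf d).IsOpenPosMeasure :=
  inferInstanceAs ((volume : Measure (Amb d)).toSphere.IsOpenPosMeasure)

theorem coe_ne_zero (r : Sph d) : (r : Amb d) ≠ 0 :=
  ne_zero_of_mem_unit_sphere r

theorem integrable_mul_cont {g : Sph d → ℂ} (hg : Integrable g (surf d)) (φ : C(Sph d, ℂ)) :
    Integrable (fun r => g r * φ r) (surf d) :=
  hg.mul_bdd (c := ‖φ‖) φ.continuous.aestronglyMeasurable
    (Eventually.of_forall fun r => φ.norm_coe_le_norm r)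

/-- Infinitely differentiable functions `S^{d-1} → ℂ`, as a subspace of all functions. -/
def smoothSubmodule (d : ℕ) [Fact (2 ≤ d)] : Submodule ℂ (Sph d → ℂ) where
  carrier := {h | ContMDiff (𝓡 (d - 1)) 𝓘(ℝ, ℂ) ∞ h}
  add_mem' hf hg := ContMDiff.add hf hg
  zero_mem' := contMDiff_const
  smul_mem' c f hf :=
    ((ContinuousLinearMap.mul ℝ ℂ c).contDiff.contMDiff (n := ∞)).comp
      (show ContMDiff (𝓡 (d - 1)) 𝓘(ℝ, ℂ) ∞ f from hf)

/-- The space `𝒮(S^{d-1}) = C^∞(S^{d-1})` of Schwartz functions. Its topology is defined below. -/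
def Schwartz (d : ℕ) [Fact (2 ≤ d)] : Type := ↥(smoothSubmodule d)

section
variable [Fact (2 ≤ d)]

noncomputable instance : AddCommGroup (Schwartz d) := inferInstanceAs (AddCommGroup (smoothSubmodule d))
noncomputable instance : Module ℂ (Schwartz d) := inferInstanceAs (Module ℂ (smoothSubmodule d))

instance : FunLike (Schwartz d) (Sph d) ℂ where
  coe h := h.1
  coe_injective := Subtype.val_injective

theorem Schwartz.contMDiff (h : Schwartz d) : ContMDiff (𝓡 (d - 1)) 𝓘(ℝ, ℂ) ∞ h := h.2

@[simp] theorem Schwartz.add_apply (f g : Schwartz d) (r : Sph d) : (f + g) r = f r + g r := rfl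

@[simp] theorem Schwartz.smul_apply (c : ℂ) (f : Schwartz d) (r : Sph d) :
    (c • f) r = c * f r := rfl

theorem contDiffAt_radialExt (h : Schwartz d) {x : Amb d} (hx : x ≠ 0) :
    ContDiffAt ℝ ∞ (radialExt h) x := by
  let U : TopologicalSpace.Opens (Amb d) := ⟨{0}ᶜ, isOpen_compl_singleton⟩
  have h1 : ContMDiff 𝓘(ℝ, Amb d) 𝓘(ℝ, Amb d) ∞ (fun y : U => ‖(y : Amb d)‖⁻¹ • (y : Amb d)) := by
    intro y
    have hy : (y : Amb d) ≠ 0 := y.2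
    exact contMDiffAt_subtype_iff (U := U) (f := fun y : Amb d => ‖y‖⁻¹ • y) |>.2
      ((((contDiffAt_norm ℝ hy).inv (norm_ne_zero_iff.2 hy)).smul contDiffAt_id).contMDiffAt)
  have hmem : ∀ y : U, ‖(y : Amb d)‖⁻¹ • (y : Amb d) ∈ sphere (0 : Amb d) 1 := fun y => by
    have hy : (y : Amb d) ≠ 0 := y.2
    simp [norm_smul, hy]
  have h2 := h.contMDiff.comp (h1.codRestrict_sphere hmem)
  have h3 : ContMDiffAt 𝓘(ℝ, Amb d) 𝓘(ℝ, ℂ) ∞ (fun y : U => radialExt h y) ⟨x, hx⟩ := by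
    refine (h2 ⟨x, hx⟩).congr_of_eventuallyEq (Eventually.of_forall fun y => ?_)
    have hy : (y : Amb d) ≠ 0 := y.2
    simp only [radialExt, dif_neg hy]
    rfl
  exact (contMDiffAt_subtype_iff (U := U) (f := radialExt h) (x := ⟨x, hx⟩) |>.1 h3).contDiffAt

theorem radialExt_add (f g : Schwartz d) : radialExt ⇑(f + g) = radialExt f + radialExt g := by
  ext x
  by_cases hx : x = 0 <;> simp [radialExt, hx]

theorem radialExt_smul (c : ℂ) (f : Schwartz d) :
    radialExt ⇑(c • f) = ContinuousLinearMap.mul ℝ ℂ c ∘ radialExt f := by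
  ext x
  by_cases hx : x = 0 <;> simp [radialExt, hx]

/-- The Laplace-Beltrami operator as an endomorphism of `𝒮(S^{d-1})`. -/
noncomputable def lapBeltrami (d : ℕ) [Fact (2 ≤ d)] : Schwartz d →ₗ[ℂ] Schwartz d where
  toFun h := ⟨lapBeltramiFun h, by
    intro r
    have h1 : ContDiffAt ℝ ∞ (Δ (radialExt h)) (r : Amb d) := by
      rw [InnerProductSpace.laplacian_eq_iteratedFDeriv_stdOrthonormalBasis]
      refine ContDiffAt.sum fun i _ => ?_
      have h2 : ContDiffAt ℝ ∞ (iteratedFDeriv ℝ 2 (radialExt h)) (r : Amb d) :=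
        (contDiffAt_radialExt h (coe_ne_zero r)).iteratedFDeriv_right (i := 2)
          (by norm_cast)
      exact (ContinuousMultilinearMap.apply ℝ (fun _ : Fin 2 => Amb d) ℂ _).contDiff.contDiffAt.comp
        _ h2
    exact ContMDiffAt.comp r h1.contMDiffAt (contMDiff_coe_sphere.contMDiffAt)⟩
  map_add' f g := by
    apply DFunLike.ext
    intro r
    have h2 : ∀ h : Schwartz d, ContDiffAt ℝ 2 (radialExt h) (r : Amb d) := fun h =>
      (contDiffAt_radialExt h (coe_ne_zero r)).of_le (WithTop.coe_le_coe.2 le_top)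
    change (Δ (radialExt ⇑(f + g))) (r : Amb d) = _
    rw [radialExt_add]
    exact (h2 f).laplacian_add (h2 g)
  map_smul' c f := by
    apply DFunLike.ext
    intro r
    have h2 : ContDiffAt ℝ 2 (radialExt f) (r : Amb d) :=
      (contDiffAt_radialExt f (coe_ne_zero r)).of_le (WithTop.coe_le_coe.2 le_top)
    change (Δ (radialExt ⇑(c • f))) (r : Amb d) = _
    rw [radialExt_smul]
    exact h2.laplacian_CLM_comp_left (l := ContinuousLinearMap.mul ℝ ℂ c)

/-- The inclusion of `𝒮(S^{d-1})` into the continuous functions. -/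
def toContₗ (d : ℕ) [Fact (2 ≤ d)] : Schwartz d →ₗ[ℂ] C(Sph d, ℂ) where
  toFun h := ⟨h, h.contMDiff.continuous⟩
  map_add' _ _ := rfl
  map_smul' _ _ := rfl

/-- The norms `‖h‖_{k,∞} = ‖(Id - Δ)^k h‖_∞`, `k ∈ ℕ`. -/
noncomputable def schwartzSeminorm (d : ℕ) [Fact (2 ≤ d)] : SeminormFamily ℂ (Schwartz d) ℕ :=
  fun k => (normSeminorm ℂ C(Sph d, ℂ)).comp (toContₗ d ∘ₗ (LinearMap.id - lapBeltrami d) ^ k)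

noncomputable instance : TopologicalSpace (Schwartz d) :=
  (schwartzSeminorm d).moduleFilterBasis.topology

theorem schwartz_withSeminorms : WithSeminorms (schwartzSeminorm d) := ⟨rfl⟩

/-- The space `𝒮'(S^{d-1})` of generalised functions, the topological dual of `𝒮(S^{d-1})`. -/
abbrev GenFun (d : ℕ) [Fact (2 ≤ d)] : Type := Schwartz d →L[ℂ] ℂ

/-- The continuous inclusion of `𝒮(S^{d-1})` into the continuous functions. -/
noncomputable def toCont (d : ℕ) [Fact (2 ≤ d)] : Schwartz d →L[ℂ] C(Sph d, ℂ) where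
  toLinearMap := toContₗ d
  cont := by
    refine WithSeminorms.continuous_normedSpace_rng C(Sph d, ℂ) schwartz_withSeminorms _
      ⟨{0}, 1, fun h => ?_⟩
    simp [schwartzSeminorm]

/-- The Dirac measure `δ_r` as a generalised function: `⟨δ_r | φ⟩ = φ(r)`. -/
noncomputable def dirac (r : Sph d) : GenFun d := (ContinuousMap.evalCLM ℂ r).comp (toCont d)

/-- An integrable function `g` as a generalised function: `⟨g | φ⟩ = ∫ g(r) φ(r) dr`. -/
noncomputable def ofIntegrable (g : Sph d → ℂ) (hg : Integrable g (surf d)) : GenFun d :=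
  ContinuousLinearMap.comp
    (LinearMap.mkContinuous
      { toFun := fun φ : C(Sph d, ℂ) => ∫ r, g r * φ r ∂(surf d)
        map_add' := fun φ ψ => by
          simp only [ContinuousMap.add_apply, mul_add]
          exact integral_add (integrable_mul_cont hg φ) (integrable_mul_cont hg ψ)
        map_smul' := fun c φ => by
          simp only [ContinuousMap.smul_apply, smul_eq_mul, RingHom.id_apply, mul_left_comm _ c]
          exact integral_const_mul c _ }
      (∫ r, ‖g r‖ ∂(surf d)) (fun φ => by
        rw [← integral_mul_const]
        refine norm_integral_le_of_norm_le (hg.norm.mul_const _) (Eventually.of_forall fun r => ?_)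
        rw [norm_mul]
        exact mul_le_mul_of_nonneg_left (φ.norm_coe_le_norm r) (norm_nonneg _)))
    (toCont d)

/-- The embedding of `ℒ²(S^{d-1})` into `𝒮'(S^{d-1})`. -/
noncomputable def ofL2 (g : Lp ℂ 2 (surf d)) : GenFun d :=
  ofIntegrable g ((Lp.memLp g).integrable (by norm_num))

theorem ofL2_apply (g : Lp ℂ 2 (surf d)) (φ : Schwartz d) :
    ofL2 g φ = ∫ r, g r * φ r ∂(surf d) := rfl

theorem ofL2_add (g g' : Lp ℂ 2 (surf d)) : ofL2 (g + g') = ofL2 g + ofL2 g' := by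
  ext φ
  refine Eq.trans ?_
    (integral_add (integrable_mul_cont ((Lp.memLp g).integrable (by norm_num)) (toCont d φ))
      (integrable_mul_cont ((Lp.memLp g').integrable (by norm_num)) (toCont d φ)))
  refine integral_congr_ae ?_
  filter_upwards [Lp.coeFn_add g g'] with r hr
  exact (congrArg (· * φ r) hr).trans (add_mul _ _ _)

theorem ofL2_smul (c : ℂ) (g : Lp ℂ 2 (surf d)) : ofL2 (c • g) = c • ofL2 g := by
  ext φ
  rw [smul_apply, ofL2_apply, ofL2_apply, smul_eq_mul, ← integral_const_mul]
  refine integral_congr_ae ?_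
  filter_upwards [Lp.coeFn_smul c g] with r hr
  rw [hr, Pi.smul_apply, smul_eq_mul, mul_assoc]

/-- The embedding of the continuous functions into `𝒮'(S^{d-1})`. -/
noncomputable def ofCont (u : C(Sph d, ℂ)) : GenFun d :=
  ofIntegrable u (u.continuous.integrable_of_hasCompactSupport (HasCompactSupport.of_compactSpace u))

/-! ### Spherical harmonics and Fourier expansion -/

/-- The inner product `⟨f, g⟩ = ∫ f(r) conj(g(r)) dr` on `𝒮(S^{d-1})`, linear in `f`. -/
noncomputable def ip (f g : Schwartz d) : ℂ := ∫ r, f r * conj (g r) ∂(surf d)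

theorem integrable_ip (f g : Schwartz d) : Integrable (fun r => f r * conj (g r)) (surf d) :=
  (f.contMDiff.continuous.mul (Complex.continuous_conj.comp
    g.contMDiff.continuous)).integrable_of_hasCompactSupport (HasCompactSupport.of_compactSpace _)

theorem ip_add_left (f f' g : Schwartz d) : ip (f + f') g = ip f g + ip f' g := by
  rw [ip, ip, ip, ← integral_add (integrable_ip f g) (integrable_ip f' g)]
  simp only [Schwartz.add_apply, add_mul]

theorem ip_smul_left (c : ℂ) (f g : Schwartz d) : ip (c • f) g = c * ip f g := by
  rw [ip, ip, ← integral_const_mul]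
  simp only [Schwartz.smul_apply, mul_assoc]

theorem ip_conj (f g : Schwartz d) : conj (ip f g) = ip g f := by
  rw [ip, ip, ← integral_conj]
  simp only [map_mul, Complex.conj_conj, mul_comm]

theorem eq_zero_of_ip_self {f : Schwartz d} (h : ip f f = 0) : f = 0 := by
  have hc : Continuous f := f.contMDiff.continuous
  have h1 : ∫ r, ‖f r‖ ^ 2 ∂(surf d) = 0 := by
    have h2 : ip f f = ((∫ r, ‖f r‖ ^ 2 ∂(surf d) : ℝ) : ℂ) := by
      rw [ip, ← integral_complex_ofReal]
      simp only [Complex.mul_conj, Complex.normSq_eq_norm_sq]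
    rw [h2] at h
    exact_mod_cast h
  have h3 := (integral_eq_zero_iff_of_nonneg (fun r => sq_nonneg ‖f r‖)
    ((hc.norm.pow 2).integrable_of_hasCompactSupport (HasCompactSupport.of_compactSpace _))).1 h1
  have h4 := ((hc.norm.pow 2).ae_eq_iff_eq (surf d) continuous_const).1 h3
  apply DFunLike.ext
  intro r
  have h5 : ‖f r‖ ^ 2 = 0 := congrFun h4 r
  exact norm_eq_zero.1 (pow_eq_zero_iff two_ne_zero |>.1 h5)

/-- `Harm_n(S^{d-1})`, the eigenspace of the Laplace-Beltrami operator for the eigenvalue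
`-n(n+d-2)`. Its elements are the spherical harmonics of order `n`. -/
noncomputable def Harm (d : ℕ) [Fact (2 ≤ d)] (n : ℕ) : Submodule ℂ (Schwartz d) :=
  End.eigenspace (lapBeltrami d) (-((n : ℂ) * ((n : ℂ) + (d : ℂ) - 2)))

/-- `q` is the `n`-th level of the Fourier expansion of `h`, i.e. its orthogonal projection onto
`Harm_n`. -/
def IsHarmPart (n : ℕ) (h q : Schwartz d) : Prop :=
  q ∈ Harm d n ∧ ∀ Y ∈ Harm d n, ip h Y = ip q Y

open Classical in
/-- The `n`-th level `∑_m ĥ_n^m Y_n^m` of the Fourier expansion of `h`, where `(Y_n^m)_m` is any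
orthonormal basis of `Harm_n` and `ĥ_n^m = ⟨h, Y_n^m⟩` (see `harmPart_eq_sum`). -/
noncomputable def harmPart (n : ℕ) (h : Schwartz d) : Schwartz d :=
  if H : ∃ q, IsHarmPart n h q then H.choose else 0

theorem IsHarmPart.unique {n : ℕ} {h q q' : Schwartz d}
    (hq : IsHarmPart n h q) (hq' : IsHarmPart n h q') : q = q' := by
  have h0 : ip (q - q') (q - q') = 0 := by
    have h1 := (hq.2 (q - q') (sub_mem hq.1 hq'.1)).symm.trans (hq'.2 _ (sub_mem hq.1 hq'.1))
    have h2 : ip (q - q' + q') (q - q') = ip (q - q') (q - q') + ip q' (q - q') := ip_add_left ..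
    rw [sub_add_cancel, h1] at h2
    exact (left_eq_add.1 (h2.trans (add_comm _ _)))
  exact sub_eq_zero.1 (eq_zero_of_ip_self h0)

/-- In any orthonormal basis of `Harm_n`, `harmPart n h` is the usual finite Fourier sum. -/
theorem harmPart_eq_sum {n N : ℕ} (Y : Fin N → Schwartz d)
    (hspan : Submodule.span ℂ (range Y) = Harm d n)
    (horth : ∀ i j, ip (Y i) (Y j) = if i = j then 1 else 0) (h : Schwartz d) :
    harmPart n h = ∑ m, ip h (Y m) • Y m := by
  have hsum : ∀ (s : Finset (Fin N)) (Z : Schwartz d),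
      ip (∑ m ∈ s, ip h (Y m) • Y m) Z = ∑ m ∈ s, ip h (Y m) * ip (Y m) Z := by
    intro s Z
    induction s using Finset.induction_on with
    | empty =>
      have := ip_smul_left 0 (0 : Schwartz d) Z
      rw [zero_smul, zero_mul] at this
      simpa using this
    | insert a s ha ih => rw [Finset.sum_insert ha, Finset.sum_insert ha, ip_add_left,
        ip_smul_left, ih]
  have key : IsHarmPart n h (∑ m, ip h (Y m) • Y m) := by
    refine ⟨Submodule.sum_mem _ fun m _ => Submodule.smul_mem _ _ ?_, fun Z hZ => ?_⟩
    · rw [← hspan]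
      exact Submodule.subset_span (mem_range_self m)
    rw [← hspan] at hZ
    have hconj : ip Z h = ip Z (∑ m, ip h (Y m) • Y m) := by
      induction hZ using Submodule.span_induction with
      | mem Z hZ =>
        obtain ⟨j, rfl⟩ := hZ
        rw [← ip_conj, ← ip_conj _ (Y j), hsum]
        simp [horth]
      | zero =>
        have h0 : ∀ g : Schwartz d, ip 0 g = 0 := fun g => by
          simpa using ip_smul_left 0 (0 : Schwartz d) g
        rw [h0, h0]
      | add Z W _ _ hZ hW => rw [ip_add_left, ip_add_left, hZ, hW]
      | smul c Z _ hZ => rw [ip_smul_left, ip_smul_left, hZ]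
    rw [← ip_conj, hconj, ip_conj]
  have H : ∃ q, IsHarmPart n h q := ⟨_, key⟩
  rw [harmPart, dif_pos H]
  exact H.choose_spec.unique key

/-! ### Pseudo-differential operators -/

/-- `D` is a spherical pseudo-differential operator with Fourier symbol `σ` and spectral growth
order `p`. -/
structure IsPseudoDiff (D : Schwartz d →ₗ[ℂ] Schwartz d) (σ : ℕ → ℝ) (p : ℝ) : Prop where
  /-- `D h = ∑_{n=0}^∞ σ_n ∑_m ĥ_n^m Y_n^m`, as a convergent series in `𝒮(S^{d-1})` -/
  series : ∀ h, Tendsto (fun N => ∑ n ∈ Finset.range N, (σ n : ℂ) • harmPart n h) atTop (𝓝 (D h))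
  finite_zeros : {n | |σ n| = 0}.Finite
  order_nonneg : 0 ≤ p
  growth : (fun n => |σ n|) =Θ[atTop] (fun n : ℕ => (n : ℝ) ^ p)

/-- `D` is positive-definite: `⟨D h, h⟩` is real and positive for `h ≠ 0`. -/
def IsPosDef (D : Schwartz d →ₗ[ℂ] Schwartz d) : Prop :=
  ∀ h, h ≠ 0 → (ip (D h) h).im = 0 ∧ 0 < (ip (D h) h).re

/-- `R` is a Hermitian square root of `D`: a self-adjoint positive semi-definite operator whose
square is `D`. -/
structure IsHermitianSqrt (D R : Schwartz d →ₗ[ℂ] Schwartz d) : Prop where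
  selfAdjoint : ∀ f g, ip (R f) g = ip f (R g)
  nonneg : ∀ f, 0 ≤ (ip (R f) f).re
  sq : R ∘ₗ R = D

/-- The action of `D` on generalised functions, `⟨D f | φ⟩ = ⟨f | D φ⟩`. (An element of the
algebraic dual of `𝒮(S^{d-1})`, since no continuity of `D` is presupposed.) -/
noncomputable def actGen (D : Schwartz d →ₗ[ℂ] Schwartz d) (f : GenFun d) : Schwartz d →ₗ[ℂ] ℂ :=
  (f : Schwartz d →ₗ[ℂ] ℂ) ∘ₗ D

/-- `s ∈ 𝒮'(S^{d-1})` is a `D`-spline: `D s = ∑_i α_i δ_{r_i}` for finitely many knots `r_i` and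
amplitudes `α_i`. -/
def IsSpline (D : Schwartz d →ₗ[ℂ] Schwartz d) (s : GenFun d) : Prop :=
  ∃ (M : ℕ) (r : Fin M → Sph d) (α : Fin M → ℂ),
    actGen D s = ((∑ i, α i • dirac (r i) : GenFun d) : Schwartz d →ₗ[ℂ] ℂ)

/-- The generalised Sobolev space `{f ∈ 𝒮' : D f ∈ ℒ²}` as a subspace of `𝒮'(S^{d-1})`. -/
noncomputable def sobolev (D : Schwartz d →ₗ[ℂ] Schwartz d) : Submodule ℂ (GenFun d) where
  carrier := {f | ∃ g : Lp ℂ 2 (surf d), actGen D f = (ofL2 g : Schwartz d →ₗ[ℂ] ℂ)}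
  add_mem' := by
    rintro f f' ⟨g, hg⟩ ⟨g', hg'⟩
    refine ⟨g + g', ?_⟩
    rw [ofL2_add, ContinuousLinearMap.toLinearMap_add, ← hg, ← hg']
    rfl
  zero_mem' := ⟨0, by
    have : ofL2 (0 : Lp ℂ 2 (surf d)) = 0 := by
      rw [← zero_smul ℂ (0 : Lp ℂ 2 (surf d)), ofL2_smul]
      exact ContinuousLinearMap.ext fun φ => zero_mul _
    rw [this]
    rfl⟩
  smul_mem' := by
    rintro c f ⟨g, hg⟩
    refine ⟨c • g, ?_⟩
    rw [ofL2_smul, ContinuousLinearMap.toLinearMap_smul, ← hg]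
    rfl

/-- The generalised Sobolev space as a bare vector space, without the topology of `𝒮'`. -/
def Sobolev (D : Schwartz d →ₗ[ℂ] Schwartz d) : Type := ↥(sobolev D)

noncomputable instance (D : Schwartz d →ₗ[ℂ] Schwartz d) : AddCommGroup (Sobolev D) :=
  inferInstanceAs (AddCommGroup (sobolev D))
noncomputable instance (D : Schwartz d →ₗ[ℂ] Schwartz d) : Module ℂ (Sobolev D) :=
  inferInstanceAs (Module ℂ (sobolev D))

/-- The generalised function underlying an element of the generalised Sobolev space. -/
def Sobolev.toGenFun {D : Schwartz d →ₗ[ℂ] Schwartz d} (f : Sobolev D) : GenFun d := f.1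

/-- The generalised Sobolev space of `D` is a reproducing kernel Hilbert space:
`⟨f, f'⟩ = ⟨D f, D f'⟩_{ℒ²}` defines an inner product on it, for which it is complete; each of its
elements is an ordinary (continuous) function, and evaluation at each point is a continuous linear
functional. (Mathlib's inner products are linear in the second argument.) -/
def IsSobolevRKHS (D : Schwartz d →ₗ[ℂ] Schwartz d) : Prop :=
  ∃ c : InnerProductSpace.Core ℂ (Sobolev D),
    (∀ (f f' : Sobolev D) (g g' : Lp ℂ 2 (surf d)),
      actGen D f.toGenFun = (ofL2 g : Schwartz d →ₗ[ℂ] ℂ) →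
      actGen D f'.toGenFun = (ofL2 g' : Schwartz d →ₗ[ℂ] ℂ) →
      c.inner f f' = inner ℂ g g') ∧
    letI : NormedAddCommGroup (Sobolev D) := c.toNormedAddCommGroup
    letI : InnerProductSpace ℂ (Sobolev D) := InnerProductSpace.ofCore c.toCore
    CompleteSpace (Sobolev D) ∧
    ∃ K : RKHS ℂ (Sobolev D) (Sph d) ℂ,
      ∀ f : Sobolev D, ∃ u : C(Sph d, ℂ), K.coeCLM f = u ∧ f.toGenFun = ofCont u

end

end Spherical

open Spherical

/-! Everything is diagonal on spherical harmonics: D acts on Harm_n as σ_n, so its root R has to act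
as √σ_n, and ρ = R⁻¹ as 1/√σ_n = O(n^(-p/2)). Testing positivity of D on one nonzero harmonic of
each order gives σ_n > 0. If R is a Hermitian root and Y ∈ Harm_n, then Z = R Y - √σ_n Y satisfies R
Z = -√σ_n Z, so positivity of R forces Z = 0; self-adjointness then fixes every Fourier part of R f
(`IsHermitianSqrt.eq_multiplier`). That the parts determine a smooth function is not deduced from
density of the harmonics but from the hypotheses: if all parts of f vanish, the series for D f
vanishes, so f = 0 by positive-definiteness (`IsPseudoDiff.ext_harmPart`).

Multipliers exist because rapidly decreasing series of harmonics converge in 𝒮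
(`RapidDecay.tendsto_sum`). On the sphere, Δ is half the sum of the squares of the infinitesimal
rotations L_ij = x_i ∂_j - x_j ∂_i. These commute with Δ, hence preserve each Harm_n, and cost only
a factor of order n in norm. Every partial derivative of a function constant along rays is a
combination of rotations, so differentiating such a series termwise produces series of the same
kind.

The analytic core is that ρ maps ℒ² boundedly into the continuous functions when p > d - 1
(`exists_norm_toCont_multiplier_le`). It rests on a Nikolskii inequality, ‖∑_{n≤N} f_n‖_∞² ≤ C
N^(d-1) ∑ ‖f_n‖₂² (`exists_norm_sq_sum_le`): the function ∑ |x|^n f_n is harmonic off the origin,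
and its value at a point of the sphere is controlled by its average over a ball of radius 1/(2N),
contained in a thin shell on which the powers |x|^n with n ≤ N are bounded. On the dyadic block 2^j
≤ n < 2^(j+1) this gives the factor 2^(j(d-1-p)/2), which is summable. Handling whole blocks
matters: the same bound applied order by order, with Cauchy-Schwarz, would require p > d.

Finally ρ extends to ℒ² → C, and the f with R f = g ∈ ℒ² is exactly the continuous function ρ g. So
the Sobolev space is an isometric copy of ℒ² whose point evaluations are bounded
(`IsSmoothingInverse.isSobolevRKHS`). For a spline s, ⟨R s | φ⟩ = ⟨s | D ρ φ⟩ = ∑ α_i (ρ φ)(r_i) is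
bounded in the ℒ² norm of φ, and the Riesz representation theorem puts R s in ℒ². -/

namespace Spherical

variable {d : ℕ}

/-! ### Coordinate derivatives away from the origin -/

/-- The `i`-th coordinate, as a complex-valued function. -/
def crd (i : Fin d) (x : Amb d) : ℂ := (x i : ℂ)

/-- The `i`-th partial derivative. -/
noncomputable def pd (i : Fin d) (F : Amb d → ℂ) (x : Amb d) : ℂ :=
  fderiv ℝ F x (EuclideanSpace.single i 1)

/-- The infinitesimal rotation `x_i ∂_j - x_j ∂_i`. -/
noncomputable def rot (i j : Fin d) (F : Amb d → ℂ) (x : Amb d) : ℂ :=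
  crd i x * pd j F x - crd j x * pd i F x

/-- The Euler operator `∑ x_i ∂_i`. -/
noncomputable def euler (F : Amb d → ℂ) (x : Amb d) : ℂ := ∑ i, crd i x * pd i F x

/-- The Euclidean Laplacian in coordinates. -/
noncomputable def lap (F : Amb d → ℂ) (x : Amb d) : ℂ := ∑ i, pd i (pd i F) x

/-- Smoothness on the complement of the origin. -/
def SmoothOff (F : Amb d → ℂ) : Prop := ∀ x ≠ 0, ContDiffAt ℝ ∞ F x

theorem contDiff_crd (i : Fin d) {n : WithTop ℕ∞} : ContDiff ℝ n (crd i : Amb d → ℂ) :=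
  Complex.ofRealCLM.contDiff.comp (EuclideanSpace.proj i : Amb d →L[ℝ] ℝ).contDiff

theorem ContDiffAt.pd {F : Amb d → ℂ} {x : Amb d} (h : ContDiffAt ℝ ∞ F x) (i : Fin d) :
    ContDiffAt ℝ ∞ (pd i F) x :=
  (h.fderiv_right (m := ∞) (by simp)).clm_apply contDiffAt_const

theorem ContDiffAt.rot {F : Amb d → ℂ} {x : Amb d} (h : ContDiffAt ℝ ∞ F x) (i j : Fin d) :
    ContDiffAt ℝ ∞ (rot i j F) x :=
  ((contDiff_crd i).contDiffAt.mul (ContDiffAt.pd h j)).sub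
    ((contDiff_crd j).contDiffAt.mul (ContDiffAt.pd h i))

theorem SmoothOff.pd {F : Amb d → ℂ} (h : SmoothOff F) (i : Fin d) : SmoothOff (pd i F) :=
  fun x hx => ContDiffAt.pd (h x hx) i

theorem SmoothOff.rot {F : Amb d → ℂ} (h : SmoothOff F) (i j : Fin d) : SmoothOff (rot i j F) :=
  fun x hx => ContDiffAt.rot (h x hx) i j

theorem SmoothOff.mul {F G : Amb d → ℂ} (h : SmoothOff F) (h' : SmoothOff G) :
    SmoothOff (fun x => F x * G x) :=
  fun x hx => (h x hx).mul (h' x hx)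

theorem smoothOff_norm_pow (n : ℕ) : SmoothOff (fun x : Amb d => ((‖x‖ ^ n : ℝ) : ℂ)) :=
  fun _ hx => Complex.ofRealCLM.contDiff.contDiffAt.comp _ ((contDiffAt_norm ℝ hx).pow n)

theorem SmoothOff.differentiableAt {F : Amb d → ℂ} (h : SmoothOff F) {x : Amb d} (hx : x ≠ 0) :
    DifferentiableAt ℝ F x :=
  (h x hx).differentiableAt (by simp)

theorem eventually_ne_zero {x : Amb d} (hx : x ≠ 0) : ∀ᶠ y in 𝓝 x, y ≠ 0 :=
  isOpen_compl_singleton.mem_nhds hx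

theorem pd_congr {F G : Amb d → ℂ} {x : Amb d} (h : F =ᶠ[𝓝 x] G) (i : Fin d) :
    pd i F x = pd i G x := by
  rw [pd, pd, h.fderiv_eq]

theorem rot_congr {F G : Amb d → ℂ} {x : Amb d} (h : F =ᶠ[𝓝 x] G) (i j : Fin d) :
    rot i j F x = rot i j G x := by
  rw [rot, rot, pd_congr h, pd_congr h]

theorem rot_congr_off {F G : Amb d → ℂ} {x : Amb d} (hx : x ≠ 0) (h : ∀ y ≠ 0, F y = G y)
    (i j : Fin d) : rot i j F x = rot i j G x :=
  rot_congr ((eventually_ne_zero hx).mono h) i j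

theorem euler_congr_off {F G : Amb d → ℂ} {x : Amb d} (hx : x ≠ 0) (h : ∀ y ≠ 0, F y = G y) :
    euler F x = euler G x := by
  simp only [euler, pd_congr ((eventually_ne_zero hx).mono h)]

theorem lap_congr_off {F G : Amb d → ℂ} {x : Amb d} (hx : x ≠ 0) (h : ∀ y ≠ 0, F y = G y) :
    lap F x = lap G x := by
  refine Finset.sum_congr rfl fun i _ => pd_congr ((eventually_ne_zero hx).mono fun y hy => ?_) i
  exact pd_congr ((eventually_ne_zero hy).mono h) i

theorem pd_add {F G : Amb d → ℂ} {x : Amb d} (hF : DifferentiableAt ℝ F x)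
    (hG : DifferentiableAt ℝ G x) (i : Fin d) :
    pd i (fun y => F y + G y) x = pd i F x + pd i G x := by
  simp only [pd, fderiv_fun_add hF hG, add_apply]

theorem pd_sub {F G : Amb d → ℂ} {x : Amb d} (hF : DifferentiableAt ℝ F x)
    (hG : DifferentiableAt ℝ G x) (i : Fin d) :
    pd i (fun y => F y - G y) x = pd i F x - pd i G x := by
  simp only [pd, fderiv_fun_sub hF hG, sub_apply]

theorem pd_sum {ι : Type*} (s : Finset ι) {F : ι → Amb d → ℂ} {x : Amb d}
    (hF : ∀ k ∈ s, DifferentiableAt ℝ (F k) x) (i : Fin d) :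
    pd i (fun y => ∑ k ∈ s, F k y) x = ∑ k ∈ s, pd i (F k) x := by
  simp only [pd, fderiv_fun_sum hF, _root_.sum_apply]

theorem pd_mul {F G : Amb d → ℂ} {x : Amb d} (hF : DifferentiableAt ℝ F x)
    (hG : DifferentiableAt ℝ G x) (i : Fin d) :
    pd i (fun y => F y * G y) x = pd i F x * G x + F x * pd i G x := by
  simp only [pd, fderiv_fun_mul hF hG, add_apply, smul_apply, smul_eq_mul]
  ring

theorem pd_const_mul {F : Amb d → ℂ} {x : Amb d} (c : ℂ) (hF : DifferentiableAt ℝ F x)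
    (i : Fin d) : pd i (fun y => c * F y) x = c * pd i F x := by
  rw [pd_mul (differentiableAt_const c) hF]
  simp [pd]

theorem differentiableAt_crd (i : Fin d) (x : Amb d) : DifferentiableAt ℝ (crd i) x :=
  (contDiff_crd i (n := 1)).contDiffAt.differentiableAt one_ne_zero

theorem pd_crd (i j : Fin d) (x : Amb d) : pd i (crd j) x = if i = j then 1 else 0 := by
  have h : (crd j : Amb d → ℂ) =
      (Complex.ofRealCLM.comp (EuclideanSpace.proj j : Amb d →L[ℝ] ℝ) : Amb d → ℂ) := rfl
  rw [pd, h, ContinuousLinearMap.fderiv]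
  simp [eq_comm, apply_ite Complex.ofReal]

theorem pd_conj (F : Amb d → ℂ) (x : Amb d) (i : Fin d) :
    pd i (fun y => conj (F y)) x = conj (pd i F x) := by
  have := Complex.conjCLE.comp_fderiv (f := F) (x := x)
  have h2 : (fun y => conj (F y)) = Complex.conjCLE ∘ F := by ext; simp
  rw [pd, h2, this]
  simp [pd]

theorem fderiv_apply_eq_sum (F : Amb d → ℂ) (x v : Amb d) :
    fderiv ℝ F x v = ∑ i, crd i v * pd i F x := by
  conv_lhs => rw [← (EuclideanSpace.basisFun (Fin d) ℝ).sum_repr v, map_sum]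
  simp [pd, crd]

theorem euler_eq_fderiv (F : Amb d → ℂ) (x : Amb d) : euler F x = fderiv ℝ F x x :=
  (fderiv_apply_eq_sum F x x).symm

theorem pd_comm {F : Amb d → ℂ} {x : Amb d} (h : ContDiffAt ℝ ∞ F x) (i j : Fin d) :
    pd i (pd j F) x = pd j (pd i F) x := by
  have h2 : ∀ i j : Fin d, pd i (pd j F) x =
      fderiv ℝ (fderiv ℝ F) x (EuclideanSpace.single i 1) (EuclideanSpace.single j 1) := by
    intro i j
    have h3 : DifferentiableAt ℝ (fderiv ℝ F) x :=
      (h.fderiv_right (m := ∞) (by simp)).differentiableAt (by simp)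
    change fderiv ℝ (fun y => fderiv ℝ F y _) x _ = _
    rw [fderiv_clm_apply h3 (differentiableAt_const _)]
    simp
  rw [h2, h2]
  exact (h.isSymmSndFDerivAt (by
    rw [minSmoothness_of_isRCLikeNormedField]
    exact WithTop.coe_le_coe.2 le_top)).eq _ _

theorem pd_rot {F : Amb d → ℂ} {x : Amb d} (h : ContDiffAt ℝ ∞ F x) (i j k : Fin d) :
    pd k (rot i j F) x = ((if k = i then 1 else 0) * pd j F x + crd i x * pd k (pd j F) x) -
      ((if k = j then 1 else 0) * pd i F x + crd j x * pd k (pd i F) x) := by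
  have hd : ∀ i, DifferentiableAt ℝ (pd i F) x := fun i =>
    (ContDiffAt.pd h i).differentiableAt (by simp)
  change pd k (fun y => crd i y * pd j F y - crd j y * pd i F y) x = _
  rw [pd_sub ((differentiableAt_crd i x).fun_mul (hd j)) ((differentiableAt_crd j x).fun_mul (hd i)),
    pd_mul (differentiableAt_crd i x) (hd j), pd_mul (differentiableAt_crd j x) (hd i),
    pd_crd, pd_crd]

theorem pd_euler {F : Amb d → ℂ} {x : Amb d} (h : ContDiffAt ℝ ∞ F x) (k : Fin d) :
    pd k (euler F) x = pd k F x + ∑ i, crd i x * pd k (pd i F) x := by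
  have hd : ∀ i, DifferentiableAt ℝ (pd i F) x := fun i =>
    (ContDiffAt.pd h i).differentiableAt (by simp)
  change pd k (fun y => ∑ i, crd i y * pd i F y) x = _
  rw [pd_sum _ fun i _ => (differentiableAt_crd i x).fun_mul (hd i)]
  simp only [pd_mul (differentiableAt_crd _ x) (hd _), pd_crd, Finset.sum_add_distrib]
  simp

/-! ### The Euclidean Laplacian through rotations and the Euler operator -/

theorem sum_crd_sq (x : Amb d) : ∑ i, crd i x * crd i x = ((‖x‖ ^ 2 : ℝ) : ℂ) := by
  rw [EuclideanSpace.norm_sq_eq]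
  simp [crd, sq]

/-- The Laplacian in polar coordinates. -/
theorem norm_sq_mul_lap {F : Amb d → ℂ} {x : Amb d} (h : ContDiffAt ℝ ∞ F x) :
    ((‖x‖ ^ 2 : ℝ) : ℂ) * lap F x = (1 / 2) * ∑ i, ∑ j, rot i j (rot i j F) x
      + ((d : ℂ) - 2) * euler F x + euler (euler F) x := by
  -- `X` is the Hessian contracted twice with x. It enters the squared Euler operator with
  -- coefficient 1 and half the sum of squared rotations with coefficient -1, so it cancels. The
  -- factor 1/2 appears because each pair {i, j} is counted twice.
  set X := ∑ i, ∑ j, crd i x * crd j x * pd i (pd j F) x with hX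
  have h1 : euler (euler F) x = euler F x + X := by
    rw [euler]
    simp only [pd_euler h, mul_add, Finset.sum_add_distrib, Finset.mul_sum, hX, mul_assoc]
    rfl
  have hX' : ∑ i, ∑ j, crd i x * crd j x * pd j (pd i F) x = X := by
    simp only [hX, pd_comm h]
  have hL : ∑ i, ∑ j, crd i x * crd i x * pd j (pd j F) x = ((‖x‖ ^ 2 : ℝ) : ℂ) * lap F x := by
    rw [← sum_crd_sq, lap, Finset.sum_mul_sum]
  have hL' : ∑ i, ∑ j, crd j x * crd j x * pd i (pd i F) x = ((‖x‖ ^ 2 : ℝ) : ℂ) * lap F x := by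
    rw [Finset.sum_comm, hL]
  have hE : ∑ i : Fin d, ∑ _j : Fin d, crd i x * pd i F x = d * euler F x := by
    rw [euler]
    simp [Finset.mul_sum]
  have hE' : ∑ _i : Fin d, ∑ j : Fin d, crd j x * pd j F x = d * euler F x := by
    rw [euler]
    simp
  have hδ : ∑ i : Fin d, ∑ j : Fin d, (if j = i then crd i x * pd j F x else 0) = euler F x := by
    simp [euler]
  have hδ' : ∑ i : Fin d, ∑ j : Fin d, (if i = j then crd j x * pd i F x else 0) = euler F x := by
    simp [euler]
  have h2 : ∑ i, ∑ j, rot i j (rot i j F) x =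
      2 * (((‖x‖ ^ 2 : ℝ) : ℂ) * lap F x) + (2 - 2 * d) * euler F x - 2 * X := by
    have h3 : ∀ i j, rot i j (rot i j F) x =
        (if j = i then crd i x * pd j F x else 0) + crd i x * crd i x * pd j (pd j F) x
        - crd i x * pd i F x - crd i x * crd j x * pd j (pd i F) x
        - crd j x * pd j F x - crd i x * crd j x * pd i (pd j F) x
        + (if i = j then crd j x * pd i F x else 0) + crd j x * crd j x * pd i (pd i F) x := by
      intro i j
      rw [rot, pd_rot h, pd_rot h]
      simp only [if_true]
      split_ifs <;> ring
    simp only [h3, Finset.sum_add_distrib, Finset.sum_sub_distrib]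
    rw [hδ, hδ', hL, hL', hE, hE', hX', ← hX]
    ring
  rw [h2, h1]
  ring

theorem laplacian_eq_lap {F : Amb d → ℂ} {x : Amb d} (h : ContDiffAt ℝ ∞ F x) :
    (Δ F) x = lap F x := by
  rw [InnerProductSpace.laplacian_eq_iteratedFDeriv_orthonormalBasis F
    (EuclideanSpace.basisFun (Fin d) ℝ)]
  refine Finset.sum_congr rfl fun i _ => ?_
  have h3 : DifferentiableAt ℝ (fderiv ℝ F) x :=
    (h.fderiv_right (m := ∞) (by simp)).differentiableAt (by simp)
  rw [iteratedFDeriv_two_apply]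
  change _ = fderiv ℝ (fun y => fderiv ℝ F y _) x _
  rw [fderiv_clm_apply h3 (differentiableAt_const _)]
  simp

/-- Infinitesimal rotations commute with the Laplacian. -/
theorem lap_rot {F : Amb d → ℂ} (h : SmoothOff F) {x : Amb d} (hx : x ≠ 0) (i j : Fin d) :
    lap (rot i j F) x = rot i j (lap F) x := by
  have hL : ∀ k, pd k (lap F) x = ∑ l, pd l (pd l (pd k F)) x := by
    intro k
    change pd k (fun y => ∑ l, pd l (pd l F) y) x = _
    rw [pd_sum _ fun l _ => ((h.pd l).pd l).differentiableAt hx]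
    refine Finset.sum_congr rfl fun l _ => ?_
    rw [pd_comm ((h.pd l) x hx)]
    exact pd_congr ((eventually_ne_zero hx).mono fun y hy => pd_comm (h y hy) _ _) _
  have h2 : ∀ k, pd k (pd k (rot i j F)) x =
      (crd i x * pd k (pd k (pd j F)) x + (if k = i then 2 * pd k (pd j F) x else 0)) -
      (crd j x * pd k (pd k (pd i F)) x + (if k = j then 2 * pd k (pd i F) x else 0)) := by
    intro k
    have hd : ∀ i, DifferentiableAt ℝ (pd i F) x := fun i => (h.pd i).differentiableAt hx
    have hd2 : ∀ i k, DifferentiableAt ℝ (pd k (pd i F)) x := fun i k =>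
      ((h.pd i).pd k).differentiableAt hx
    rw [pd_congr ((eventually_ne_zero hx).mono fun y hy => pd_rot (h y hy) i j k),
      pd_sub ((((differentiableAt_const _).fun_mul (hd j))).fun_add ((differentiableAt_crd i x).fun_mul (hd2 j k)))
        ((((differentiableAt_const _).fun_mul (hd i))).fun_add ((differentiableAt_crd j x).fun_mul (hd2 i k))),
      pd_add ((differentiableAt_const _).fun_mul (hd j)) ((differentiableAt_crd i x).fun_mul (hd2 j k)),
      pd_add ((differentiableAt_const _).fun_mul (hd i)) ((differentiableAt_crd j x).fun_mul (hd2 i k)),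
      pd_const_mul _ (hd j), pd_const_mul _ (hd i),
      pd_mul (differentiableAt_crd i x) (hd2 j k), pd_mul (differentiableAt_crd j x) (hd2 i k),
      pd_crd, pd_crd]
    split_ifs <;> ring
  rw [lap, rot, hL, hL]
  simp only [h2, Finset.sum_sub_distrib, Finset.sum_add_distrib, Finset.sum_ite_eq',
    Finset.mem_univ, if_true, Finset.mul_sum]
  -- Differentiating the coefficients x_i and x_j leaves the cross terms 2 ∂_i ∂_j F and -2 ∂_j ∂_i
  -- F, which cancel by symmetry of second derivatives.
  rw [pd_comm (h x hx)]
  ring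

theorem rot_mul {F G : Amb d → ℂ} {x : Amb d} (hF : DifferentiableAt ℝ F x)
    (hG : DifferentiableAt ℝ G x) (i j : Fin d) :
    rot i j (fun y => F y * G y) x = rot i j F x * G x + F x * rot i j G x := by
  rw [rot, pd_mul hF hG, pd_mul hF hG, rot, rot]
  ring

theorem euler_mul {F G : Amb d → ℂ} {x : Amb d} (hF : DifferentiableAt ℝ F x)
    (hG : DifferentiableAt ℝ G x) :
    euler (fun y => F y * G y) x = euler F x * G x + F x * euler G x := by
  simp only [euler, pd_mul hF hG, Finset.sum_mul, Finset.mul_sum, ← Finset.sum_add_distrib]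
  exact Finset.sum_congr rfl fun i _ => by ring

theorem pd_comp_norm_sq {a : ℝ → ℝ} {x : Amb d} (ha : DifferentiableAt ℝ a (‖x‖ ^ 2))
    (i : Fin d) :
    pd i (fun y => ((a (‖y‖ ^ 2) : ℝ) : ℂ)) x = 2 * (deriv a (‖x‖ ^ 2) : ℝ) * crd i x := by
  have h1 : HasFDerivAt (fun y : Amb d => ((a (‖y‖ ^ 2) : ℝ) : ℂ))
      (Complex.ofRealCLM.comp (deriv a (‖x‖ ^ 2) • (2 • innerSL ℝ x))) x :=
    Complex.ofRealCLM.hasFDerivAt.comp x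
      (ha.hasDerivAt.comp_hasFDerivAt x (hasStrictFDerivAt_norm_sq x).hasFDerivAt)
  rw [pd, h1.fderiv]
  simp [crd, EuclideanSpace.inner_single_right]
  ring

theorem rot_comp_norm_sq {a : ℝ → ℝ} {x : Amb d} (ha : DifferentiableAt ℝ a (‖x‖ ^ 2))
    (i j : Fin d) : rot i j (fun y => ((a (‖y‖ ^ 2) : ℝ) : ℂ)) x = 0 := by
  rw [rot, pd_comp_norm_sq ha, pd_comp_norm_sq ha]
  ring

theorem rot_norm_pow (n : ℕ) {x : Amb d} (hx : x ≠ 0) (i j : Fin d) :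
    rot i j (fun y => ((‖y‖ ^ n : ℝ) : ℂ)) x = 0 := by
  -- Read as √t ^ n at t = ‖y‖², the power is a function of the smooth squared norm, and √ is
  -- differentiable there because x ≠ 0.
  have h : (fun y : Amb d => ((‖y‖ ^ n : ℝ) : ℂ)) =
      fun y => (((fun t : ℝ => √t ^ n) (‖y‖ ^ 2) : ℝ) : ℂ) := by
    ext y
    simp [Real.sqrt_sq (norm_nonneg y)]
  rw [h]
  exact rot_comp_norm_sq (a := fun t => √t ^ n)
    ((Real.hasDerivAt_sqrt (by positivity)).differentiableAt.fun_pow n) i j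

theorem euler_norm_pow (n : ℕ) {x : Amb d} (hx : x ≠ 0) :
    euler (fun y => ((‖y‖ ^ n : ℝ) : ℂ)) x = n * ((‖x‖ ^ n : ℝ) : ℂ) := by
  have h : (fun y : Amb d => ((‖y‖ ^ n : ℝ) : ℂ)) =
      fun y => (((fun t : ℝ => √t ^ n) (‖y‖ ^ 2) : ℝ) : ℂ) := by
    ext y
    simp [Real.sqrt_sq (norm_nonneg y)]
  have hs := (Real.hasDerivAt_sqrt (x := ‖x‖ ^ 2) (by positivity)).fun_pow n
  have hn : ‖x‖ ≠ 0 := norm_ne_zero_iff.2 hx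
  rw [h, euler]
  simp only [pd_comp_norm_sq (a := fun t => √t ^ n) hs.differentiableAt]
  rw [hs.deriv, Real.sqrt_sq (norm_nonneg x)]
  have hc : ∀ (c : ℂ) (i : Fin d), crd i x * (c * crd i x) = c * (crd i x * crd i x) :=
    fun c i => mul_left_comm _ _ _
  simp only [hc, ← Finset.mul_sum, sum_crd_sq]
  -- The derivative contains the exponent n - 1 with truncated subtraction, so n = 0 is separate.
  rcases n with _ | n
  · simp
  push_cast
  have hn' : (‖x‖ : ℂ) ≠ 0 := by exact_mod_cast hn
  field_simp
  ring

end Spherical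

namespace Spherical

variable {d : ℕ}

/-! ### Infinitesimal rotations on the sphere -/

theorem radialExt_coe (h : Sph d → ℂ) (r : Sph d) : radialExt h r = h r := by
  have h1 : ‖(r : Amb d)‖ = 1 := norm_eq_of_mem_sphere r
  rw [radialExt, dif_neg (coe_ne_zero r)]
  congr 1
  ext1
  simp [h1]

theorem radialExt_smul_pos (h : Sph d → ℂ) {t : ℝ} (ht : 0 < t) (x : Amb d) :
    radialExt h (t • x) = radialExt h x := by
  by_cases hx : x = 0
  · simp [hx]
  have htx : t • x ≠ 0 := smul_ne_zero ht.ne' hx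
  rw [radialExt, radialExt, dif_neg hx, dif_neg htx]
  congr 1
  ext1
  simp only [norm_smul, Real.norm_of_nonneg ht.le, smul_smul]
  congr 1
  field_simp

theorem exists_sphere_smul {x : Amb d} (hx : x ≠ 0) : ∃ r : Sph d, x = ‖x‖ • (r : Amb d) :=
  ⟨⟨‖x‖⁻¹ • x, by simp [norm_smul, hx]⟩, by simp [smul_smul, hx]⟩

theorem smoothOff_lap {F : Amb d → ℂ} (h : SmoothOff F) : SmoothOff (lap F) :=
  fun x hx => ContDiffAt.sum fun i _ => ((h.pd i).pd i) x hx

variable [Fact (2 ≤ d)]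

theorem smoothOff_radialExt (f : Schwartz d) : SmoothOff (radialExt f) :=
  fun _ hx => contDiffAt_radialExt f hx

/-- A function smooth away from the origin restricts to a smooth function on the sphere. -/
def SmoothOff.restr {F : Amb d → ℂ} (hF : SmoothOff F) : Schwartz d :=
  ⟨fun r => F r, fun r =>
    ContMDiffAt.comp r (hF r (coe_ne_zero r)).contMDiffAt (contMDiff_coe_sphere.contMDiffAt)⟩

@[simp] theorem SmoothOff.restr_apply {F : Amb d → ℂ} (hF : SmoothOff F) (r : Sph d) :
    hF.restr r = F r := rfl

/-- The infinitesimal rotation `x_i ∂_j - x_j ∂_i` on the sphere. -/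
noncomputable def sphRot (i j : Fin d) : Schwartz d →ₗ[ℂ] Schwartz d where
  toFun f := ((smoothOff_radialExt f).rot i j).restr
  map_add' f g := by
    apply DFunLike.ext
    intro r
    have hd : ∀ f : Schwartz d, DifferentiableAt ℝ (radialExt f) (r : Amb d) := fun f =>
      (smoothOff_radialExt f).differentiableAt (coe_ne_zero r)
    simp only [SmoothOff.restr_apply, Schwartz.add_apply, rot, radialExt_add]
    have := pd_add (hd f) (hd g)
    simp only [pd, Pi.add_def] at this ⊢
    rw [this, this]
    ring
  map_smul' c f := by
    apply DFunLike.ext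
    intro r
    have hd : DifferentiableAt ℝ (radialExt f) (r : Amb d) :=
      (smoothOff_radialExt f).differentiableAt (coe_ne_zero r)
    simp only [SmoothOff.restr_apply, RingHom.id_apply, Schwartz.smul_apply, rot, radialExt_smul]
    have := pd_const_mul c hd
    change ∀ i, pd i (ContinuousLinearMap.mul ℝ ℂ c ∘ radialExt f) _ = _ at this
    rw [this, this]
    ring

theorem sphRot_apply (i j : Fin d) (f : Schwartz d) (r : Sph d) :
    sphRot i j f r = rot i j (radialExt f) r := rfl

theorem pd_radialExt_smul (f : Schwartz d) {t : ℝ} (ht : 0 < t) (x : Amb d) (i : Fin d) :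
    t * pd i (radialExt f) (t • x) = pd i (radialExt f) x := by
  have h1 : (fun y => radialExt f (t • y)) = radialExt f :=
    funext fun y => radialExt_smul_pos f ht y
  have h2 := fderiv_comp_smul (𝕜 := ℝ) (f := radialExt f) (x := x) t
  rw [h1] at h2
  rw [pd, pd, h2]
  simp

/-- The coefficients of a rotation have degree 1 and the first derivatives of a degree 0 function
have degree -1, so the rotated extension is again constant along rays. Hence rotations on the sphere
can be iterated as rotations of the ambient space. -/
theorem radialExt_sphRot (i j : Fin d) (f : Schwartz d) {x : Amb d} (hx : x ≠ 0) :
    radialExt (sphRot i j f) x = rot i j (radialExt f) x := by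
  obtain ⟨r, hr⟩ := exists_sphere_smul hx
  have ht : 0 < ‖x‖ := norm_pos_iff.2 hx
  generalize ‖x‖ = t at hr ht
  subst hr
  rw [radialExt_smul_pos _ ht, radialExt_coe, sphRot_apply, rot, rot]
  rw [← pd_radialExt_smul f ht _ i, ← pd_radialExt_smul f ht _ j]
  simp [crd]
  ring

theorem euler_radialExt (f : Schwartz d) {x : Amb d} (hx : x ≠ 0) :
    euler (radialExt f) x = 0 := by
  have hd : HasFDerivAt (radialExt f) (fderiv ℝ (radialExt f) x) ((1 : ℝ) • x) := by
    rw [one_smul]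
    exact ((smoothOff_radialExt f).differentiableAt hx).hasFDerivAt
  have h1 : HasDerivAt (fun t : ℝ => t • x) x 1 := by
    simpa using (hasDerivAt_id (1 : ℝ)).smul_const x
  have h2 : HasDerivAt (fun t : ℝ => radialExt f (t • x)) (fderiv ℝ (radialExt f) x x) 1 :=
    hd.comp_hasDerivAt (1 : ℝ) (f := fun t : ℝ => t • x) h1
  have h3 : HasDerivAt (fun t : ℝ => radialExt f (t • x)) 0 1 := by
    refine (hasDerivAt_const (1 : ℝ) (radialExt f x)).congr_of_eventuallyEq ?_
    filter_upwards [lt_mem_nhds one_pos] with t ht using radialExt_smul_pos f ht x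
  rw [euler_eq_fderiv, h2.unique h3]

theorem euler_euler_radialExt (f : Schwartz d) {x : Amb d} (hx : x ≠ 0) :
    euler (euler (radialExt f)) x = 0 := by
  rw [euler_congr_off hx (G := fun _ => 0) fun y hy => euler_radialExt f hy]
  simp [euler, pd]

theorem rot_rot_radialExt (i j : Fin d) (f : Schwartz d) {x : Amb d} (hx : x ≠ 0) :
    rot i j (rot i j (radialExt f)) x = radialExt (sphRot i j (sphRot i j f)) x := by
  rw [radialExt_sphRot _ _ _ hx]
  exact rot_congr_off hx (fun y hy => (radialExt_sphRot i j f hy).symm) i j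

theorem Schwartz.sum_apply {ι : Type*} (s : Finset ι) (f : ι → Schwartz d) (r : Sph d) :
    (∑ i ∈ s, f i) r = ∑ i ∈ s, f i r :=
  map_sum ((LinearMap.proj r : (Sph d → ℂ) →ₗ[ℂ] ℂ) ∘ₗ (smoothSubmodule d).subtype) f s

theorem lapBeltrami_apply (f : Schwartz d) (r : Sph d) :
    lapBeltrami d f r = lap (radialExt f) r :=
  laplacian_eq_lap (contDiffAt_radialExt f (coe_ne_zero r))

/-- The Euler operator kills functions constant along rays, so on the unit sphere only the rotation
part of the polar formula survives. Symmetry, commutation and termwise application of Δ are all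
obtained from this form. -/
theorem lapBeltrami_eq_sum (f : Schwartz d) :
    lapBeltrami d f = (1 / 2 : ℂ) • ∑ i, ∑ j, sphRot i j (sphRot i j f) := by
  apply DFunLike.ext
  intro r
  have hr : (r : Amb d) ≠ 0 := coe_ne_zero r
  have h := norm_sq_mul_lap (contDiffAt_radialExt f hr)
  have h1 : ‖(r : Amb d)‖ = 1 := norm_eq_of_mem_sphere r
  rw [euler_euler_radialExt f hr, euler_radialExt f hr, h1] at h
  simp only [rot_rot_radialExt _ _ f hr, radialExt_coe] at h
  rw [lapBeltrami_apply]
  simp only [Schwartz.smul_apply, Schwartz.sum_apply]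
  simpa using h

theorem radialExt_sum {ι : Type*} (s : Finset ι) (f : ι → Schwartz d) (x : Amb d) :
    radialExt ⇑(∑ i ∈ s, f i) x = ∑ i ∈ s, radialExt (f i) x := by
  by_cases hx : x = 0 <;> simp [radialExt, hx, Schwartz.sum_apply]

theorem radialExt_smul_apply (c : ℂ) (f : Schwartz d) (x : Amb d) :
    radialExt ⇑(c • f) x = c * radialExt f x := by
  rw [radialExt_smul]
  rfl

theorem radialExt_lapBeltrami (f : Schwartz d) {x : Amb d} (hx : x ≠ 0) :
    radialExt (lapBeltrami d f) x = ((‖x‖ ^ 2 : ℝ) : ℂ) * lap (radialExt f) x := by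
  rw [norm_sq_mul_lap (contDiffAt_radialExt f hx), lapBeltrami_eq_sum, euler_radialExt f hx,
    euler_euler_radialExt f hx, radialExt_smul_apply, radialExt_sum]
  simp only [radialExt_sum, rot_rot_radialExt _ _ f hx]
  ring

/-- Rotations commute with the Euclidean Laplacian and kill the factor ‖x‖² that relates the
Laplacian of the extension to the extension of Δ f. -/
theorem sphRot_lapBeltrami (i j : Fin d) (f : Schwartz d) :
    sphRot i j (lapBeltrami d f) = lapBeltrami d (sphRot i j f) := by
  apply DFunLike.ext
  intro r
  have hr : (r : Amb d) ≠ 0 := coe_ne_zero r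
  have h1 : ‖(r : Amb d)‖ = 1 := norm_eq_of_mem_sphere r
  rw [sphRot_apply, rot_congr_off hr (fun y hy => radialExt_lapBeltrami f hy),
    rot_mul ((smoothOff_norm_pow 2).differentiableAt hr)
      ((smoothOff_lap (smoothOff_radialExt f)).differentiableAt hr), rot_norm_pow 2 hr, h1,
    ← lap_rot (smoothOff_radialExt f) hr, lapBeltrami_apply,
    lap_congr_off hr (fun y hy => radialExt_sphRot i j f hy)]
  simp

/-! ### Solid spherical harmonics -/

/-- The extension of `f` to a function homogeneous of degree `n`. -/
noncomputable def solid (n : ℕ) (f : Schwartz d) (x : Amb d) : ℂ :=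
  ((‖x‖ ^ n : ℝ) : ℂ) * radialExt f x

theorem smoothOff_solid (n : ℕ) (f : Schwartz d) : SmoothOff (solid n f) :=
  (smoothOff_norm_pow n).mul (smoothOff_radialExt f)

/-- In degree n the Euler operator E is multiplication by n, so (d - 2) E + E² becomes n (n + d -
2), while rotations ignore the radial factor. Thus the eigenvalue defining Harm_n is exactly the one
making the solid extension harmonic. -/
theorem norm_sq_mul_lap_solid (n : ℕ) (f : Schwartz d) {x : Amb d} (hx : x ≠ 0) :
    ((‖x‖ ^ 2 : ℝ) : ℂ) * lap (solid n f) x = ((‖x‖ ^ n : ℝ) : ℂ) *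
      (radialExt (lapBeltrami d f) x + n * (n + d - 2) * radialExt f x) := by
  have hn : ∀ {y : Amb d}, y ≠ 0 → DifferentiableAt ℝ (fun y : Amb d => ((‖y‖ ^ n : ℝ) : ℂ)) y :=
    fun hy => (smoothOff_norm_pow n).differentiableAt hy
  have hf : ∀ (f : Schwartz d) {y : Amb d}, y ≠ 0 → DifferentiableAt ℝ (radialExt f) y :=
    fun f y hy => (smoothOff_radialExt f).differentiableAt hy
  have hr : ∀ i j (f : Schwartz d) {y : Amb d}, y ≠ 0 →
      rot i j (solid n f) y = solid n (sphRot i j f) y := by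
    intro i j f y hy
    have := rot_mul (hn hy) (hf f hy) i j
    rw [rot_norm_pow n hy, zero_mul, zero_add] at this
    rw [solid, radialExt_sphRot _ _ _ hy, ← this]
    rfl
  have he : ∀ {y : Amb d}, y ≠ 0 → euler (solid n f) y = n * solid n f y := by
    intro y hy
    have := euler_mul (hn hy) (hf f hy)
    rw [euler_norm_pow n hy, euler_radialExt f hy, mul_zero, add_zero, mul_assoc] at this
    exact this
  have hee : euler (euler (solid n f)) x = n * (n * solid n f x) := by
    rw [euler_congr_off hx fun y hy => he hy, ← he hx]
    simp only [euler, pd_const_mul _ ((smoothOff_solid n f).differentiableAt hx), Finset.mul_sum,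
      mul_left_comm]
  have hrr : ∀ i j, rot i j (rot i j (solid n f)) x = solid n (sphRot i j (sphRot i j f)) x := by
    intro i j
    rw [rot_congr_off hx (fun y hy => hr i j f hy), hr i j _ hx]
  rw [norm_sq_mul_lap (smoothOff_solid n f x hx), hee, he hx, lapBeltrami_eq_sum,
    radialExt_smul_apply, radialExt_sum]
  simp only [hrr, radialExt_sum, solid, ← Finset.mul_sum]
  ring

theorem mem_Harm {n : ℕ} {f : Schwartz d} :
    f ∈ Harm d n ↔ lapBeltrami d f = (-((n : ℂ) * ((n : ℂ) + (d : ℂ) - 2))) • f :=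
  End.mem_eigenspace_iff

theorem lap_solid {n : ℕ} {f : Schwartz d} (hf : f ∈ Harm d n) {x : Amb d} (hx : x ≠ 0) :
    lap (solid n f) x = 0 := by
  have h := norm_sq_mul_lap_solid n f hx
  rw [mem_Harm.1 hf, radialExt_smul_apply] at h
  have h2 : ((‖x‖ ^ 2 : ℝ) : ℂ) ≠ 0 := by
    have := norm_ne_zero_iff.2 hx
    exact_mod_cast pow_ne_zero 2 this
  refine (mul_eq_zero.1 (h.trans ?_)).resolve_left h2
  ring

theorem sphRot_mem_Harm {n : ℕ} {f : Schwartz d} (hf : f ∈ Harm d n) (i j : Fin d) :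
    sphRot i j f ∈ Harm d n := by
  rw [mem_Harm] at hf ⊢
  rw [← sphRot_lapBeltrami, hf, map_smul]

/-- There are spherical harmonics of each order. -/
theorem exists_mem_Harm_ne_zero (n : ℕ) : ∃ f ∈ Harm d n, f ≠ 0 := by
  have hd : 2 ≤ d := Fact.out
  let i₀ : Fin d := ⟨0, by omega⟩
  let i₁ : Fin d := ⟨1, by omega⟩
  have h01 : i₀ ≠ i₁ := by simp [i₀, i₁]
  -- The gradient a = e₀ + i e₁ is isotropic, a · a = 0, so every power of ℓ is harmonic; ℓ equals 1
  -- at the point e₀ of the sphere, so no power restricts to zero. Two coordinates are available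
  -- because d ≥ 2.
  let ℓ : Amb d → ℂ := fun x => crd i₀ x + Complex.I * crd i₁ x
  have hℓ : ContDiff ℝ ∞ ℓ := (contDiff_crd i₀).add (contDiff_const.mul (contDiff_crd i₁))
  have hF : ∀ m, ContDiff ℝ ∞ (fun x => ℓ x ^ m) := fun m => hℓ.pow m
  have hdiff : ∀ x, DifferentiableAt ℝ ℓ x := fun x => hℓ.contDiffAt.differentiableAt (by simp)
  let a : Fin d → ℂ := fun i => (if i = i₀ then 1 else 0) + Complex.I * (if i = i₁ then 1 else 0)
  have hpℓ : ∀ i x, pd i ℓ x = a i := by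
    intro i x
    rw [pd_add (differentiableAt_crd i₀ x) ((differentiableAt_const _).fun_mul
      (differentiableAt_crd i₁ x)), pd_const_mul _ (differentiableAt_crd i₁ x), pd_crd, pd_crd]
  have hpow : ∀ (m : ℕ) i x, pd i (fun x => ℓ x ^ m) x = m * ℓ x ^ (m - 1) * a i := by
    intro m i x
    rw [← hpℓ i x, pd, pd, fderiv_fun_pow _ (hdiff x)]
    simp
  have hlap : ∀ x, lap (fun x => ℓ x ^ n) x = 0 := by
    intro x
    have h2 : ∀ i, pd i (pd i (fun x => ℓ x ^ n)) x =
        n * ((n - 1 : ℕ) * ℓ x ^ (n - 1 - 1)) * (a i * a i) := by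
      intro i
      rw [funext (hpow n i)]
      have hm : DifferentiableAt ℝ (fun x => ℓ x ^ (n - 1)) x :=
        (hF _).contDiffAt.differentiableAt (by simp)
      have h3 : (fun x => (n : ℂ) * ℓ x ^ (n - 1) * a i) =
          fun x => (n * a i) * ℓ x ^ (n - 1) := by
        ext; ring
      rw [h3, pd_const_mul _ hm, hpow]
      ring
    have h4 : ∑ i, a i * a i = 0 := by
      have h5 : ∀ i, a i * a i = (if i = i₀ then 1 else 0) - (if i = i₁ then 1 else 0) := by
        intro i
        by_cases h : i = i₀
        · simp [a, h, h01]
        · by_cases h' : i = i₁ <;> simp [a, h', h01.symm, h]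
      simp [h5]
    rw [lap]
    simp only [h2, ← Finset.mul_sum, h4, mul_zero]
  have hs : SmoothOff (fun x => ℓ x ^ n) := fun x _ => (hF n).contDiffAt
  -- By homogeneity of degree n, extending the restriction to the sphere gives ℓ^n back.
  have hhom : ∀ y ≠ 0, solid n hs.restr y = ℓ y ^ n := by
    intro y hy
    obtain ⟨r, hr⟩ := exists_sphere_smul hy
    have ht : 0 < ‖y‖ := norm_pos_iff.2 hy
    have hy' : radialExt hs.restr y = ℓ r ^ n := by
      rw [hr, radialExt_smul_pos _ ht, radialExt_coe, SmoothOff.restr_apply]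
    rw [solid, hy']
    conv_rhs => rw [hr]
    simp only [ℓ, crd, PiLp.smul_apply, smul_eq_mul, Complex.ofReal_mul, Complex.ofReal_pow]
    rw [← mul_pow]
    ring
  refine ⟨hs.restr, mem_Harm.2 (DFunLike.ext _ _ fun r => ?_), fun h0 => ?_⟩
  · have hr : (r : Amb d) ≠ 0 := coe_ne_zero r
    have h := norm_sq_mul_lap_solid n hs.restr hr
    have h1 : ‖(r : Amb d)‖ = 1 := norm_eq_of_mem_sphere r
    rw [lap_congr_off hr hhom, hlap, mul_zero, radialExt_coe, radialExt_coe, h1] at h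
    have h2 : lapBeltrami d hs.restr r + n * (n + d - 2) * hs.restr r = 0 := by
      simpa using h.symm
    rw [Schwartz.smul_apply]
    linear_combination h2
  · have h1 : hs.restr (⟨EuclideanSpace.single i₀ 1, by simp⟩ : Sph d) = 0 := by
      rw [h0]
      rfl
    rw [SmoothOff.restr_apply] at h1
    simp [ℓ, crd, h01.symm] at h1

end Spherical

namespace Spherical

/-! ### Integration on the sphere -/

section Polar

variable {d : ℕ}

/-- Integration in polar coordinates of a product of a radial and an angular function. -/
theorem integral_radial_mul_radialExt [hd : Fact (2 ≤ d)] (a : ℝ → ℂ) (b : Sph d → ℂ) :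
    ∫ x : Amb d, a ‖x‖ * radialExt b x =
      (∫ t in Ioi (0 : ℝ), ((t ^ (d - 1) : ℝ) : ℂ) * a t) * ∫ r, b r ∂(surf d) := by
  have hnt : Nontrivial (Amb d) :=
    Module.nontrivial_of_finrank_pos (R := ℝ) (by have := hd.out; simp; omega)
  have hfr : finrank ℝ (Amb d) = d := by simp
  calc
    ∫ x : Amb d, a ‖x‖ * radialExt b x
      = ∫ x : ({(0 : Amb d)}ᶜ : Set (Amb d)), a ‖x.1‖ * radialExt b x.1
          ∂((volume : Measure (Amb d)).comap (↑)) := by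
      rw [integral_subtype_comap (measurableSet_singleton _).compl
        fun x : Amb d => a ‖x‖ * radialExt b x, restrict_compl_singleton]
    _ = ∫ x : Sph d × Ioi (0 : ℝ), b x.1 * a x.2
          ∂((surf d).prod (.volumeIoiPow (finrank ℝ (Amb d) - 1))) := by
      rw [surf, ← (volume : Measure (Amb d)).measurePreserving_homeomorphUnitSphereProd.integral_comp
        (Homeomorph.measurableEmbedding _)]
      refine integral_congr_ae (Eventually.of_forall fun x => ?_)
      have hx : (x : Amb d) ≠ 0 := x.2
      simp only [homeomorphUnitSphereProd_apply_snd_coe, radialExt, dif_neg hx]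
      rw [mul_comm]
      congr 2
      exact Subtype.ext (by simp)
    _ = (∫ r, b r ∂(surf d)) *
        ∫ x : Ioi (0 : ℝ), a x ∂(.volumeIoiPow (finrank ℝ (Amb d) - 1)) :=
      integral_prod_mul b fun x : Ioi (0 : ℝ) => a x
    _ = _ := by
      rw [mul_comm, hfr]
      congr 1
      simp only [Measure.volumeIoiPow, ENNReal.ofReal]
      rw [integral_withDensity_eq_integral_smul,
        integral_subtype_comap measurableSet_Ioi fun t : ℝ => Real.toNNReal (t ^ (d - 1)) • a t,
        setIntegral_congr_fun measurableSet_Ioi fun x hx => ?_]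
      · rw [NNReal.smul_def, Real.coe_toNNReal _ (pow_nonneg (le_of_lt hx) _), Complex.real_smul]
      · exact (measurable_subtype_coe.pow_const _).real_toNNReal

/-- Rotation fields are divergence free: integration by parts moves the derivative onto the
coordinate, and ∂_j x_i = δ_ij is symmetric in i and j. -/
theorem integral_rot_eq_zero {H : Amb d → ℂ} (hH : ContDiff ℝ ∞ H) (hc : HasCompactSupport H)
    (i j : Fin d) : ∫ x, rot i j H x = 0 := by
  have hpd : ∀ i, Continuous (pd i H) := fun i =>
    (hH.continuous_fderiv (by simp)).clm_apply continuous_const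
  have hpc : ∀ i, HasCompactSupport (pd i H) := fun i =>
    hc.fderiv_apply (𝕜 := ℝ) (EuclideanSpace.single i 1)
  have hcrd : ∀ i : Fin d, Continuous (crd i : Amb d → ℂ) := fun i => (contDiff_crd (n := 0) i).continuous
  have hint : ∀ i j, Integrable (fun x => crd i x * pd j H x) := fun i j =>
    ((hcrd i).mul (hpd j)).integrable_of_hasCompactSupport (hpc j).mul_left
  have key : ∀ i j, ∫ x, crd i x * pd j H x = - ∫ x, (if j = i then 1 else 0) * H x := by
    intro i j
    have h1 : ∀ x, pd j (crd i) x * H x = (if j = i then 1 else 0) * H x := fun x => by rw [pd_crd]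
    have h2 : Integrable (fun x => (if j = i then (1 : ℂ) else 0) * H x) :=
      (hH.continuous.integrable_of_hasCompactSupport hc).const_mul _
    have := integral_mul_fderiv_eq_neg_fderiv_mul_of_integrable (μ := (volume : Measure (Amb d)))
      (f := crd i) (g := H) (v := EuclideanSpace.single j 1)
      (h2.congr (Eventually.of_forall fun x => (h1 x).symm)) (hint i j)
      (((hcrd i).mul hH.continuous).integrable_of_hasCompactSupport hc.mul_left)
      (fun x _ => differentiableAt_crd i x) (fun x _ => hH.contDiffAt.differentiableAt (by simp))
    change ∫ x, crd i x * pd j H x = - ∫ x, pd j (crd i) x * H x at this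
    rw [this]
    simp only [h1]
  change ∫ x, (crd i x * pd j H x - crd j x * pd i H x) = 0
  rw [integral_sub (hint i j) (hint j i), key, key]
  simp [eq_comm]

end Polar

variable {d : ℕ} [Fact (2 ≤ d)]

/-- The Euclidean statement is transferred by a radial cutoff, which rotations do not see. In polar
coordinates the vanishing integral factors into a radial constant and the surface integral, and the
constant is nonzero. -/
theorem integral_sphRot (i j : Fin d) (f : Schwartz d) :
    ∫ r, sphRot i j f r ∂(surf d) = 0 := by
  -- Evaluated at ‖x‖², this bump lives on 1 < ‖x‖² < 3: compactly supported, and away from the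
  -- origin, where the radial extension need not be smooth.
  let ψ : ContDiffBump (2 : ℝ) := ⟨1 / 2, 1, by norm_num, by norm_num⟩
  have hψ0 : ∀ t, t ≤ 1 → ψ t = 0 := fun t ht => ψ.zero_of_le_dist (by
    rw [Real.dist_eq, abs_sub_comm, le_abs]
    left
    change (1 : ℝ) ≤ _
    linarith)
  have hψ1 : ∀ t, 3 ≤ t → ψ t = 0 := fun t ht => ψ.zero_of_le_dist (by
    rw [Real.dist_eq, le_abs]
    left
    change (1 : ℝ) ≤ _
    linarith)
  have hχ : ContDiff ℝ ∞ (fun x : Amb d => ψ (‖x‖ ^ 2)) := ψ.contDiff.comp (contDiff_norm_sq ℝ)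
  have hχc : HasCompactSupport (fun x : Amb d => ψ (‖x‖ ^ 2)) := by
    refine HasCompactSupport.of_support_subset_isCompact (isCompact_closedBall 0 2) fun x hx => ?_
    rw [mem_closedBall_zero_iff]
    by_contra! h
    exact hx (hψ1 _ (by nlinarith))
  have hχ' : ContDiff ℝ ∞ (fun x : Amb d => ((ψ (‖x‖ ^ 2) : ℝ) : ℂ)) :=
    Complex.ofRealCLM.contDiff.comp hχ
  let H : Amb d → ℂ := fun x => ((ψ (‖x‖ ^ 2) : ℝ) : ℂ) * radialExt f x
  have hH : ContDiff ℝ ∞ H := by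
    rw [contDiff_iff_contDiffAt]
    intro x
    by_cases hx : x = 0
    · subst hx
      refine (contDiffAt_const (c := (0 : ℂ))).congr_of_eventuallyEq ?_
      filter_upwards [ball_mem_nhds (0 : Amb d) one_pos] with x hx
      rw [mem_ball_zero_iff] at hx
      simp only [H]
      rw [hψ0 _ (by nlinarith [norm_nonneg x])]
      simp
    · exact hχ'.contDiffAt.mul (contDiffAt_radialExt f hx)
  have hHc : HasCompactSupport H := by
    have : HasCompactSupport (fun x : Amb d => ((ψ (‖x‖ ^ 2) : ℝ) : ℂ)) :=
      hχc.comp_left (g := Complex.ofReal) (by simp)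
    exact this.mul_right
  have hrot : ∀ x, rot i j H x = (fun t : ℝ => ((ψ (t ^ 2) : ℝ) : ℂ)) ‖x‖ *
      radialExt (sphRot i j f) x := by
    intro x
    by_cases hx : x = 0
    · simp [hx, rot, crd, radialExt]
    have hd : DifferentiableAt ℝ ψ (‖x‖ ^ 2) := ψ.contDiff.contDiffAt.differentiableAt one_ne_zero
    rw [rot_mul (hχ'.contDiffAt.differentiableAt (by simp))
      ((smoothOff_radialExt f).differentiableAt hx), rot_comp_norm_sq hd,
      radialExt_sphRot _ _ _ hx]
    ring
  have h0 := integral_rot_eq_zero hH hHc i j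
  rw [integral_congr_ae (Eventually.of_forall hrot)] at h0
  refine (mul_eq_zero.1 ((integral_radial_mul_radialExt
    (fun t : ℝ => ((ψ (t ^ 2) : ℝ) : ℂ)) (sphRot i j f)).symm.trans h0)).resolve_left fun h1 => ?_
  -- To see that the radial constant is nonzero, the polar formula is applied to the constant
  -- function 1: otherwise a nonnegative continuous function, positive where ‖x‖² = 2, would have
  -- integral zero.
  have h2 := integral_radial_mul_radialExt (d := d) (fun t : ℝ => ((ψ (t ^ 2) : ℝ) : ℂ)) (fun _ => 1)
  rw [h1, zero_mul] at h2
  have h3 : ∫ x : Amb d, ψ (‖x‖ ^ 2) = 0 := by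
    have h4 : ∀ x : Amb d, ((ψ (‖x‖ ^ 2) : ℝ) : ℂ) * radialExt (fun _ => 1) x =
        ((ψ (‖x‖ ^ 2) : ℝ) : ℂ) := by
      intro x
      by_cases hx : x = 0
      · rw [hx, hψ0 _ (by simp)]
        simp
      · simp [radialExt, hx]
    simp only [h4] at h2
    rw [integral_complex_ofReal] at h2
    exact_mod_cast h2
  have hnt : Nontrivial (Amb d) :=
    Module.nontrivial_of_finrank_pos (R := ℝ) (by have := (Fact.out : 2 ≤ d); simp; omega)
  obtain ⟨x, hx⟩ := exists_norm_eq (Amb d) (c := √2) (by positivity)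
  refine (hχ.continuous.integral_pos_of_hasCompactSupport_nonneg_nonzero hχc
    (fun x => ψ.nonneg) (x := x) ?_).ne' h3
  rw [hx, Real.sq_sqrt (by norm_num)]
  exact (ψ.pos_of_mem_ball (mem_ball_self ψ.rOut_pos)).ne'

/-! ### Symmetry of the Laplace-Beltrami operator, orthogonality of harmonics -/

/-- The pointwise product of smooth functions. -/
def Schwartz.mul (f g : Schwartz d) : Schwartz d :=
  ⟨fun r => f r * g r, (contDiff_mul (𝕜 := ℝ) (𝔸 := ℂ) (n := ∞)).contMDiff.comp
    (f.contMDiff.prodMk_space g.contMDiff)⟩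

@[simp] theorem Schwartz.mul_apply (f g : Schwartz d) (r : Sph d) : f.mul g r = f r * g r := rfl

/-- The pointwise complex conjugate of a smooth function. -/
noncomputable def Schwartz.conj (f : Schwartz d) : Schwartz d :=
  ⟨fun r => (starRingEnd ℂ) (f r),
    (Complex.conjCLE.contDiff.contMDiff (n := ∞)).comp f.contMDiff⟩

@[simp] theorem Schwartz.conj_apply (f : Schwartz d) (r : Sph d) :
    f.conj r = (starRingEnd ℂ) (f r) := rfl

@[simp] theorem Schwartz.conj_conj (f : Schwartz d) : f.conj.conj = f :=
  DFunLike.ext _ _ fun r => by simp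

theorem sphRot_mul (i j : Fin d) (f g : Schwartz d) :
    sphRot i j (f.mul g) = (sphRot i j f).mul g + f.mul (sphRot i j g) := by
  apply DFunLike.ext
  intro r
  have hr : (r : Amb d) ≠ 0 := coe_ne_zero r
  have h : radialExt (f.mul g) = fun x => radialExt f x * radialExt g x := by
    ext x
    by_cases hx : x = 0 <;> simp [radialExt, hx]
  rw [sphRot_apply, h, rot_mul ((smoothOff_radialExt f).differentiableAt hr)
    ((smoothOff_radialExt g).differentiableAt hr)]
  simp [radialExt_coe, sphRot_apply]

theorem sphRot_conj (i j : Fin d) (f : Schwartz d) :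
    sphRot i j f.conj = (sphRot i j f).conj := by
  apply DFunLike.ext
  intro r
  have h : radialExt f.conj = fun x => (starRingEnd ℂ) (radialExt f x) := by
    ext x
    by_cases hx : x = 0 <;> simp [radialExt, hx]
  rw [sphRot_apply, h, rot, pd_conj, pd_conj, Schwartz.conj_apply, sphRot_apply, rot]
  simp [crd]

theorem integrable_schwartz (f : Schwartz d) : Integrable f (surf d) :=
  f.contMDiff.continuous.integrable_of_hasCompactSupport (HasCompactSupport.of_compactSpace _)

theorem ip_sphRot (i j : Fin d) (f g : Schwartz d) :
    ip (sphRot i j f) g = - ip f (sphRot i j g) := by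
  have h := integral_sphRot i j (f.mul g.conj)
  rw [sphRot_mul] at h
  have h2 := integral_add (integrable_schwartz ((sphRot i j f).mul g.conj))
    (integrable_schwartz (f.mul (sphRot i j g.conj)))
  have h3 : ∫ r, f.mul (sphRot i j g.conj) r ∂(surf d) = ip f (sphRot i j g) := by
    rw [sphRot_conj]
    rfl
  rw [h3] at h2
  exact eq_neg_of_add_eq_zero_left (h2.symm.trans h)

theorem ip_smul_right (c : ℂ) (f g : Schwartz d) : ip f (c • g) = conj c * ip f g := by
  rw [← ip_conj, ip_smul_left, map_mul, ip_conj]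

/-- `ip · g` as a linear map. -/
noncomputable def ipLeft (g : Schwartz d) : Schwartz d →ₗ[ℂ] ℂ where
  toFun f := ip f g
  map_add' f f' := ip_add_left f f' g
  map_smul' c f := ip_smul_left c f g

theorem ip_sum_left {ι : Type*} (s : Finset ι) (f : ι → Schwartz d) (g : Schwartz d) :
    ip (∑ k ∈ s, f k) g = ∑ k ∈ s, ip (f k) g := map_sum (ipLeft g) f s

theorem ip_sub_left (f f' g : Schwartz d) : ip (f - f') g = ip f g - ip f' g :=
  map_sub (ipLeft g) f f'

theorem ip_zero_left (g : Schwartz d) : ip 0 g = 0 := map_zero (ipLeft g)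

theorem ip_sum_right {ι : Type*} (s : Finset ι) (f : Schwartz d) (g : ι → Schwartz d) :
    ip f (∑ k ∈ s, g k) = ∑ k ∈ s, ip f (g k) := by
  rw [← ip_conj, ip_sum_left, map_sum]
  simp only [ip_conj]

/-- Green's identity. The right-hand side is visibly Hermitian in f and g, which gives symmetry of
Δ; with f = g it also bounds each rotation by the eigenvalue. -/
theorem ip_lapBeltrami_eq (f g : Schwartz d) :
    ip (lapBeltrami d f) g = -((1 / 2 : ℂ) * ∑ i, ∑ j, ip (sphRot i j f) (sphRot i j g)) := by
  rw [lapBeltrami_eq_sum, ip_smul_left, ip_sum_left]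
  simp only [ip_sum_left, ip_sphRot _ _ (sphRot _ _ f) g, Finset.sum_neg_distrib, mul_neg]

/-- The Laplace-Beltrami operator is symmetric. -/
theorem ip_lapBeltrami (f g : Schwartz d) :
    ip (lapBeltrami d f) g = ip f (lapBeltrami d g) := by
  rw [← ip_conj (lapBeltrami d g), ip_lapBeltrami_eq, ip_lapBeltrami_eq]
  simp [ip_conj, map_ofNat (starRingEnd ℂ) 2]

/-- The eigenvalue `n (n + d - 2)` of `-Δ` on the spherical harmonics of order `n`. -/
def lapEig (d n : ℕ) : ℝ := n * (n + d - 2)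

theorem mem_Harm_iff {n : ℕ} {f : Schwartz d} :
    f ∈ Harm d n ↔ lapBeltrami d f = ((-lapEig d n : ℝ) : ℂ) • f := by
  rw [mem_Harm]
  simp [lapEig]

theorem lapEig_nonneg (n : ℕ) : 0 ≤ lapEig d n := by
  have : (2 : ℝ) ≤ d := by exact_mod_cast (Fact.out : 2 ≤ d)
  exact mul_nonneg (by positivity) (by linarith [(Nat.cast_nonneg n : (0 : ℝ) ≤ n)])

/-- Different orders have different eigenvalues, which is what orthogonality needs. The bound d ≥ 2
matters: for d = 1 the orders 0 and 1 would share the eigenvalue 0. -/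
theorem lapEig_strictMono : StrictMono (lapEig d) := by
  refine strictMono_nat_of_lt_succ fun n => ?_
  have : (2 : ℝ) ≤ d := by exact_mod_cast (Fact.out : 2 ≤ d)
  simp only [lapEig, Nat.cast_add, Nat.cast_one]
  nlinarith [(Nat.cast_nonneg n : (0 : ℝ) ≤ n)]

/-- Spherical harmonics of different orders are orthogonal. -/
theorem ip_eq_zero_of_mem_Harm {n m : ℕ} (hnm : n ≠ m) {f g : Schwartz d} (hf : f ∈ Harm d n)
    (hg : g ∈ Harm d m) : ip f g = 0 := by
  have h := ip_lapBeltrami f g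
  rw [mem_Harm_iff.1 hf, mem_Harm_iff.1 hg, ip_smul_left, ip_smul_right, Complex.conj_ofReal] at h
  have h2 : (((-lapEig d n : ℝ) : ℂ) - ((-lapEig d m : ℝ) : ℂ)) * ip f g = 0 := by
    rw [sub_mul, h, sub_self]
  refine (mul_eq_zero.1 h2).resolve_left fun h3 => hnm (lapEig_strictMono (d := d).injective ?_)
  rw [sub_eq_zero, Complex.ofReal_inj] at h3
  linarith

/-- The squared `ℒ²` norm. -/
noncomputable def normSq (f : Schwartz d) : ℝ := ∫ r, ‖f r‖ ^ 2 ∂(surf d)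

theorem ip_self (f : Schwartz d) : ip f f = (normSq f : ℂ) := by
  rw [ip, normSq, ← integral_complex_ofReal]
  simp only [Complex.mul_conj, Complex.normSq_eq_norm_sq]

theorem normSq_nonneg (f : Schwartz d) : 0 ≤ normSq f :=
  integral_nonneg fun _ => by positivity

/-- For an eigenfunction, Green's identity reads ½ ∑ ‖L_ij f‖² = λ_n ‖f‖²; all terms but one are
dropped. -/
theorem normSq_sphRot_le {n : ℕ} {f : Schwartz d} (hf : f ∈ Harm d n) (i j : Fin d) :
    normSq (sphRot i j f) ≤ 2 * lapEig d n * normSq f := by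
  have h := ip_lapBeltrami_eq f f
  rw [mem_Harm_iff.1 hf, ip_smul_left] at h
  simp only [ip_self] at h
  have h2 : (-lapEig d n) * normSq f = -((1 / 2) * ∑ i, ∑ j, normSq (sphRot i j f)) := by
    rw [← Complex.ofReal_inj]
    push_cast at h ⊢
    exact h
  have h3 : normSq (sphRot i j f) ≤ ∑ i, ∑ j, normSq (sphRot i j f) :=
    (Finset.single_le_sum (f := fun j => normSq (sphRot i j f)) (fun _ _ => normSq_nonneg _)
      (Finset.mem_univ j)).trans
    (Finset.single_le_sum (f := fun i => ∑ j, normSq (sphRot i j f))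
      (fun _ _ => Finset.sum_nonneg fun _ _ => normSq_nonneg _) (Finset.mem_univ i))
  linarith

end Spherical

namespace Spherical

/-! ### The mean value property and the sup-norm estimate for spherical harmonics -/

section MeanValue

variable {d : ℕ}

/-- An exponent of at least 2 removes the corner at 0, since the function is dominated by |t|^(n+2)
= o(t). -/
theorem hasDerivAt_max_zero_pow (n : ℕ) (t : ℝ) :
    HasDerivAt (fun t : ℝ => max t 0 ^ (n + 2)) ((n + 2 : ℕ) * max t 0 ^ (n + 1)) t := by
  rcases lt_trichotomy t 0 with ht | rfl | ht
  · rw [max_eq_right ht.le, zero_pow (by omega), mul_zero]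
    refine (hasDerivAt_const t (0 : ℝ)).congr_of_eventuallyEq ?_
    filter_upwards [gt_mem_nhds ht] with s hs
    rw [max_eq_right hs.le, zero_pow (by omega)]
  · rw [max_self, zero_pow (by omega), mul_zero, hasDerivAt_iff_isLittleO]
    simp only [max_self, sub_zero, smul_zero, zero_pow (Nat.succ_ne_zero (n + 1))]
    refine Asymptotics.IsBigO.trans_isLittleO (g := fun t : ℝ => t ^ (n + 2)) ?_ ?_
    · refine Asymptotics.IsBigO.of_bound 1 (Eventually.of_forall fun s => ?_)
      rw [one_mul, norm_pow, norm_pow]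
      refine pow_le_pow_left₀ (norm_nonneg _) ?_ _
      rw [Real.norm_eq_abs, Real.norm_eq_abs, abs_of_nonneg (le_max_right _ _)]
      exact max_le (le_abs_self s) (abs_nonneg s)
    · simpa using Asymptotics.isLittleO_pow_pow (𝕜 := ℝ) (show 1 < n + 2 by omega)
  · rw [max_eq_left ht.le]
    refine (hasDerivAt_pow (n + 2) t).congr_of_eventuallyEq ?_
    filter_upwards [lt_mem_nhds ht] with s hs
    rw [max_eq_left hs.le]

/-- The truncated power `(1 - ‖y‖²)₊^n`. -/
noncomputable def truncPow (n : ℕ) (y : Amb d) : ℝ := max (1 - ‖y‖ ^ 2) 0 ^ n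

theorem continuous_truncPow (n : ℕ) : Continuous (truncPow n : Amb d → ℝ) := by
  unfold truncPow
  fun_prop

theorem truncPow_nonneg (n : ℕ) (y : Amb d) : 0 ≤ truncPow n y :=
  pow_nonneg (le_max_right _ _) n

theorem truncPow_le_one (n : ℕ) (y : Amb d) : truncPow n y ≤ 1 :=
  pow_le_one₀ (le_max_right _ _) (max_le (by nlinarith [norm_nonneg y]) zero_le_one)

theorem truncPow_eq_zero (n : ℕ) {y : Amb d} (hy : 1 ≤ ‖y‖) : truncPow (n + 1) y = 0 := by
  rw [truncPow, max_eq_right (by nlinarith), zero_pow (by omega)]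

theorem hasCompactSupport_truncPow (n : ℕ) :
    HasCompactSupport (truncPow (n + 1) : Amb d → ℝ) := by
  refine HasCompactSupport.of_support_subset_isCompact (isCompact_closedBall 0 1) fun x hx => ?_
  rw [mem_closedBall_zero_iff]
  by_contra! h
  exact hx (truncPow_eq_zero n h.le)

theorem integral_truncPow_pos (n : ℕ) : 0 < ∫ y : Amb d, truncPow (n + 1) y :=
  (continuous_truncPow _).integral_pos_of_hasCompactSupport_nonneg_nonzero
    (hasCompactSupport_truncPow n) (truncPow_nonneg _) (x := 0) (by simp [truncPow])

theorem differentiable_truncPow (n : ℕ) (y : Amb d) :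
    DifferentiableAt ℝ (fun y : Amb d => ((truncPow (n + 2) y : ℝ) : ℂ)) y := by
  have h1 : HasDerivAt (fun t : ℝ => max (1 - t) 0 ^ (n + 2))
      (((n + 2 : ℕ) * max (1 - ‖y‖ ^ 2) 0 ^ (n + 1)) * -1) (‖y‖ ^ 2) :=
    (hasDerivAt_max_zero_pow n (1 - ‖y‖ ^ 2)).comp (‖y‖ ^ 2) ((hasDerivAt_id _).const_sub 1)
  have h2 : DifferentiableAt ℝ (fun y : Amb d => ‖y‖ ^ 2) y :=
    (contDiff_norm_sq ℝ (n := 1)).contDiffAt.differentiableAt one_ne_zero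
  exact Complex.ofRealCLM.differentiableAt.comp y
    (h1.differentiableAt.comp (f := fun y : Amb d => ‖y‖ ^ 2) y h2)

/-- The gradient of a truncated power is a multiple of y times the preceding one. This is the reason
for the choice of weight: it turns a radial derivative of F under the integral into a Laplacian. -/
theorem pd_truncPow (n : ℕ) (y : Amb d) (i : Fin d) :
    pd i (fun y : Amb d => ((truncPow (n + 2) y : ℝ) : ℂ)) y =
      -2 * (n + 2 : ℕ) * ((truncPow (n + 1) y : ℝ) : ℂ) * crd i y := by
  have h1 : HasDerivAt (fun t : ℝ => max (1 - t) 0 ^ (n + 2))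
      (((n + 2 : ℕ) * max (1 - ‖y‖ ^ 2) 0 ^ (n + 1)) * -1) (‖y‖ ^ 2) :=
    (hasDerivAt_max_zero_pow n (1 - ‖y‖ ^ 2)).comp (‖y‖ ^ 2) ((hasDerivAt_id _).const_sub 1)
  have := pd_comp_norm_sq h1.differentiableAt i
  rw [h1.deriv] at this
  refine Eq.trans this ?_
  simp only [truncPow]
  push_cast
  ring

/-- With w_k the k-th truncated power, y w_2 = -(1/6) ∇w_3. Integrating by parts moves the gradient
onto the partial derivatives of F at x + s y, and the chain rule contributes the factor s. -/
theorem integral_truncPow_mul_fderiv {F : Amb d → ℂ} (hF : ContDiff ℝ ∞ F) (x : Amb d) (s : ℝ) :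
    ∫ y, ((truncPow 2 y : ℝ) : ℂ) * fderiv ℝ F (x + s • y) y =
      (s / 6 : ℝ) * ∫ y, ((truncPow 3 y : ℝ) : ℂ) * lap F (x + s • y) := by
  have haff : ContDiff ℝ ∞ (fun y : Amb d => x + s • y) := by fun_prop
  have hpd : ∀ {G : Amb d → ℂ}, ContDiff ℝ ∞ G → ∀ i, ContDiff ℝ ∞ (pd i G) := fun hG i =>
    contDiff_iff_contDiffAt.2 fun x => ContDiffAt.pd hG.contDiffAt i
  have hcomp : ∀ i y, pd i (fun y => pd i F (x + s • y)) y = s * pd i (pd i F) (x + s • y) := by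
    intro i y
    have h1 : HasFDerivAt (fun y : Amb d => x + s • y) (s • ContinuousLinearMap.id ℝ (Amb d)) y :=
      ((hasFDerivAt_id y).const_smul s).const_add x
    have h2 := ((hpd hF i).contDiffAt.differentiableAt (by simp)).hasFDerivAt.comp y h1
      (g := pd i F)
    change fderiv ℝ (pd i F ∘ fun y : Amb d => x + s • y) y _ = _
    rw [h2.fderiv]
    simp [pd]
  have hcT : ∀ n, Continuous (fun y : Amb d => ((truncPow n y : ℝ) : ℂ)) := fun n =>
    Complex.continuous_ofReal.comp (continuous_truncPow n)
  have hsT : ∀ n, HasCompactSupport (fun y : Amb d => ((truncPow (n + 1) y : ℝ) : ℂ)) := fun n =>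
    (hasCompactSupport_truncPow n).comp_left (g := Complex.ofReal) (by simp)
  have hint : ∀ (n : ℕ) {G : Amb d → ℂ}, Continuous G →
      Integrable (fun y => ((truncPow (n + 1) y : ℝ) : ℂ) * G y) := fun n G hG =>
    ((hcT (n + 1)).mul hG).integrable_of_hasCompactSupport (hsT n).mul_right
  have hcont : ∀ {G : Amb d → ℂ}, ContDiff ℝ ∞ G → Continuous (fun y => G (x + s • y)) := fun hG =>
    hG.continuous.comp haff.continuous
  have hcrd : ∀ i : Fin d, Continuous (crd i : Amb d → ℂ) := fun i =>
    (contDiff_crd (n := 0) i).continuous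
  have key : ∀ i, ∫ y, ((truncPow 2 y : ℝ) : ℂ) * (crd i y * pd i F (x + s • y)) =
      (s / 6 : ℝ) * ∫ y, ((truncPow 3 y : ℝ) : ℂ) * pd i (pd i F) (x + s • y) := by
    intro i
    have hl : ∀ y, pd i (fun y : Amb d => ((truncPow 3 y : ℝ) : ℂ)) y * pd i F (x + s • y) =
        -6 * (((truncPow 2 y : ℝ) : ℂ) * (crd i y * pd i F (x + s • y))) := by
      intro y
      rw [pd_truncPow 1]
      push_cast
      ring
    have hr : ∀ y, ((truncPow 3 y : ℝ) : ℂ) * pd i (fun y => pd i F (x + s • y)) y =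
        s * (((truncPow 3 y : ℝ) : ℂ) * pd i (pd i F) (x + s • y)) := by
      intro y
      rw [hcomp]
      ring
    have hil := ((hint 1 ((hcrd i).mul (hcont (hpd hF i)))).const_mul (-6)).congr
      (Eventually.of_forall fun y => (hl y).symm)
    have hir := ((hint 2 (hcont (hpd (hpd hF i) i))).const_mul (s : ℂ)).congr
      (Eventually.of_forall fun y => (hr y).symm)
    have h := integral_mul_fderiv_eq_neg_fderiv_mul_of_integrable
      (μ := (volume : Measure (Amb d))) (v := EuclideanSpace.single i 1) hil hir
      (hint 2 (hcont (hpd hF i))) (fun y _ => differentiable_truncPow 1 y)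
      (fun y _ => (((hpd hF i).comp haff).contDiffAt.differentiableAt (by simp)))
    change ∫ y, ((truncPow 3 y : ℝ) : ℂ) * pd i (fun y => pd i F (x + s • y)) y =
      - ∫ y, pd i (fun y : Amb d => ((truncPow 3 y : ℝ) : ℂ)) y * pd i F (x + s • y) at h
    simp only [hl, hr, integral_const_mul] at h
    push_cast
    linear_combination (-1 / 6) * h
  simp only [fderiv_apply_eq_sum, lap, Finset.mul_sum]
  have h2 : ∀ i, Integrable fun y => ((truncPow 2 y : ℝ) : ℂ) * (crd i y * pd i F (x + s • y)) :=
    fun i => hint 1 ((hcrd i).mul (hcont (hpd hF i)))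
  rw [integral_finsetSum _ fun i _ => h2 i,
    integral_finsetSum _ fun i _ => hint 2 (hcont (hpd (hpd hF i) i)), Finset.mul_sum]
  exact Finset.sum_congr rfl fun i _ => key i

/-- A weighted mean value property of harmonic functions. -/
theorem integral_truncPow_mul_harmonic {F : Amb d → ℂ} (hF : ContDiff ℝ ∞ F) {x : Amb d} {ε : ℝ}
    (hlap : ∀ y ∈ ball x ε, lap F y = 0) {s : ℝ} (hs : |s| < ε) :
    ∫ y, ((truncPow 2 y : ℝ) : ℂ) * F (x + s • y) = (∫ y : Amb d, truncPow 2 y : ℝ) * F x := by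
  have hcT : Continuous (fun y : Amb d => ((truncPow 2 y : ℝ) : ℂ)) :=
    Complex.continuous_ofReal.comp (continuous_truncPow 2)
  have hsT : HasCompactSupport (fun y : Amb d => ((truncPow 2 y : ℝ) : ℂ)) :=
    (hasCompactSupport_truncPow 1).comp_left (g := Complex.ofReal) (by simp)
  have hint : ∀ {G : Amb d → ℂ}, Continuous G →
      Integrable (fun y => ((truncPow 2 y : ℝ) : ℂ) * G y) := fun hG =>
    (hcT.mul hG).integrable_of_hasCompactSupport hsT.mul_right
  have hFc : ∀ t : ℝ, Continuous fun y : Amb d => F (x + t • y) := fun t =>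
    hF.continuous.comp (by fun_prop)
  have hFd : Continuous (fderiv ℝ F) := hF.continuous_fderiv (by simp)
  have hderiv : ∀ s : ℝ, HasDerivAt (fun s : ℝ => ∫ y, ((truncPow 2 y : ℝ) : ℂ) * F (x + s • y))
      (∫ y, ((truncPow 2 y : ℝ) : ℂ) * fderiv ℝ F (x + s • y) y) s := by
    intro s
    -- For |t - s| < 1 and y in the unit ball, which carries the weight, x + t y stays in this
    -- closed ball, so C dominates the derivative.
    obtain ⟨C, hC⟩ := (isCompact_closedBall x (|s| + 1)).exists_bound_of_continuousOn
      hFd.continuousOn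
    refine (hasDerivAt_integral_of_dominated_loc_of_deriv_le (μ := (volume : Measure (Amb d)))
      (F := fun t y => ((truncPow 2 y : ℝ) : ℂ) * F (x + t • y))
      (F' := fun t y => ((truncPow 2 y : ℝ) : ℂ) * fderiv ℝ F (x + t • y) y)
      (bound := fun y => truncPow 2 y * C) (ball_mem_nhds s one_pos)
      (Eventually.of_forall fun t => ?_) (hint (hFc s)) ?_ ?_ ?_ ?_).2
    · exact (hint (hFc t)).aestronglyMeasurable
    · have haff : Continuous fun y : Amb d => x + s • y := by fun_prop
      exact (hint ((hFd.comp haff).clm_apply continuous_id)).aestronglyMeasurable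
    · refine Eventually.of_forall fun y t ht => ?_
      rw [norm_mul, Complex.norm_real, Real.norm_of_nonneg (truncPow_nonneg _ _)]
      by_cases hy : 1 ≤ ‖y‖
      · rw [truncPow_eq_zero 1 hy]
        simp
      · push Not at hy
        have ht' : |t| ≤ |s| + 1 := by
          have := abs_sub_abs_le_abs_sub t s
          rw [mem_ball, Real.dist_eq] at ht
          linarith
        have hmem : x + t • y ∈ closedBall x (|s| + 1) := by
          rw [mem_closedBall, dist_self_add_left, norm_smul, Real.norm_eq_abs]
          nlinarith [abs_nonneg t, norm_nonneg y]
        refine mul_le_mul_of_nonneg_left ?_ (truncPow_nonneg _ _)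
        have h1 := (fderiv ℝ F (x + t • y)).le_opNorm y
        have h2 := hC _ hmem
        nlinarith [norm_nonneg (fderiv ℝ F (x + t • y)), norm_nonneg y]
    · exact ((continuous_truncPow 2).integrable_of_hasCompactSupport
        (hasCompactSupport_truncPow 1)).mul_const C
    · refine Eventually.of_forall fun y t _ => ?_
      have h1 : HasDerivAt (fun t : ℝ => x + t • y) y t := by
        simpa using ((hasDerivAt_id t).smul_const y).const_add x
      have h2 : HasFDerivAt F (fderiv ℝ F (x + t • y)) (x + t • y) :=
        (hF.contDiffAt.differentiableAt (by simp)).hasFDerivAt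
      exact (h2.comp_hasDerivAt t (f := fun t : ℝ => x + t • y) h1).const_mul _
  -- While |t| < ε, the weight only sees points where F is harmonic, so the derivative of the
  -- weighted average vanishes. The average is therefore constant in t and is compared with its
  -- value at t = 0.
  have hzero : ∀ t ∈ Ioo (-ε) ε, HasDerivWithinAt
      (fun s : ℝ => ∫ y, ((truncPow 2 y : ℝ) : ℂ) * F (x + s • y)) 0 (Ioo (-ε) ε) t := by
    intro t ht
    have h1 := hderiv t
    rw [integral_truncPow_mul_fderiv hF] at h1
    have h2 : ∀ y, ((truncPow 3 y : ℝ) : ℂ) * lap F (x + t • y) = 0 := by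
      intro y
      by_cases hy : 1 ≤ ‖y‖
      · rw [truncPow_eq_zero 2 hy]
        simp
      · push Not at hy
        rw [hlap, mul_zero]
        rw [mem_ball, dist_self_add_left, norm_smul, Real.norm_eq_abs]
        have := abs_lt.2 ht
        nlinarith [abs_nonneg t, norm_nonneg y]
    simp only [h2, integral_zero, mul_zero] at h1
    exact h1.hasDerivWithinAt
  have hε : 0 < ε := (abs_nonneg s).trans_lt hs
  have h := (convex_Ioo (-ε) ε).is_const_of_fderivWithin_eq_zero (𝕜 := ℝ)
    (f := fun s : ℝ => ∫ y, ((truncPow 2 y : ℝ) : ℂ) * F (x + s • y))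
    (fun t ht => (hzero t ht).differentiableWithinAt) (fun t ht => by
      have h3 := (hzero t ht).hasFDerivWithinAt.fderivWithin
        (isOpen_Ioo.uniqueDiffWithinAt ht)
      rw [h3]
      ext
      simp) (abs_lt.1 hs) (mem_Ioo.2 ⟨neg_lt_zero.2 hε, hε⟩)
  simp only [zero_smul, add_zero] at h
  rw [h, integral_mul_const, integral_complex_ofReal]

/-- The corresponding sub-mean value inequality for `|F|²`. -/
theorem norm_sq_le_integral_truncPow {F : Amb d → ℂ} (hF : ContDiff ℝ ∞ F) {x : Amb d} {ε : ℝ}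
    (hlap : ∀ y ∈ ball x ε, lap F y = 0) {s : ℝ} (hs : |s| < ε) :
    (∫ y : Amb d, truncPow 2 y) * ‖F x‖ ^ 2 ≤ ∫ y, truncPow 2 y * ‖F (x + s • y)‖ ^ 2 := by
  have hG : ∀ {G : Amb d → ℝ}, Continuous G → Integrable (fun y => truncPow 2 y * G y) :=
    fun hG => ((continuous_truncPow 2).mul hG).integrable_of_hasCompactSupport
      (hasCompactSupport_truncPow 1).mul_right
  have haff : Continuous (fun y : Amb d => F (x + s • y)) :=
    hF.continuous.comp (by fun_prop)
  have hm := integral_truncPow_mul_harmonic hF hlap hs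
  have hre : ∫ y, truncPow 2 y * (conj (F x) * F (x + s • y)).re =
      (∫ y : Amb d, truncPow 2 y) * ‖F x‖ ^ 2 := by
    have h1 : ∀ y, truncPow 2 y * (conj (F x) * F (x + s • y)).re =
        Complex.reCLM (conj (F x) * (((truncPow 2 y : ℝ) : ℂ) * F (x + s • y))) := by
      intro y
      rw [mul_left_comm]
      exact (Complex.re_ofReal_mul _ _).symm
    have hi : Integrable (fun y => conj (F x) * (((truncPow 2 y : ℝ) : ℂ) * F (x + s • y))) :=
      ((((Complex.continuous_ofReal.comp (continuous_truncPow 2)).mul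
        haff).integrable_of_hasCompactSupport (HasCompactSupport.mul_right
        ((hasCompactSupport_truncPow 1).comp_left (g := Complex.ofReal) (by simp))))).const_mul _
    simp only [h1]
    rw [ContinuousLinearMap.integral_comp_comm _ hi, integral_const_mul, hm, mul_left_comm,
      ← Complex.normSq_eq_conj_mul_self, Complex.normSq_eq_norm_sq, ← Complex.ofReal_mul]
    rfl
  -- Jensen's inequality by hand: expand the weighted square of F(x + s y) - F(x) and evaluate the
  -- cross term by the mean value identity.
  have h0 : 0 ≤ ∫ y, truncPow 2 y * ‖F (x + s • y) - F x‖ ^ 2 :=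
    integral_nonneg fun y => mul_nonneg (truncPow_nonneg _ _) (sq_nonneg _)
  have hexp : ∀ y, truncPow 2 y * ‖F (x + s • y) - F x‖ ^ 2 =
      truncPow 2 y * ‖F (x + s • y)‖ ^ 2 -
        2 * (truncPow 2 y * (conj (F x) * F (x + s • y)).re) + truncPow 2 y * ‖F x‖ ^ 2 := by
    intro y
    rw [← Complex.normSq_eq_norm_sq, ← Complex.normSq_eq_norm_sq, ← Complex.normSq_eq_norm_sq,
      Complex.normSq_sub, mul_comm (F (x + s • y))]
    ring
  simp only [hexp] at h0
  have i1 : Integrable fun y => truncPow 2 y * ‖F (x + s • y)‖ ^ 2 := hG (haff.norm.pow 2)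
  have i2 : Integrable fun y => 2 * (truncPow 2 y * (conj (F x) * F (x + s • y)).re) :=
    (hG (Complex.continuous_re.comp (continuous_const.mul haff))).const_mul 2
  have i3 : Integrable fun y : Amb d => truncPow 2 y * ‖F x‖ ^ 2 := hG continuous_const
  have hsum : ∫ y, (truncPow 2 y * ‖F (x + s • y)‖ ^ 2 -
      2 * (truncPow 2 y * (conj (F x) * F (x + s • y)).re) + truncPow 2 y * ‖F x‖ ^ 2) =
      (∫ y, truncPow 2 y * ‖F (x + s • y)‖ ^ 2) -
      (∫ y, 2 * (truncPow 2 y * (conj (F x) * F (x + s • y)).re)) +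
      ∫ y : Amb d, truncPow 2 y * ‖F x‖ ^ 2 := by
    rw [← integral_sub i1 i2]
    exact integral_add (i1.sub i2) i3
  rw [hsum, integral_const_mul, integral_mul_const, hre] at h0
  linarith

end MeanValue

end Spherical

/-! ### The Nikolskii inequality on thin shells -/

namespace Spherical

variable {d : ℕ}

/-- The closed annulus of radii `1 ± ε`. -/
def annulus (d : ℕ) (ε : ℝ) : Set (Amb d) := {x | ‖x‖ ∈ Icc (1 - ε) (1 + ε)}

theorem isCompact_annulus (ε : ℝ) : IsCompact (annulus d ε) :=
  (isCompact_closedBall (0 : Amb d) (1 + ε)).of_isClosed_subset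
    (isClosed_Icc.preimage continuous_norm) fun x hx => by
      rw [mem_closedBall_zero_iff]
      exact hx.2

theorem ne_zero_of_mem_annulus {ε : ℝ} (hε : ε < 1) {x : Amb d} (hx : x ∈ annulus d ε) :
    x ≠ 0 := by
  rw [← norm_pos_iff]
  have := hx.1
  linarith

theorem setIntegral_radial_le {ε : ℝ} (hε0 : 0 < ε) (hε : ε ≤ 1) (k : ℕ) :
    ∫ t in Ioi (0 : ℝ), t ^ (d - 1) * (Icc (1 - ε) (1 + ε)).indicator (fun t => t ^ k) t ≤
      2 * ε * (1 + ε) ^ (d - 1 + k) := by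
  have h1 : ∀ t : ℝ, t ^ (d - 1) * (Icc (1 - ε) (1 + ε)).indicator (fun t => t ^ k) t =
      (Icc (1 - ε) (1 + ε)).indicator (fun t => t ^ (d - 1 + k)) t := by
    intro t
    by_cases ht : t ∈ Icc (1 - ε) (1 + ε)
    · simp only [indicator_of_mem ht, pow_add]
    · simp only [indicator_of_notMem ht, mul_zero]
  simp only [h1]
  have hint : Integrable ((Icc (1 - ε) (1 + ε)).indicator fun t : ℝ => t ^ (d - 1 + k)) := by
    rw [integrable_indicator_iff measurableSet_Icc]
    exact (continuous_pow _).continuousOn.integrableOn_compact isCompact_Icc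
  calc ∫ t in Ioi (0 : ℝ), (Icc (1 - ε) (1 + ε)).indicator (fun t => t ^ (d - 1 + k)) t
      ≤ ∫ t, (Icc (1 - ε) (1 + ε)).indicator (fun t : ℝ => t ^ (d - 1 + k)) t := by
        refine setIntegral_le_integral hint (Eventually.of_forall fun t => ?_)
        refine indicator_nonneg (fun t ht => pow_nonneg ?_ _) t
        linarith [ht.1]
    _ = ∫ t in Icc (1 - ε) (1 + ε), t ^ (d - 1 + k) := integral_indicator measurableSet_Icc
    _ ≤ ∫ t in Icc (1 - ε) (1 + ε), (1 + ε) ^ (d - 1 + k) := by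
        refine setIntegral_mono_on ((continuous_pow _).continuousOn.integrableOn_compact
          isCompact_Icc) (continuousOn_const.integrableOn_compact isCompact_Icc)
          measurableSet_Icc fun t ht => ?_
        exact pow_le_pow_left₀ (by linarith [ht.1]) ht.2 _
    _ = _ := by
        rw [setIntegral_const, measureReal_def, Real.volume_Icc,
          ENNReal.toReal_ofReal (by linarith), smul_eq_mul]
        ring

/-- Near a point of the sphere, a function smooth away from the origin coincides with a globally
smooth function. -/
theorem exists_contDiff_eq_on_ball {F : Amb d → ℂ} (hF : SmoothOff F) (r : Sph d) :
    ∃ G : Amb d → ℂ, ContDiff ℝ ∞ G ∧ ∀ y ∈ ball (r : Amb d) (3 / 4), G y = F y := by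
  -- The outer radius is less than 1 = ‖r‖, so the cutoff vanishes near the origin, the only place
  -- where smoothness of F is not given.
  let χ : ContDiffBump (r : Amb d) := ⟨3 / 4, 7 / 8, by norm_num, by norm_num⟩
  refine ⟨fun y => ((χ y : ℝ) : ℂ) * F y, ?_, fun y hy => ?_⟩
  · rw [contDiff_iff_contDiffAt]
    intro x
    by_cases hx : x = 0
    · subst hx
      refine (contDiffAt_const (c := (0 : ℂ))).congr_of_eventuallyEq ?_
      filter_upwards [ball_mem_nhds (0 : Amb d) (show (0 : ℝ) < 1 / 8 by norm_num)] with x hx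
      rw [χ.zero_of_le_dist]
      · simp
      · change (7 / 8 : ℝ) ≤ dist x r
        have h1 : ‖(r : Amb d)‖ = 1 := norm_eq_of_mem_sphere r
        rw [mem_ball_zero_iff] at hx
        have h2 := norm_sub_norm_le (r : Amb d) x
        rw [dist_comm, dist_eq_norm]
        linarith
    · exact (Complex.ofRealCLM.contDiff.comp χ.contDiff).contDiffAt.mul (hF x hx)
  · change ((χ y : ℝ) : ℂ) * F y = F y
    rw [χ.one_of_mem_closedBall (ball_subset_closedBall hy)]
    simp

variable [Fact (2 ≤ d)]

/-- Finite sums of homogeneous extensions of spherical harmonics. -/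
noncomputable def solidSum (s : Finset ℕ) (f : ℕ → Schwartz d) (x : Amb d) : ℂ :=
  ∑ n ∈ s, solid n (f n) x

theorem smoothOff_solidSum (s : Finset ℕ) (f : ℕ → Schwartz d) : SmoothOff (solidSum s f) :=
  fun x hx => ContDiffAt.sum fun n _ => smoothOff_solid n (f n) x hx

theorem solidSum_coe (s : Finset ℕ) (f : ℕ → Schwartz d) (r : Sph d) :
    solidSum s f r = ∑ n ∈ s, f n r := by
  have h1 : ‖(r : Amb d)‖ = 1 := norm_eq_of_mem_sphere r
  simp [solidSum, solid, radialExt_coe, h1]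

theorem lap_solidSum {s : Finset ℕ} {f : ℕ → Schwartz d} (hf : ∀ n ∈ s, f n ∈ Harm d n)
    {x : Amb d} (hx : x ≠ 0) : lap (solidSum s f) x = 0 := by
  have h1 : ∀ i, pd i (pd i (solidSum s f)) x = ∑ n ∈ s, pd i (pd i (solid n (f n))) x := by
    intro i
    rw [← pd_sum _ fun n _ => ((smoothOff_solid n (f n)).pd i).differentiableAt hx]
    exact pd_congr ((eventually_ne_zero hx).mono fun y hy =>
      pd_sum _ (fun n _ => (smoothOff_solid n (f n)).differentiableAt hy) i) i
  rw [lap]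
  simp only [h1]
  rw [Finset.sum_comm]
  exact Finset.sum_eq_zero fun n hn => lap_solid (hf n hn) hx

theorem integral_annulus_solid_mul {ε : ℝ} (n m : ℕ) (f g : Schwartz d) :
    ∫ x in annulus d ε, solid n f x * conj (solid m g x) =
      (∫ t in Ioi (0 : ℝ), ((t ^ (d - 1) : ℝ) : ℂ) *
        (Icc (1 - ε) (1 + ε)).indicator (fun t => ((t ^ (n + m) : ℝ) : ℂ)) t) * ip f g := by
  rw [← integral_indicator (isCompact_annulus ε).measurableSet, ip,
    ← integral_radial_mul_radialExt _ fun r => f r * conj (g r)]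
  refine integral_congr_ae (Eventually.of_forall fun x => ?_)
  by_cases hx : x ∈ annulus d ε
  · have hx' : ‖x‖ ∈ Icc (1 - ε) (1 + ε) := hx
    simp only [indicator_of_mem hx, indicator_of_mem hx', solid, pow_add]
    have h : radialExt (fun r => f r * conj (g r)) x = radialExt f x * conj (radialExt g x) := by
      by_cases hx : x = 0 <;> simp [radialExt, hx]
    rw [h, map_mul, Complex.conj_ofReal]
    push_cast
    ring
  · have hx' : ‖x‖ ∉ Icc (1 - ε) (1 + ε) := hx
    simp only [indicator_of_notMem hx, indicator_of_notMem hx', zero_mul]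

/-- In polar coordinates the mixed terms vanish by orthogonality on the sphere. Each diagonal term
is a radial integral over an interval of length 2ε on which t ≤ 1 + ε. -/
theorem integral_annulus_normSq_le {ε : ℝ} (hε0 : 0 < ε) (hε : ε < 1) {N : ℕ} {s : Finset ℕ}
    (hs : ∀ n ∈ s, n ≤ N) {f : ℕ → Schwartz d} (hf : ∀ n ∈ s, f n ∈ Harm d n) :
    ∫ x in annulus d ε, ‖solidSum s f x‖ ^ 2 ≤
      2 * ε * (1 + ε) ^ (d - 1 + 2 * N) * ∑ n ∈ s, normSq (f n) := by
  have hint : ∀ n m, IntegrableOn (fun x => solid n (f n) x * conj (solid m (f m) x))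
      (annulus d ε) := by
    intro n m
    refine ContinuousOn.integrableOn_compact (isCompact_annulus ε) fun x hx => ?_
    have hx0 := ne_zero_of_mem_annulus hε hx
    exact ((smoothOff_solid n (f n) x hx0).continuousAt.mul
      (Complex.continuous_conj.continuousAt.comp
        (smoothOff_solid m (f m) x hx0).continuousAt)).continuousWithinAt
  have h1 : ((∫ x in annulus d ε, ‖solidSum s f x‖ ^ 2 : ℝ) : ℂ) =
      ((∑ n ∈ s, (∫ t in Ioi (0 : ℝ), t ^ (d - 1) * (Icc (1 - ε) (1 + ε)).indicator
        (fun t => t ^ (n + n)) t) * normSq (f n) : ℝ) : ℂ) := by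
    rw [← integral_complex_ofReal]
    have h2 : ∀ x, ((‖solidSum s f x‖ ^ 2 : ℝ) : ℂ) =
        ∑ n ∈ s, ∑ m ∈ s, solid n (f n) x * conj (solid m (f m) x) := by
      intro x
      rw [← Complex.normSq_eq_norm_sq, ← Complex.mul_conj, solidSum, map_sum, Finset.sum_mul_sum]
    simp only [h2]
    rw [integral_finsetSum _ fun n _ => integrable_finsetSum _ fun m _ => hint n m]
    rw [Complex.ofReal_sum]
    refine Finset.sum_congr rfl fun n hn => ?_
    rw [integral_finsetSum _ fun m _ => hint n m]
    simp only [integral_annulus_solid_mul]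
    rw [Finset.sum_eq_single_of_mem n hn fun m hm hmn => by
      rw [ip_eq_zero_of_mem_Harm hmn.symm (hf n hn) (hf m hm), mul_zero], ip_self,
      Complex.ofReal_mul, ← integral_complex_ofReal]
    congr 1
    refine integral_congr_ae (Eventually.of_forall fun t => ?_)
    by_cases ht : t ∈ Icc (1 - ε) (1 + ε)
    · simp only [indicator_of_mem ht, Complex.ofReal_mul]
    · simp only [indicator_of_notMem ht, mul_zero, Complex.ofReal_zero]
  rw [Complex.ofReal_inj] at h1
  rw [h1, Finset.mul_sum]
  refine Finset.sum_le_sum fun n hn => mul_le_mul_of_nonneg_right ?_ (normSq_nonneg _)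
  refine (setIntegral_radial_le hε0 hε.le (n + n)).trans ?_
  refine mul_le_mul_of_nonneg_left ?_ (by positivity)
  exact pow_le_pow_right₀ (by linarith) (by have := hs n hn; omega)

/-- A Nikolskii type inequality: sup-norm bound for sums of spherical harmonics of bounded order
with the sharp power of the order. -/
theorem exists_norm_sq_sum_le (d : ℕ) [Fact (2 ≤ d)] : ∃ C : ℝ, 0 < C ∧ ∀ (N : ℕ), 1 ≤ N →
    ∀ (s : Finset ℕ), (∀ n ∈ s, n ≤ N) → ∀ f : ℕ → Schwartz d, (∀ n ∈ s, f n ∈ Harm d n) →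
      ∀ r, ‖∑ n ∈ s, f n r‖ ^ 2 ≤ C * (N : ℝ) ^ (d - 1) * ∑ n ∈ s, normSq (f n) := by
  have hc := integral_truncPow_pos (d := d) 1
  set c := ∫ y : Amb d, truncPow (1 + 1) y with hcdef
  refine ⟨2 ^ d * 2 ^ (d - 1) * Real.exp 1 / c, by positivity, fun N hN s hs f hf r => ?_⟩
  have hN' : (1 : ℝ) ≤ N := by exact_mod_cast hN
  -- This radius balances the estimate: (1 + ε)^(2N) ≤ e stays bounded, while dividing the shell
  -- thickness 2ε by the scaling factor ε^d of the ball produces 2^d N^(d-1).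
  set ε : ℝ := 1 / (2 * N) with hε
  have hε0 : 0 < ε := by positivity
  have hε2 : ε ≤ 1 / 2 := by
    rw [hε]
    exact one_div_le_one_div_of_le (by norm_num) (by linarith)
  have hr1 : ‖(r : Amb d)‖ = 1 := norm_eq_of_mem_sphere r
  obtain ⟨G, hG, hGF⟩ := exists_contDiff_eq_on_ball (smoothOff_solidSum s f) r
  have hne : ∀ y ∈ ball (r : Amb d) (3 / 4), y ≠ 0 := by
    rintro y hy rfl
    rw [mem_ball, dist_zero_left, hr1] at hy
    norm_num at hy
  have hlapG : ∀ y ∈ ball (r : Amb d) (3 / 4), lap G y = 0 := by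
    intro y hy
    rw [← lap_solidSum hf (hne y hy)]
    refine Finset.sum_congr rfl fun i _ => pd_congr ?_ i
    filter_upwards [isOpen_ball.mem_nhds hy] with z hz
    exact pd_congr (Filter.eventuallyEq_of_mem (isOpen_ball.mem_nhds hz) hGF) i
  have h1 := norm_sq_le_integral_truncPow hG hlapG (s := ε) (by rw [abs_of_pos hε0]; linarith)
  rw [hGF r (mem_ball_self (by norm_num)), solidSum_coe] at h1
  set K := annulus d ε
  let g : Amb d → ℝ := K.indicator fun x => ‖solidSum s f x‖ ^ 2
  have hgint : Integrable g := by
    rw [integrable_indicator_iff (isCompact_annulus ε).measurableSet]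
    refine ContinuousOn.integrableOn_compact (isCompact_annulus ε) fun x hx => ?_
    exact ((smoothOff_solidSum s f x (ne_zero_of_mem_annulus (by linarith)
      hx)).continuousAt.norm.pow 2).continuousWithinAt
  have hg0 : ∀ x, 0 ≤ g x := fun x => indicator_nonneg (fun _ _ => sq_nonneg _) x
  have h2 : ∫ y, truncPow 2 y * ‖G ((r : Amb d) + ε • y)‖ ^ 2 ≤ ∫ y, g ((r : Amb d) + ε • y) := by
    refine integral_mono_of_nonneg (Eventually.of_forall fun y =>
      mul_nonneg (truncPow_nonneg _ _) (sq_nonneg _))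
      ((hgint.comp_add_left (r : Amb d)).comp_smul hε0.ne') (Eventually.of_forall fun y => ?_)
    by_cases hy : 1 ≤ ‖y‖
    · simp only [truncPow_eq_zero 1 hy, zero_mul]
      exact hg0 _
    · push Not at hy
      have hn : ‖ε • y‖ ≤ ε := by
        rw [norm_smul, Real.norm_of_nonneg hε0.le]
        nlinarith
      have hmem : (r : Amb d) + ε • y ∈ K := by
        have h3 := norm_add_le (r : Amb d) (ε • y)
        have h4 := norm_sub_le ((r : Amb d) + ε • y) (ε • y)
        rw [add_sub_cancel_right] at h4
        exact ⟨by linarith, by linarith⟩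
      have hb : (r : Amb d) + ε • y ∈ ball (r : Amb d) (3 / 4) := by
        rw [mem_ball, dist_self_add_left]
        linarith
      simp only [g, indicator_of_mem hmem, hGF _ hb]
      exact mul_le_of_le_one_left (sq_nonneg _) (truncPow_le_one _ _)
  have h3 : ∫ y, g ((r : Amb d) + ε • y) = (ε ^ d)⁻¹ * ∫ x, g x := by
    have := Measure.integral_comp_smul (volume : Measure (Amb d)) (fun y => g ((r : Amb d) + y)) ε
    rw [this, integral_add_left_eq_self g (r : Amb d)]
    simp [abs_of_pos hε0]
  have h4 := integral_annulus_normSq_le hε0 (by linarith) hs hf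
  rw [← integral_indicator (isCompact_annulus ε).measurableSet] at h4
  have hS : 0 ≤ ∑ n ∈ s, normSq (f n) := Finset.sum_nonneg fun _ _ => normSq_nonneg _
  have h5 : (1 + ε) ^ (d - 1 + 2 * N) ≤ 2 ^ (d - 1) * Real.exp 1 := by
    rw [pow_add]
    refine mul_le_mul (pow_le_pow_left₀ (by positivity) (by linarith) _) ?_ (by positivity)
      (by positivity)
    have h6 : (1 + ε) ^ (2 * N) ≤ Real.exp ε ^ (2 * N) :=
      pow_le_pow_left₀ (by positivity) (by linarith [Real.add_one_le_exp ε]) _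
    refine h6.trans_eq ?_
    rw [← Real.exp_nat_mul]
    congr 1
    rw [hε]
    push_cast
    field_simp
  have hεd : (ε ^ d)⁻¹ * (2 * ε) = 2 ^ d * (N : ℝ) ^ (d - 1) := by
    obtain ⟨k, hk⟩ : ∃ k, d = k + 1 := ⟨d - 1, by have := (Fact.out : 2 ≤ d); omega⟩
    have hd1 : d - 1 = k := by omega
    have hN0 : (N : ℝ) ≠ 0 := by positivity
    rw [hd1, hk, hε, one_div, inv_pow, inv_inv, mul_inv, mul_pow, pow_succ (N : ℝ)]
    field_simp
  have h7 : c * ‖∑ n ∈ s, f n r‖ ^ 2 ≤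
      2 ^ d * 2 ^ (d - 1) * Real.exp 1 * (N : ℝ) ^ (d - 1) * ∑ n ∈ s, normSq (f n) := by
    calc c * ‖∑ n ∈ s, f n r‖ ^ 2 ≤ (ε ^ d)⁻¹ * ∫ x, g x := (h1.trans h2).trans_eq h3
      _ ≤ (ε ^ d)⁻¹ * (2 * ε * (1 + ε) ^ (d - 1 + 2 * N) * ∑ n ∈ s, normSq (f n)) :=
        mul_le_mul_of_nonneg_left h4 (by positivity)
      _ = ((ε ^ d)⁻¹ * (2 * ε)) * ((1 + ε) ^ (d - 1 + 2 * N) * ∑ n ∈ s, normSq (f n)) := by ring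
      _ ≤ ((ε ^ d)⁻¹ * (2 * ε)) * (2 ^ (d - 1) * Real.exp 1 * ∑ n ∈ s, normSq (f n)) :=
        mul_le_mul_of_nonneg_left (mul_le_mul_of_nonneg_right h5 hS) (by positivity)
      _ = _ := by
        rw [hεd]
        ring
  rw [div_mul_eq_mul_div, div_mul_eq_mul_div, le_div_iff₀ hc]
  linarith

end Spherical

namespace Spherical

variable {d : ℕ} [Fact (2 ≤ d)]

/-! ### Projections onto the spaces of spherical harmonics -/

/-- The embedding of smooth functions into `ℒ²`. -/
noncomputable def toL2 (d : ℕ) [Fact (2 ≤ d)] : Schwartz d →ₗ[ℂ] Lp ℂ 2 (surf d) :=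
  (ContinuousMap.toLp 2 (surf d) ℂ : C(Sph d, ℂ) →L[ℂ] Lp ℂ 2 (surf d)).toLinearMap ∘ₗ toContₗ d

theorem coeFn_toL2 (f : Schwartz d) : toL2 d f =ᵐ[surf d] f :=
  ContinuousMap.coeFn_toLp (𝕜 := ℂ) (surf d) (toContₗ d f)

theorem inner_toL2 (f g : Schwartz d) : inner ℂ (toL2 d f) (toL2 d g) = ip g f := by
  rw [L2.inner_def]
  refine integral_congr_ae ?_
  filter_upwards [coeFn_toL2 f, coeFn_toL2 g] with r hf hg
  rw [hf, hg]
  rfl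

theorem norm_toL2_sq (f : Schwartz d) : ‖toL2 d f‖ ^ 2 = normSq f := by
  have h := inner_self_eq_norm_sq_to_K (𝕜 := ℂ) (toL2 d f)
  rw [inner_toL2, ip_self] at h
  rw [← Complex.ofReal_inj, h, Complex.ofReal_pow]
  rfl

theorem norm_toL2 (f : Schwartz d) : ‖toL2 d f‖ = √(normSq f) := by
  rw [← norm_toL2_sq, Real.sqrt_sq (norm_nonneg _)]

theorem normSq_smul (c : ℂ) (f : Schwartz d) : normSq (c • f) = ‖c‖ ^ 2 * normSq f := by
  rw [← norm_toL2_sq, map_smul, norm_smul, mul_pow, norm_toL2_sq]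

theorem norm_apply_le (f : Schwartz d) (r : Sph d) : ‖f r‖ ≤ ‖toCont d f‖ :=
  (toCont d f).norm_coe_le_norm r

theorem normSq_le (f : Schwartz d) : normSq f ≤ (surf d).real univ * ‖toCont d f‖ ^ 2 := by
  have h : ∫ r, ‖f r‖ ^ 2 ∂(surf d) ≤ ∫ _r, ‖toCont d f‖ ^ 2 ∂(surf d) := by
    refine integral_mono_of_nonneg (Eventually.of_forall fun r => sq_nonneg _)
      (integrable_const _) (Eventually.of_forall fun r => ?_)
    exact pow_le_pow_left₀ (norm_nonneg _) (norm_apply_le f r) 2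
  rwa [integral_const, smul_eq_mul] at h

/-- Sup-norm bound for a single spherical harmonic. -/
theorem exists_norm_toCont_sq_le (d : ℕ) [Fact (2 ≤ d)] : ∃ C : ℝ, 0 < C ∧
    ∀ (n : ℕ), ∀ f ∈ Harm d n, ‖toCont d f‖ ^ 2 ≤ C * ((n : ℝ) + 1) ^ (d - 1) * normSq f := by
  obtain ⟨C, hC, h⟩ := exists_norm_sq_sum_le d
  refine ⟨C, hC, fun n f hf => ?_⟩
  have hb : 0 ≤ C * ((n : ℝ) + 1) ^ (d - 1) * normSq f :=
    mul_nonneg (by positivity) (normSq_nonneg f)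
  rw [← Real.sqrt_le_sqrt_iff hb, Real.sqrt_sq (norm_nonneg _),
    ContinuousMap.norm_le _ (Real.sqrt_nonneg _)]
  intro r
  -- The bound is taken with N = n + 1, since N ≥ 1 is required and n may be 0.
  have h1 := h (n + 1) (by omega) {n} (by simp) (fun _ => f) (by simpa using hf) r
  simp only [Finset.sum_singleton, Nat.cast_add, Nat.cast_one] at h1
  exact Real.le_sqrt_of_sq_le h1

/-! ### Finite dimension of the spaces of harmonics -/

/-- The spherical harmonics of order `n` as a subspace of `ℒ²`. -/
noncomputable def harmL2 (d : ℕ) [Fact (2 ≤ d)] (n : ℕ) : Submodule ℂ (Lp ℂ 2 (surf d)) :=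
  (Harm d n).map (toL2 d)

/-- Reproducing kernel argument: f = ∑ conj(Y_i(r)) Y_i has both f(r) and ‖f‖₂² equal to T = ∑
|Y_i(r)|², so the sup-norm bound says T² ≤ C T, that is T ≤ C. Integrating T over r counts the
family. -/
theorem card_le_of_orthonormal_harmL2 {C : ℝ} (hC0 : 0 ≤ C) {n k : ℕ}
    (hC : ∀ f ∈ Harm d n, ‖toCont d f‖ ^ 2 ≤ C * normSq f) {v : Fin k → Lp ℂ 2 (surf d)}
    (hv : Orthonormal ℂ v) (hmem : ∀ i, v i ∈ harmL2 d n) : (k : ℝ) ≤ (surf d).real univ * C := by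
  choose Y hY hYv using hmem
  have hip : ∀ i j, ip (Y i) (Y j) = if i = j then 1 else 0 := by
    intro i j
    rw [← inner_toL2, hYv, hYv, orthonormal_iff_ite.1 hv]
    simp [eq_comm]
  have hpt : ∀ r, ∑ i, ‖Y i r‖ ^ 2 ≤ C := by
    intro r
    set T := ∑ i, ‖Y i r‖ ^ 2 with hT
    have hT0 : 0 ≤ T := Finset.sum_nonneg fun _ _ => sq_nonneg _
    let f : Schwartz d := ∑ i, conj (Y i r) • Y i
    have hf : f ∈ Harm d n := Submodule.sum_mem _ fun i _ => Submodule.smul_mem _ _ (hY i)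
    have hfr : f r = (T : ℂ) := by
      simp only [f, Schwartz.sum_apply, Schwartz.smul_apply, hT, Complex.ofReal_sum]
      exact Finset.sum_congr rfl fun i _ => by
        rw [← Complex.normSq_eq_conj_mul_self, Complex.normSq_eq_norm_sq]
    have hfn : normSq f = T := by
      rw [← Complex.ofReal_inj, ← ip_self]
      simp only [f, ip_sum_left, ip_sum_right, ip_smul_left, ip_smul_right, hip, mul_ite, mul_one,
        mul_zero, Finset.sum_ite_eq', Finset.mem_univ, if_true, hT, Complex.ofReal_sum]
      exact Finset.sum_congr rfl fun i _ => by
        simp [Complex.mul_conj, Complex.normSq_eq_norm_sq]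
    have h1 := (pow_le_pow_left₀ (norm_nonneg _) (norm_apply_le f r) 2).trans (hC f hf)
    rw [hfr, hfn, Complex.norm_real, Real.norm_of_nonneg hT0] at h1
    by_contra! hlt
    nlinarith
  have hk : (k : ℝ) = ∫ r, ∑ i, ‖Y i r‖ ^ 2 ∂(surf d) := by
    have hi : ∀ i, Integrable (fun r => ‖Y i r‖ ^ 2) (surf d) := fun i =>
      ((Y i).contMDiff.continuous.norm.pow 2).integrable_of_hasCompactSupport
        (HasCompactSupport.of_compactSpace _)
    rw [integral_finsetSum _ fun i _ => hi i]
    have : ∀ i, ∫ r, ‖Y i r‖ ^ 2 ∂(surf d) = 1 := by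
      intro i
      have h1 := ip_self (Y i)
      rw [hip, if_pos rfl] at h1
      exact_mod_cast h1.symm
    simp [this]
  have h2 : ∫ r, ∑ i, ‖Y i r‖ ^ 2 ∂(surf d) ≤ ∫ _r, C ∂(surf d) :=
    integral_mono_of_nonneg (Eventually.of_forall fun r => Finset.sum_nonneg fun _ _ => sq_nonneg _)
      (integrable_const _) (Eventually.of_forall hpt)
  rw [hk]
  refine h2.trans_eq ?_
  rw [integral_const, smul_eq_mul]

/-- The span of a finite independent set has an orthonormal basis of the same cardinality, so
bounding orthonormal families bounds the rank. -/
instance finiteDimensional_harmL2 (n : ℕ) : FiniteDimensional ℂ (harmL2 d n) := by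
  obtain ⟨C, hC, h⟩ := exists_norm_toCont_sq_le d
  obtain ⟨K, hK⟩ := exists_nat_ge ((surf d).real univ * (C * ((n : ℝ) + 1) ^ (d - 1)))
  have hrank : Module.rank ℂ (harmL2 d n) ≤ K := by
    refine rank_le fun s hs => ?_
    let V : Submodule ℂ (harmL2 d n) := Submodule.span ℂ (s : Set (harmL2 d n))
    have hfin : FiniteDimensional ℂ V := FiniteDimensional.span_finset ℂ s
    have hV : finrank ℂ V = s.card := finrank_span_finset_eq_card hs
    let b := stdOrthonormalBasis ℂ V
    have hb : Orthonormal ℂ (fun i => (((b i : V) : harmL2 d n) : Lp ℂ 2 (surf d))) :=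
      (b.orthonormal.comp_linearIsometry V.subtypeₗᵢ).comp_linearIsometry (harmL2 d n).subtypeₗᵢ
    have := (card_le_of_orthonormal_harmL2 (by positivity) (h n) hb fun i => (b i : harmL2 d n).2).trans hK
    rw [← hV]
    exact_mod_cast this
  exact Module.rank_lt_aleph0_iff.1 (hrank.trans_lt (Cardinal.natCast_lt_aleph0))

/-- Finite dimension supplies the orthogonal projection in ℒ², whose values come from smooth
functions by definition of `harmL2`. So the default value 0 in `harmPart` never occurs. -/
theorem exists_isHarmPart (n : ℕ) (h : Schwartz d) : ∃ q, IsHarmPart n h q := by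
  obtain ⟨q, hq, hqP⟩ := ((harmL2 d n).orthogonalProjectionOnto (toL2 d h)).2
  refine ⟨q, hq, fun Y hY => ?_⟩
  have h1 := (harmL2 d n).starProjection_inner_eq_zero (toL2 d h) (toL2 d Y)
    (Submodule.mem_map_of_mem hY)
  rw [Submodule.starProjection_apply, ← hqP, ← map_sub, inner_toL2] at h1
  have h2 : ip (h - q) Y = 0 := by rw [← ip_conj, h1, map_zero]
  rwa [ip_sub_left, sub_eq_zero] at h2

theorem isHarmPart_harmPart (n : ℕ) (h : Schwartz d) : IsHarmPart n h (harmPart n h) := by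
  rw [harmPart, dif_pos (exists_isHarmPart n h)]
  exact (exists_isHarmPart n h).choose_spec

theorem harmPart_mem (n : ℕ) (h : Schwartz d) : harmPart n h ∈ Harm d n :=
  (isHarmPart_harmPart n h).1

theorem ip_harmPart {n : ℕ} (h : Schwartz d) {Y : Schwartz d} (hY : Y ∈ Harm d n) :
    ip (harmPart n h) Y = ip h Y :=
  ((isHarmPart_harmPart n h).2 Y hY).symm

theorem IsHarmPart.harmPart_eq {n : ℕ} {h q : Schwartz d} (hq : IsHarmPart n h q) :
    harmPart n h = q :=
  (isHarmPart_harmPart n h).unique hq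

theorem harmPart_add (n : ℕ) (f g : Schwartz d) :
    harmPart n (f + g) = harmPart n f + harmPart n g :=
  IsHarmPart.harmPart_eq ⟨add_mem (harmPart_mem n f) (harmPart_mem n g), fun Y hY => by
    rw [ip_add_left, ip_add_left, ip_harmPart f hY, ip_harmPart g hY]⟩

theorem harmPart_smul (n : ℕ) (c : ℂ) (f : Schwartz d) :
    harmPart n (c • f) = c • harmPart n f :=
  IsHarmPart.harmPart_eq ⟨Submodule.smul_mem _ _ (harmPart_mem n f), fun Y hY => by
    rw [ip_smul_left, ip_smul_left, ip_harmPart f hY]⟩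

theorem harmPart_sub (n : ℕ) (f g : Schwartz d) :
    harmPart n (f - g) = harmPart n f - harmPart n g :=
  IsHarmPart.harmPart_eq ⟨sub_mem (harmPart_mem n f) (harmPart_mem n g), fun Y hY => by
    rw [ip_sub_left, ip_sub_left, ip_harmPart f hY, ip_harmPart g hY]⟩

theorem harmPart_of_mem {n : ℕ} {Y : Schwartz d} (hY : Y ∈ Harm d n) : harmPart n Y = Y :=
  IsHarmPart.harmPart_eq ⟨hY, fun _ _ => rfl⟩

theorem harmPart_of_mem_of_ne {n m : ℕ} (hnm : n ≠ m) {Y : Schwartz d} (hY : Y ∈ Harm d n) :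
    harmPart m Y = 0 :=
  IsHarmPart.harmPart_eq ⟨zero_mem _, fun Z hZ => by
    rw [ip_zero_left, ip_eq_zero_of_mem_Harm hnm hY hZ]⟩

theorem harmPart_lapBeltrami (n : ℕ) (f : Schwartz d) :
    harmPart n (lapBeltrami d f) = ((-lapEig d n : ℝ) : ℂ) • harmPart n f :=
  IsHarmPart.harmPart_eq ⟨Submodule.smul_mem _ _ (harmPart_mem n f), fun Y hY => by
    rw [ip_lapBeltrami, mem_Harm_iff.1 hY, ip_smul_left, ip_smul_right, ip_harmPart f hY,
      Complex.conj_ofReal]⟩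

theorem Schwartz.conj_mem_Harm {n : ℕ} {f : Schwartz d} (hf : f ∈ Harm d n) :
    f.conj ∈ Harm d n := by
  have hlin : ∀ (c : ℝ) (g : Schwartz d), ((c : ℂ) • g).conj = (c : ℂ) • g.conj := fun c g =>
    DFunLike.ext _ _ fun r => by
      rw [Schwartz.conj_apply, Schwartz.smul_apply, Schwartz.smul_apply, map_mul,
        Complex.conj_ofReal, Schwartz.conj_apply]
  have hlap : lapBeltrami d f.conj = (lapBeltrami d f).conj := by
    rw [lapBeltrami_eq_sum, lapBeltrami_eq_sum]
    refine DFunLike.ext _ _ fun r => ?_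
    simp [Schwartz.sum_apply, sphRot_conj, map_ofNat (starRingEnd ℂ) 2]
  rw [mem_Harm_iff] at hf ⊢
  rw [hlap, hf, hlin]

theorem ip_conj_conj (f g : Schwartz d) : ip f.conj g.conj = conj (ip f g) := by
  rw [ip, ip, ← integral_conj]
  simp

/-- The duality product is bilinear but `ip` is sesquilinear. Passing between them needs real
multipliers to commute with conjugation, which comes from here. -/
theorem harmPart_conj (n : ℕ) (f : Schwartz d) : harmPart n f.conj = (harmPart n f).conj :=
  IsHarmPart.harmPart_eq ⟨Schwartz.conj_mem_Harm (harmPart_mem n f), fun Y hY => by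
    rw [← Schwartz.conj_conj Y, ip_conj_conj, ip_conj_conj,
      ip_harmPart f (Schwartz.conj_mem_Harm hY)]⟩

theorem normSq_sum_of_mem_Harm (s : Finset ℕ) {f : ℕ → Schwartz d} (hf : ∀ n ∈ s, f n ∈ Harm d n) :
    normSq (∑ n ∈ s, f n) = ∑ n ∈ s, normSq (f n) := by
  rw [← Complex.ofReal_inj, ← ip_self, ip_sum_left, Complex.ofReal_sum]
  refine Finset.sum_congr rfl fun n hn => ?_
  rw [ip_sum_right, Finset.sum_eq_single_of_mem n hn fun m hm hmn =>
    ip_eq_zero_of_mem_Harm hmn.symm (hf n hn) (hf m hm), ip_self]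

/-- Bessel's inequality for the expansion in spherical harmonics. -/
theorem sum_normSq_harmPart_le (s : Finset ℕ) (h : Schwartz d) :
    ∑ n ∈ s, normSq (harmPart n h) ≤ normSq h := by
  set S := ∑ n ∈ s, harmPart n h with hS
  have h1 : normSq S = ∑ n ∈ s, normSq (harmPart n h) :=
    normSq_sum_of_mem_Harm s fun n _ => harmPart_mem n h
  have h2 : ip h S = normSq S := by
    rw [h1, hS, ip_sum_right, Complex.ofReal_sum]
    exact Finset.sum_congr rfl fun n _ => by rw [← ip_harmPart h (harmPart_mem n h), ip_self]
  have h3 : ip (h - S) (h - S) = (normSq h : ℂ) - normSq S := by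
    rw [ip_sub_left, ← ip_conj (h - S) h, ← ip_conj (h - S) S, ip_sub_left, ip_sub_left, h2,
      ip_self, ip_self, ← ip_conj h S, h2]
    simp
  rw [ip_self, ← Complex.ofReal_sub, Complex.ofReal_inj] at h3
  have := normSq_nonneg (h - S)
  linarith

theorem normSq_harmPart_le (n : ℕ) (h : Schwartz d) : normSq (harmPart n h) ≤ normSq h := by
  simpa using sum_normSq_harmPart_le {n} h

theorem add_one_le_one_add_lapEig (n : ℕ) : (n : ℝ) + 1 ≤ 1 + lapEig d n := by
  have : (2 : ℝ) ≤ d := by exact_mod_cast (Fact.out : 2 ≤ d)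
  have h2 : (n : ℝ) ≤ (n : ℝ) * n := by
    rcases n with _ | n
    · simp
    · push_cast
      nlinarith [(Nat.cast_nonneg n : (0 : ℝ) ≤ n)]
  rw [lapEig]
  nlinarith [(Nat.cast_nonneg n : (0 : ℝ) ≤ n)]

theorem lapEig_le (n : ℕ) : lapEig d n ≤ d * ((n : ℝ) + 1) ^ 2 := by
  have : (2 : ℝ) ≤ d := by exact_mod_cast (Fact.out : 2 ≤ d)
  rw [lapEig]
  nlinarith [(Nat.cast_nonneg n : (0 : ℝ) ≤ n), mul_nonneg (Nat.cast_nonneg n : (0 : ℝ) ≤ n)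
    (Nat.cast_nonneg d : (0 : ℝ) ≤ d), mul_nonneg (sq_nonneg (n : ℝ)) (by linarith : (0 : ℝ) ≤ d - 1)]

end Spherical

namespace Spherical

variable {d : ℕ} [Fact (2 ≤ d)]

/-! ### Rapidly decreasing series of spherical harmonics -/

/-- A sequence of spherical harmonics, the `n`-th of order `n`, with rapidly decreasing norms. -/
structure RapidDecay (Y : ℕ → Schwartz d) : Prop where
  mem : ∀ n, Y n ∈ Harm d n
  decay : ∀ k : ℕ, ∃ C : ℝ, ∀ n : ℕ, ((n : ℝ) + 1) ^ k * normSq (Y n) ≤ C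

/-- A rotation preserves the order and costs two powers of n + 1 in the squared norm, so it keeps
the class of rapidly decreasing sequences stable. -/
theorem RapidDecay.sphRot {Y : ℕ → Schwartz d} (hY : RapidDecay Y) (i j : Fin d) :
    RapidDecay (fun n => sphRot i j (Y n)) := by
  refine ⟨fun n => sphRot_mem_Harm (hY.mem n) i j, fun k => ?_⟩
  obtain ⟨C, hC⟩ := hY.decay (k + 2)
  refine ⟨2 * d * C, fun n => ?_⟩
  have h1 : normSq (Spherical.sphRot i j (Y n)) ≤ 2 * (d * ((n : ℝ) + 1) ^ 2) * normSq (Y n) :=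
    (normSq_sphRot_le (hY.mem n) i j).trans (mul_le_mul_of_nonneg_right
      (mul_le_mul_of_nonneg_left (lapEig_le n) zero_le_two) (normSq_nonneg _))
  calc ((n : ℝ) + 1) ^ k * normSq (Spherical.sphRot i j (Y n))
      ≤ ((n : ℝ) + 1) ^ k * (2 * (d * ((n : ℝ) + 1) ^ 2) * normSq (Y n)) :=
        mul_le_mul_of_nonneg_left h1 (by positivity)
    _ = 2 * d * (((n : ℝ) + 1) ^ (k + 2) * normSq (Y n)) := by ring
    _ ≤ 2 * d * C := mul_le_mul_of_nonneg_left (hC n) (by positivity)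

/-- Sequences of at most polynomial growth. -/
def PolyBounded (c : ℕ → ℝ) : Prop := ∃ (C : ℝ) (q : ℕ), ∀ n : ℕ, |c n| ≤ C * ((n : ℝ) + 1) ^ q

theorem RapidDecay.smul {Y : ℕ → Schwartz d} (hY : RapidDecay Y) {c : ℕ → ℝ}
    (hc : PolyBounded c) : RapidDecay (fun n => (c n : ℂ) • Y n) := by
  obtain ⟨A, q, hA⟩ := hc
  refine ⟨fun n => Submodule.smul_mem _ _ (hY.mem n), fun k => ?_⟩
  obtain ⟨C, hC⟩ := hY.decay (k + 2 * q)
  refine ⟨A ^ 2 * C, fun n => ?_⟩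
  have h1 : |c n| ^ 2 ≤ (A * ((n : ℝ) + 1) ^ q) ^ 2 := pow_le_pow_left₀ (abs_nonneg _) (hA n) 2
  rw [normSq_smul, Complex.norm_real, Real.norm_eq_abs]
  calc ((n : ℝ) + 1) ^ k * (|c n| ^ 2 * normSq (Y n))
      ≤ ((n : ℝ) + 1) ^ k * ((A * ((n : ℝ) + 1) ^ q) ^ 2 * normSq (Y n)) :=
        mul_le_mul_of_nonneg_left (mul_le_mul_of_nonneg_right h1 (normSq_nonneg _)) (by positivity)
    _ = A ^ 2 * (((n : ℝ) + 1) ^ (k + 2 * q) * normSq (Y n)) := by ring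
    _ ≤ A ^ 2 * C := mul_le_mul_of_nonneg_left (hC n) (by positivity)

/-- The operator `Id - Δ`. -/
noncomputable abbrev idSubLap (d : ℕ) [Fact (2 ≤ d)] : End ℂ (Schwartz d) :=
  LinearMap.id - lapBeltrami d

theorem harmPart_id_sub_lapBeltrami_pow (n k : ℕ) (h : Schwartz d) :
    harmPart n ((idSubLap d ^ k) h) =
      (((1 + lapEig d n) ^ k : ℝ) : ℂ) • harmPart n h := by
  induction k with
  | zero => simp
  | succ k ih =>
    rw [pow_succ', Module.End.mul_apply, LinearMap.sub_apply, LinearMap.id_apply, harmPart_sub,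
      harmPart_lapBeltrami, ih, smul_smul, ← sub_smul]
    congr 1
    push_cast
    ring

/-- The parts of (Id - Δ)^k h are (1 + λ_n)^k times those of h and have norm at most that of (Id -
Δ)^k h. Since 1 + λ_n ≥ n + 1, this is decay of every order. -/
theorem rapidDecay_harmPart (h : Schwartz d) : RapidDecay (fun n => harmPart n h) := by
  refine ⟨fun n => harmPart_mem n h, fun k =>
    ⟨normSq ((idSubLap d ^ k) h), fun n => ?_⟩⟩
  have h1 := normSq_harmPart_le n ((idSubLap d ^ k) h)
  rw [harmPart_id_sub_lapBeltrami_pow, normSq_smul, Complex.norm_real, norm_pow, ← pow_mul] at h1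
  refine le_trans (mul_le_mul_of_nonneg_right ?_ (normSq_nonneg _)) h1
  have h2 := add_one_le_one_add_lapEig (d := d) n
  have h3 : (1 : ℝ) ≤ 1 + lapEig d n := by linarith [lapEig_nonneg (d := d) n]
  rw [Real.norm_of_nonneg (by linarith)]
  calc ((n : ℝ) + 1) ^ k ≤ (1 + lapEig d n) ^ k := pow_le_pow_left₀ (by positivity) h2 k
    _ ≤ (1 + lapEig d n) ^ (k * 2) := pow_le_pow_right₀ h3 (by omega)

theorem RapidDecay.summable {Y : ℕ → Schwartz d} (hY : RapidDecay Y) :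
    Summable fun n => ‖toCont d (Y n)‖ := by
  obtain ⟨A, hA, h⟩ := exists_norm_toCont_sq_le d
  -- The power d - 1 pays for the sup-norm; after a square root the remaining four leave the
  -- summable (n + 1)^(-2).
  obtain ⟨C, hC⟩ := hY.decay (d - 1 + 4)
  have hb : ∀ n, ‖toCont d (Y n)‖ ≤ √(A * C) * (1 / ((n + 1 : ℕ) : ℝ) ^ 2) := by
    intro n
    have h1 : (‖toCont d (Y n)‖ * ((n : ℝ) + 1) ^ 2) ^ 2 ≤ A * C := by
      calc (‖toCont d (Y n)‖ * ((n : ℝ) + 1) ^ 2) ^ 2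
          = ‖toCont d (Y n)‖ ^ 2 * ((n : ℝ) + 1) ^ 4 := by ring
        _ ≤ (A * ((n : ℝ) + 1) ^ (d - 1) * normSq (Y n)) * ((n : ℝ) + 1) ^ 4 :=
          mul_le_mul_of_nonneg_right (h n _ (hY.mem n)) (by positivity)
        _ = A * (((n : ℝ) + 1) ^ (d - 1 + 4) * normSq (Y n)) := by ring
        _ ≤ A * C := mul_le_mul_of_nonneg_left (hC n) hA.le
    have h2 := Real.le_sqrt_of_sq_le h1
    rw [mul_one_div, le_div_iff₀ (by positivity)]
    simpa using h2
  refine Summable.of_nonneg_of_le (fun n => norm_nonneg _) hb (Summable.mul_left _ ?_)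
  exact (summable_nat_add_iff 1).2 (Real.summable_one_div_nat_pow.2 one_lt_two)

theorem norm_radialExt_le (f : Schwartz d) (x : Amb d) : ‖radialExt f x‖ ≤ ‖toCont d f‖ := by
  rw [radialExt]
  split_ifs
  · simp
  · exact norm_apply_le f _

theorem RapidDecay.summable_radialExt {Y : ℕ → Schwartz d} (hY : RapidDecay Y) (x : Amb d) :
    Summable fun n => radialExt (Y n) x :=
  Summable.of_norm_bounded hY.summable fun n => norm_radialExt_le (Y n) x

/-- The partial derivatives of a `0`-homogeneous function in terms of its rotations. -/
theorem pd_radialExt (f : Schwartz d) {x : Amb d} (hx : x ≠ 0) (j : Fin d) :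
    pd j (radialExt f) x =
      ∑ i, ((‖x‖ ^ 2 : ℝ) : ℂ)⁻¹ * crd i x * radialExt (sphRot i j f) x := by
  have hn : ((‖x‖ ^ 2 : ℝ) : ℂ) ≠ 0 := by
    have := norm_ne_zero_iff.2 hx
    exact_mod_cast pow_ne_zero 2 this
  have h1 : ∑ i, crd i x * radialExt (sphRot i j f) x =
      ((‖x‖ ^ 2 : ℝ) : ℂ) * pd j (radialExt f) x := by
    have h2 : ∀ i, crd i x * radialExt (sphRot i j f) x =
        crd i x * crd i x * pd j (radialExt f) x - crd j x * (crd i x * pd i (radialExt f) x) := by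
      intro i
      rw [radialExt_sphRot _ _ _ hx, rot]
      ring
    simp only [h2, Finset.sum_sub_distrib, ← Finset.sum_mul, ← Finset.mul_sum, sum_crd_sq]
    have := euler_radialExt f hx
    rw [euler] at this
    rw [this]
    ring
  simp only [mul_assoc, ← Finset.mul_sum]
  rw [h1, inv_mul_cancel_left₀ hn]

theorem norm_crd_le {d : ℕ} (i : Fin d) (x : Amb d) : ‖crd i x‖ ≤ ‖x‖ := by
  rw [crd, Complex.norm_real]
  exact PiLp.norm_apply_le x i

theorem norm_pd_radialExt_le (f : Schwartz d) {x : Amb d} (hx : x ≠ 0) (j : Fin d) :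
    ‖pd j (radialExt f) x‖ ≤ ‖x‖⁻¹ * ∑ i, ‖toCont d (sphRot i j f)‖ := by
  have hn : 0 < ‖x‖ := norm_pos_iff.2 hx
  rw [pd_radialExt f hx, Finset.mul_sum]
  refine norm_sum_le_of_le _ fun i _ => ?_
  rw [norm_mul, norm_mul, norm_inv, Complex.norm_real, Real.norm_of_nonneg (sq_nonneg _)]
  refine mul_le_mul ?_ (norm_radialExt_le _ x) (norm_nonneg _) (by positivity)
  calc (‖x‖ ^ 2)⁻¹ * ‖crd i x‖ ≤ (‖x‖ ^ 2)⁻¹ * ‖x‖ :=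
        mul_le_mul_of_nonneg_left (norm_crd_le i x) (by positivity)
    _ = ‖x‖⁻¹ := by field_simp

theorem norm_fderiv_le_sum {d : ℕ} (F : Amb d → ℂ) (x : Amb d) :
    ‖fderiv ℝ F x‖ ≤ ∑ i, ‖pd i F x‖ := by
  refine ContinuousLinearMap.opNorm_le_bound _ (Finset.sum_nonneg fun _ _ => norm_nonneg _)
    fun v => ?_
  rw [fderiv_apply_eq_sum, Finset.sum_mul]
  refine norm_sum_le_of_le _ fun i _ => ?_
  rw [norm_mul, mul_comm]
  exact mul_le_mul_of_nonneg_left (norm_crd_le i v) (norm_nonneg _)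

theorem RapidDecay.hasFDerivAt {Y : ℕ → Schwartz d} (hY : RapidDecay Y) {x : Amb d} (hx : x ≠ 0) :
    HasFDerivAt (fun y => ∑' n, radialExt (Y n) y) (∑' n, fderiv ℝ (radialExt (Y n)) x) x ∧
      Summable fun n => fderiv ℝ (radialExt (Y n)) x := by
  have hn : 0 < ‖x‖ := norm_pos_iff.2 hx
  -- On this ball the factor ‖y‖⁻¹ in the derivative bound is at most 2 / ‖x‖, so the termwise
  -- derivatives are dominated uniformly.
  have hball : ∀ y ∈ ball x (‖x‖ / 2), y ≠ 0 ∧ ‖y‖⁻¹ ≤ 2 / ‖x‖ := by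
    intro y hy
    rw [mem_ball, dist_comm, dist_eq_norm] at hy
    have h1 := norm_sub_norm_le x y
    have h2 : ‖x‖ / 2 ≤ ‖y‖ := by linarith
    refine ⟨norm_pos_iff.1 (by linarith), ?_⟩
    rw [← inv_div]
    exact inv_anti₀ (by positivity) h2
  let u : ℕ → ℝ := fun n => ∑ j, 2 / ‖x‖ * ∑ i, ‖toCont d (Spherical.sphRot i j (Y n))‖
  have hu : Summable u := summable_sum fun j _ => (summable_sum fun i _ =>
    (hY.sphRot i j).summable).mul_left _
  have hbound : ∀ n, ∀ y ∈ ball x (‖x‖ / 2), ‖fderiv ℝ (radialExt (Y n)) y‖ ≤ u n := by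
    intro n y hy
    refine (norm_fderiv_le_sum _ y).trans (Finset.sum_le_sum fun j _ => ?_)
    exact (norm_pd_radialExt_le _ (hball y hy).1 j).trans (mul_le_mul_of_nonneg_right
      (hball y hy).2 (Finset.sum_nonneg fun _ _ => norm_nonneg _))
  have hmem : x ∈ ball x (‖x‖ / 2) := mem_ball_self (by positivity)
  refine ⟨hasFDerivAt_tsum_of_isPreconnected hu isOpen_ball (convex_ball x _).isPreconnected
    (fun n y hy => ((smoothOff_radialExt (Y n)).differentiableAt (hball y hy).1).hasFDerivAt)
    hbound hmem (hY.summable_radialExt x) hmem, ?_⟩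
  exact Summable.of_norm_bounded hu fun n => hbound n x hmem

theorem RapidDecay.hasSum_pd {Y : ℕ → Schwartz d} (hY : RapidDecay Y) {x : Amb d} (hx : x ≠ 0)
    (j : Fin d) :
    HasSum (fun n => pd j (radialExt (Y n)) x) (pd j (fun y => ∑' n, radialExt (Y n) y) x) := by
  obtain ⟨h1, h2⟩ := hY.hasFDerivAt hx
  rw [pd, h1.fderiv]
  exact h2.hasSum.mapL (ContinuousLinearMap.apply ℝ ℂ (EuclideanSpace.single j (1 : ℝ)))

theorem RapidDecay.pd_tsum {Y : ℕ → Schwartz d} (hY : RapidDecay Y) {x : Amb d} (hx : x ≠ 0)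
    (j : Fin d) : pd j (fun y => ∑' n, radialExt (Y n) y) x = ∑ i, ((‖x‖ ^ 2 : ℝ) : ℂ)⁻¹ *
      crd i x * ∑' n, radialExt (Spherical.sphRot i j (Y n)) x := by
  refine (hY.hasSum_pd hx j).unique ?_
  simp only [pd_radialExt _ hx]
  exact hasSum_sum fun i _ => ((hY.sphRot i j).summable_radialExt x).hasSum.mul_left _

/-- Bootstrapping: the derivative of the sum is a combination, with coefficients smooth off the
origin, of sums of rotated series. These are again rapidly decreasing, so the induction on k must
range over all series. -/
theorem RapidDecay.contDiffOn (k : ℕ) : ∀ {Y : ℕ → Schwartz d}, RapidDecay Y →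
    ContDiffOn ℝ k (fun x => ∑' n, radialExt (Y n) x) {0}ᶜ := by
  induction k with
  | zero =>
    intro Y hY
    exact contDiffOn_zero.2 fun x hx => (hY.hasFDerivAt hx).1.continuousAt.continuousWithinAt
  | succ k ih =>
    intro Y hY
    rw [Nat.cast_add, Nat.cast_one, contDiffOn_succ_iff_fderiv_of_isOpen isOpen_compl_singleton]
    refine ⟨fun x hx => (hY.hasFDerivAt hx).1.differentiableAt.differentiableWithinAt, ?_, ?_⟩
    · intro h
      exact absurd h (by simp)
    refine contDiffOn_clm_apply.2 fun v => ?_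
    have h1 : ContDiffOn ℝ k (fun x : Amb d => ∑ j, crd j v * ∑ i, ((‖x‖ ^ 2 : ℝ) : ℂ)⁻¹ *
        crd i x * ∑' n, radialExt (Spherical.sphRot i j (Y n)) x) {0}ᶜ := by
      refine ContDiffOn.sum fun j _ => contDiffOn_const.mul (ContDiffOn.sum fun i _ =>
        ContDiffOn.mul (ContDiffOn.mul ?_ (contDiff_crd i).contDiffOn) (ih (hY.sphRot i j)))
      have h2 : ContDiff ℝ k (fun x : Amb d => ((‖x‖ ^ 2 : ℝ) : ℂ)) :=
        Complex.ofRealCLM.contDiff.comp (contDiff_norm_sq ℝ)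
      refine h2.contDiffOn.inv fun x hx => ?_
      have := norm_ne_zero_iff.2 hx
      exact_mod_cast pow_ne_zero 2 this
    refine h1.congr fun x hx => ?_
    rw [fderiv_apply_eq_sum]
    exact Finset.sum_congr rfl fun j _ => by rw [hY.pd_tsum hx]

theorem RapidDecay.smoothOff {Y : ℕ → Schwartz d} (hY : RapidDecay Y) :
    SmoothOff (fun x => ∑' n, radialExt (Y n) x) := fun _ hx =>
  (contDiffOn_infty.2 fun k => RapidDecay.contDiffOn k hY).contDiffAt
    (isOpen_compl_singleton.mem_nhds hx)

/-- The sum of a rapidly decreasing series of spherical harmonics. -/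
noncomputable def RapidDecay.sum {Y : ℕ → Schwartz d} (hY : RapidDecay Y) : Schwartz d :=
  hY.smoothOff.restr

theorem RapidDecay.hasSum_apply {Y : ℕ → Schwartz d} (hY : RapidDecay Y) (r : Sph d) :
    HasSum (fun n => Y n r) (hY.sum r) := by
  have h := (hY.summable_radialExt r).hasSum
  simp only [radialExt_coe] at h
  have h2 : hY.sum r = ∑' n, Y n r := by
    simp only [RapidDecay.sum, SmoothOff.restr_apply, radialExt_coe]
  rwa [h2]

theorem RapidDecay.radialExt_sum {Y : ℕ → Schwartz d} (hY : RapidDecay Y) (x : Amb d) :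
    radialExt hY.sum x = ∑' n, radialExt (Y n) x := by
  by_cases hx : x = 0
  · simp [radialExt, hx]
  · rw [radialExt, dif_neg hx, ← (hY.hasSum_apply _).tsum_eq]
    simp only [radialExt, dif_neg hx]

theorem RapidDecay.sphRot_sum {Y : ℕ → Schwartz d} (hY : RapidDecay Y) (i j : Fin d) :
    Spherical.sphRot i j hY.sum = (hY.sphRot i j).sum := by
  refine DFunLike.ext _ _ fun r => ?_
  have hr : (r : Amb d) ≠ 0 := coe_ne_zero r
  refine HasSum.unique ?_ ((hY.sphRot i j).hasSum_apply r)
  rw [sphRot_apply, funext hY.radialExt_sum, rot]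
  exact ((hY.hasSum_pd hr j).mul_left _).sub ((hY.hasSum_pd hr i).mul_left _)

theorem RapidDecay.lapBeltrami_sum {Y : ℕ → Schwartz d} (hY : RapidDecay Y) (r : Sph d) :
    HasSum (fun n => lapBeltrami d (Y n) r) (lapBeltrami d hY.sum r) := by
  simp only [lapBeltrami_eq_sum, Schwartz.smul_apply, Schwartz.sum_apply, RapidDecay.sphRot_sum]
  exact (hasSum_sum fun i _ => hasSum_sum fun j _ =>
    ((hY.sphRot i j).sphRot i j).hasSum_apply r).mul_left _

theorem polyBounded_lapEig : PolyBounded (fun n => 1 + lapEig d n) := by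
  refine ⟨1 + d, 2, fun n => ?_⟩
  have h1 := lapEig_nonneg (d := d) n
  rw [abs_of_nonneg (by linarith)]
  have h2 : (1 : ℝ) ≤ ((n : ℝ) + 1) ^ 2 := one_le_pow₀ (by linarith [(Nat.cast_nonneg n : (0:ℝ) ≤ n)])
  linarith [lapEig_le (d := d) n]

theorem id_sub_lapBeltrami_of_mem {n : ℕ} {f : Schwartz d} (hf : f ∈ Harm d n) :
    idSubLap d f =
      ((1 + lapEig d n : ℝ) : ℂ) • f := by
  rw [LinearMap.sub_apply, LinearMap.id_apply, mem_Harm_iff.1 hf]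
  nth_rw 1 [← one_smul ℂ f]
  rw [← sub_smul]
  congr 1
  push_cast
  ring

theorem RapidDecay.id_sub_lapBeltrami {Y : ℕ → Schwartz d} (hY : RapidDecay Y) :
    RapidDecay (fun n => idSubLap d (Y n)) := by
  have := hY.smul (polyBounded_lapEig (d := d))
  simpa only [← id_sub_lapBeltrami_of_mem (hY.mem _)] using this

theorem RapidDecay.id_sub_lapBeltrami_sum {Y : ℕ → Schwartz d} (hY : RapidDecay Y) :
    idSubLap d hY.sum =
      hY.id_sub_lapBeltrami.sum := by
  refine DFunLike.ext _ _ fun r => ?_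
  refine HasSum.unique ?_ (hY.id_sub_lapBeltrami.hasSum_apply r)
  exact (hY.hasSum_apply r).sub (hY.lapBeltrami_sum r)

theorem RapidDecay.tendsto_norm {Y : ℕ → Schwartz d} (hY : RapidDecay Y) :
    Tendsto (fun N => ‖toCont d (∑ n ∈ Finset.range N, Y n - hY.sum)‖) atTop (𝓝 0) := by
  have h1 : Summable fun n => toCont d (Y n) := hY.summable.of_norm
  have h2 : ∑' n, toCont d (Y n) = toCont d hY.sum := by
    ext r
    have h3 := h1.hasSum.mapL (ContinuousMap.evalCLM ℂ r)
    exact h3.unique (hY.hasSum_apply r)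
  have h4 := h1.hasSum.tendsto_sum_nat
  rw [h2] at h4
  have h5 := (tendsto_iff_norm_sub_tendsto_zero.1 h4)
  simpa only [map_sub, map_sum] using h5

/-- A rapidly decreasing series of spherical harmonics converges in `𝒮(S^{d-1})`. -/
theorem RapidDecay.tendsto_sum {Y : ℕ → Schwartz d} (hY : RapidDecay Y) :
    Tendsto (fun N => ∑ n ∈ Finset.range N, Y n) atTop (𝓝 hY.sum) := by
  rw [schwartz_withSeminorms.tendsto_nhds]
  intro k ε hε
  -- The seminorm of index k + 1 is the one of index k after applying Id - Δ, which turns the series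
  -- into that of (Id - Δ) Y_n. Hence the statement is proved for all series simultaneously.
  have key : ∀ (k : ℕ) {Y : ℕ → Schwartz d} (hY : RapidDecay Y),
      Tendsto (fun N => schwartzSeminorm d k (∑ n ∈ Finset.range N, Y n - hY.sum)) atTop (𝓝 0) := by
    intro k
    induction k with
    | zero => exact fun hY => hY.tendsto_norm
    | succ k ih =>
      intro Y hY
      refine (ih hY.id_sub_lapBeltrami).congr fun N => ?_
      rw [← hY.id_sub_lapBeltrami_sum, ← map_sum, ← map_sub]
      simp only [schwartzSeminorm, Seminorm.comp_apply, LinearMap.comp_apply, pow_succ,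
        Module.End.mul_apply]
  exact (key k hY).eventually (gt_mem_nhds hε)

/-- Uniqueness of limits in 𝒮 is what allows a pseudo-differential operator to be identified with
the multiplier of its symbol. -/
instance : T2Space (Schwartz d) :=
  T2Space.of_injective_continuous (f := toCont d)
    (fun _ _ h => DFunLike.ext _ _ fun r => DFunLike.congr_fun h r) (toCont d).continuous

/-! ### Fourier multipliers -/

/-- The Fourier multiplier operator with a symbol of polynomial growth. -/
noncomputable def multiplier (c : ℕ → ℝ) (hc : PolyBounded c) : Schwartz d →ₗ[ℂ] Schwartz d where
  toFun h := ((rapidDecay_harmPart h).smul hc).sum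
  map_add' f g := DFunLike.ext _ _ fun r => by
    refine (((rapidDecay_harmPart (f + g)).smul hc).hasSum_apply r).unique ?_
    simp only [harmPart_add, smul_add, Schwartz.add_apply]
    exact (((rapidDecay_harmPart f).smul hc).hasSum_apply r).add
      (((rapidDecay_harmPart g).smul hc).hasSum_apply r)
  map_smul' a f := DFunLike.ext _ _ fun r => by
    refine (((rapidDecay_harmPart (a • f)).smul hc).hasSum_apply r).unique ?_
    simp only [harmPart_smul, smul_comm _ a, Schwartz.smul_apply _ (_ • _), RingHom.id_apply]
    exact (((rapidDecay_harmPart f).smul hc).hasSum_apply r).mul_left a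

theorem tendsto_multiplier {c : ℕ → ℝ} (hc : PolyBounded c) (h : Schwartz d) :
    Tendsto (fun N => ∑ n ∈ Finset.range N, (c n : ℂ) • harmPart n h) atTop
      (𝓝 (multiplier c hc h)) :=
  ((rapidDecay_harmPart h).smul hc).tendsto_sum

theorem tendsto_ip_of_tendsto_norm {F : ℕ → Schwartz d} {f : Schwartz d}
    (h : Tendsto (fun N => ‖toCont d (F N - f)‖) atTop (𝓝 0)) (g : Schwartz d) :
    Tendsto (fun N => ip (F N) g) atTop (𝓝 (ip f g)) := by
  rw [tendsto_iff_norm_sub_tendsto_zero]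
  have hb : ∀ N, ‖ip (F N) g - ip f g‖ ≤
      √((surf d).real univ) * ‖toL2 d g‖ * ‖toCont d (F N - f)‖ := by
    intro N
    rw [← ip_sub_left, ← inner_toL2]
    have h1 : ‖toL2 d (F N - f)‖ ≤ √((surf d).real univ) * ‖toCont d (F N - f)‖ := by
      rw [norm_toL2]
      refine (Real.sqrt_le_sqrt (normSq_le _)).trans_eq ?_
      rw [Real.sqrt_mul measureReal_nonneg, Real.sqrt_sq (norm_nonneg _)]
    refine (norm_inner_le_norm _ _).trans ?_
    nlinarith [norm_nonneg (toL2 d g)]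
  refine squeeze_zero (fun _ => norm_nonneg _) hb ?_
  simpa using h.const_mul (√((surf d).real univ) * ‖toL2 d g‖)

theorem harmPart_multiplier {c : ℕ → ℝ} (hc : PolyBounded c) (n : ℕ) (h : Schwartz d) :
    harmPart n (multiplier c hc h) = (c n : ℂ) • harmPart n h := by
  refine IsHarmPart.harmPart_eq ⟨Submodule.smul_mem _ _ (harmPart_mem n h), fun Y hY => ?_⟩
  have h1 := tendsto_ip_of_tendsto_norm ((rapidDecay_harmPart h).smul hc).tendsto_norm Y
  refine tendsto_nhds_unique h1 (tendsto_const_nhds.congr' ?_)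
  filter_upwards [eventually_gt_atTop n] with N hN
  rw [ip_sum_left, Finset.sum_eq_single_of_mem n (Finset.mem_range.2 hN)]
  intro m _ hmn
  exact ip_eq_zero_of_mem_Harm hmn (Submodule.smul_mem _ _ (harmPart_mem m h)) hY

end Spherical

namespace Spherical

variable {d : ℕ} [Fact (2 ≤ d)]

/-! ### Multipliers and the Hermitian square root -/

theorem polyBounded_of_isBigO {c : ℕ → ℝ} {s : ℝ}
    (h : c =O[atTop] fun n : ℕ => (n : ℝ) ^ s) : PolyBounded c := by
  obtain ⟨C, hC, hb⟩ := Asymptotics.bound_of_isBigO_nat_atTop h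
  -- The summand |c 0| takes care of n = 0, where n^s can vanish and the asymptotic bound then says
  -- nothing.
  refine ⟨C + |c 0|, ⌈s⌉₊, fun n => ?_⟩
  rcases n.eq_zero_or_pos with rfl | hn
  · simpa using hC.le
  have hn' : (0 : ℝ) < n := by exact_mod_cast hn
  have h1 : (1 : ℝ) ≤ n := by exact_mod_cast hn
  have h2 := hb (x := n) (Real.rpow_pos_of_pos hn' s).ne'
  rw [Real.norm_eq_abs, Real.norm_of_nonneg (by positivity)] at h2
  have h3 : (n : ℝ) ^ s ≤ ((n : ℝ) + 1) ^ ⌈s⌉₊ := by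
    calc (n : ℝ) ^ s ≤ (n : ℝ) ^ ((⌈s⌉₊ : ℕ) : ℝ) :=
          Real.rpow_le_rpow_of_exponent_le h1 (Nat.le_ceil s)
      _ = (n : ℝ) ^ ⌈s⌉₊ := Real.rpow_natCast _ _
      _ ≤ _ := pow_le_pow_left₀ hn'.le (by linarith) _
  refine h2.trans (mul_le_mul (by linarith [abs_nonneg (c 0)]) h3 (by positivity) (by positivity))

theorem isTheta_sqrt {σ : ℕ → ℝ} {p : ℝ} (h : (fun n => |σ n|) =Θ[atTop] fun n : ℕ => (n : ℝ) ^ p) :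
    (fun n => √(|σ n|)) =Θ[atTop] fun n : ℕ => (n : ℝ) ^ (p / 2) := by
  have h1 : ∀ n : ℕ, (n : ℝ) ^ (p / 2) = ((n : ℝ) ^ p) ^ (1 / 2 : ℝ) := fun n => by
    rw [← Real.rpow_mul (Nat.cast_nonneg n), mul_one_div]
  simp only [h1, Real.sqrt_eq_rpow]
  exact ⟨h.1.rpow (by norm_num) (Eventually.of_forall fun n => by positivity),
    h.2.rpow (by norm_num) (Eventually.of_forall fun n => abs_nonneg _)⟩

theorem ip_harmPart_comm (n : ℕ) (f g : Schwartz d) :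
    ip (harmPart n f) g = ip f (harmPart n g) := by
  rw [← ip_harmPart f (harmPart_mem n g), ← ip_conj, ← ip_harmPart g (harmPart_mem n f), ip_conj]

/-- Multipliers with real symbol are symmetric. -/
theorem ip_multiplier {c : ℕ → ℝ} (hc : PolyBounded c) (f g : Schwartz d) :
    ip (multiplier c hc f) g = ip f (multiplier c hc g) := by
  have h1 := tendsto_ip_of_tendsto_norm ((rapidDecay_harmPart f).smul hc).tendsto_norm g
  have h2 := (Complex.continuous_conj.tendsto _).comp
    (tendsto_ip_of_tendsto_norm ((rapidDecay_harmPart g).smul hc).tendsto_norm f)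
  rw [ip_conj] at h2
  refine tendsto_nhds_unique h1 (h2.congr fun N => ?_)
  simp only [Function.comp_apply, ip_sum_left, map_sum, ip_smul_left, map_mul, Complex.conj_ofReal,
    ip_conj, ip_harmPart_comm]

theorem ip_multiplier_self_nonneg {c : ℕ → ℝ} (hc : PolyBounded c) (h0 : ∀ n, 0 ≤ c n)
    (f : Schwartz d) : 0 ≤ (ip (multiplier c hc f) f).re := by
  have h1 := tendsto_ip_of_tendsto_norm ((rapidDecay_harmPart f).smul hc).tendsto_norm f
  refine ge_of_tendsto' ((Complex.continuous_re.tendsto _).comp h1) fun N => ?_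
  simp only [Function.comp_apply, ip_sum_left, ip_smul_left, Complex.re_sum]
  refine Finset.sum_nonneg fun n _ => ?_
  rw [ip_harmPart_comm, ← ip_harmPart f (harmPart_mem n f), ip_self, ← Complex.ofReal_mul,
    Complex.ofReal_re]
  exact mul_nonneg (h0 n) (normSq_nonneg _)

theorem IsPseudoDiff.polyBounded {D : Schwartz d →ₗ[ℂ] Schwartz d} {σ : ℕ → ℝ} {p : ℝ}
    (hD : IsPseudoDiff D σ p) : PolyBounded σ :=
  polyBounded_of_isBigO (Asymptotics.isBigO_abs_left.1 hD.growth.1)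

theorem IsPseudoDiff.eq_multiplier {D : Schwartz d →ₗ[ℂ] Schwartz d} {σ : ℕ → ℝ} {p : ℝ}
    (hD : IsPseudoDiff D σ p) : D = multiplier σ hD.polyBounded :=
  LinearMap.ext fun h => tendsto_nhds_unique (hD.series h) (tendsto_multiplier _ h)

theorem multiplier_of_mem {c : ℕ → ℝ} (hc : PolyBounded c) {n : ℕ} {Y : Schwartz d}
    (hY : Y ∈ Harm d n) : multiplier c hc Y = (c n : ℂ) • Y := by
  refine tendsto_nhds_unique (tendsto_multiplier hc Y) (tendsto_const_nhds.congr' ?_)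
  filter_upwards [eventually_gt_atTop n] with N hN
  rw [Finset.sum_eq_single_of_mem n (Finset.mem_range.2 hN), harmPart_of_mem hY]
  intro m _ hmn
  rw [harmPart_of_mem_of_ne hmn.symm hY, smul_zero]

/-- The symbol of a positive-definite operator is positive. -/
theorem IsPseudoDiff.symbol_pos {D : Schwartz d →ₗ[ℂ] Schwartz d} {σ : ℕ → ℝ} {p : ℝ}
    (hD : IsPseudoDiff D σ p) (hpos : IsPosDef D) (n : ℕ) : 0 < σ n := by
  obtain ⟨Y, hY, hY0⟩ := exists_mem_Harm_ne_zero (d := d) n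
  have h := (hpos Y hY0).2
  rw [hD.eq_multiplier, multiplier_of_mem _ hY, ip_smul_left, ip_self, ← Complex.ofReal_mul,
    Complex.ofReal_re] at h
  exact pos_of_mul_pos_left h (normSq_nonneg Y)

/-- A smooth function with vanishing Fourier expansion vanishes, as soon as there is a
positive-definite pseudo-differential operator. -/
theorem IsPseudoDiff.ext_harmPart {D : Schwartz d →ₗ[ℂ] Schwartz d} {σ : ℕ → ℝ} {p : ℝ}
    (hD : IsPseudoDiff D σ p) (hpos : IsPosDef D) {f g : Schwartz d}
    (h : ∀ n, harmPart n f = harmPart n g) : f = g := by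
  by_contra hfg
  have h1 := (hpos (f - g) (sub_ne_zero.2 hfg)).2
  -- All partial sums of the series for D (f - g) vanish; positive-definiteness thus plays the role
  -- of completeness of the harmonics.
  have h2 : D (f - g) = 0 := by
    refine tendsto_nhds_unique (hD.series (f - g)) (tendsto_const_nhds.congr fun N => ?_)
    simp [harmPart_sub, h]
  rw [h2, ip_zero_left] at h1
  simp at h1

theorem IsPseudoDiff.multiplier_comp {D : Schwartz d →ₗ[ℂ] Schwartz d} {σ : ℕ → ℝ} {p : ℝ}
    (hD : IsPseudoDiff D σ p) (hpos : IsPosDef D) {a b c : ℕ → ℝ} (ha : PolyBounded a)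
    (hb : PolyBounded b) (hc : PolyBounded c) (h : ∀ n, a n * b n = c n) (f : Schwartz d) :
    multiplier a ha (multiplier b hb f) = multiplier c hc f := by
  refine hD.ext_harmPart hpos fun n => ?_
  rw [harmPart_multiplier, harmPart_multiplier, harmPart_multiplier, smul_smul,
    ← Complex.ofReal_mul, h]

theorem polyBounded_one : PolyBounded fun _ => 1 := ⟨1, 0, fun n => by simp⟩

theorem IsPseudoDiff.multiplier_one {D : Schwartz d →ₗ[ℂ] Schwartz d} {σ : ℕ → ℝ} {p : ℝ}
    (hD : IsPseudoDiff D σ p) (hpos : IsPosDef D) (f : Schwartz d) :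
    multiplier (fun _ => 1) polyBounded_one f = f :=
  hD.ext_harmPart hpos fun n => by rw [harmPart_multiplier, Complex.ofReal_one, one_smul]

theorem IsPseudoDiff.isTheta_sqrt {D : Schwartz d →ₗ[ℂ] Schwartz d} {σ : ℕ → ℝ} {p : ℝ}
    (hD : IsPseudoDiff D σ p) (hpos : IsPosDef D) :
    (fun n => √(σ n)) =Θ[atTop] fun n : ℕ => (n : ℝ) ^ (p / 2) := by
  simpa only [abs_of_pos (hD.symbol_pos hpos _)] using Spherical.isTheta_sqrt hD.growth

theorem IsPseudoDiff.polyBounded_sqrt {D : Schwartz d →ₗ[ℂ] Schwartz d} {σ : ℕ → ℝ} {p : ℝ}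
    (hD : IsPseudoDiff D σ p) (hpos : IsPosDef D) : PolyBounded fun n => √(σ n) :=
  polyBounded_of_isBigO (hD.isTheta_sqrt hpos).1

theorem IsPseudoDiff.isBigO_inv_sqrt {D : Schwartz d →ₗ[ℂ] Schwartz d} {σ : ℕ → ℝ} {p : ℝ}
    (hD : IsPseudoDiff D σ p) (hpos : IsPosDef D) :
    (fun n => (√(σ n))⁻¹) =O[atTop] fun n : ℕ => (n : ℝ) ^ (-(p / 2)) := by
  simpa only [Real.rpow_neg (Nat.cast_nonneg _)] using (hD.isTheta_sqrt hpos).inv.1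

theorem IsPseudoDiff.polyBounded_inv_sqrt {D : Schwartz d →ₗ[ℂ] Schwartz d} {σ : ℕ → ℝ} {p : ℝ}
    (hD : IsPseudoDiff D σ p) (hpos : IsPosDef D) : PolyBounded fun n => (√(σ n))⁻¹ :=
  polyBounded_of_isBigO (hD.isBigO_inv_sqrt hpos)

theorem IsPseudoDiff.isHermitianSqrt {D : Schwartz d →ₗ[ℂ] Schwartz d} {σ : ℕ → ℝ} {p : ℝ}
    (hD : IsPseudoDiff D σ p) (hpos : IsPosDef D) :
    IsHermitianSqrt D (multiplier (fun n => √(σ n)) (hD.polyBounded_sqrt hpos)) where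
  selfAdjoint := ip_multiplier _
  nonneg := ip_multiplier_self_nonneg _ fun _ => Real.sqrt_nonneg _
  sq := LinearMap.ext fun f => by
    rw [LinearMap.comp_apply, hD.multiplier_comp hpos _ _ hD.polyBounded
      fun n => Real.mul_self_sqrt (hD.symbol_pos hpos n).le, ← hD.eq_multiplier]

/-- The Hermitian square root is the multiplier with symbol the square root of the symbol. -/
theorem IsHermitianSqrt.eq_multiplier {D R : Schwartz d →ₗ[ℂ] Schwartz d} {σ : ℕ → ℝ} {p : ℝ}
    (hR : IsHermitianSqrt D R) (hD : IsPseudoDiff D σ p) (hpos : IsPosDef D) :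
    R = multiplier (fun n => √(σ n)) (hD.polyBounded_sqrt hpos) := by
  have hRY : ∀ n, ∀ Y ∈ Harm d n, R Y = ((√(σ n) : ℝ) : ℂ) • Y := by
    intro n Y hY
    have hσ := hD.symbol_pos hpos n
    -- From R² Y = σ_n Y one gets (R + √σ_n)(R - √σ_n) Y = 0, so Z would be an eigenvector of R for
    -- the negative number -√σ_n.
    set Z := R Y - ((√(σ n) : ℝ) : ℂ) • Y with hZ
    have h1 : R Z = ((-√(σ n) : ℝ) : ℂ) • Z := by
      have h2 : R (R Y) = (σ n : ℂ) • Y := by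
        rw [← LinearMap.comp_apply, hR.sq, hD.eq_multiplier, multiplier_of_mem _ hY]
      rw [hZ, map_sub, map_smul, h2, smul_sub, smul_smul, ← Complex.ofReal_mul, neg_mul,
        Real.mul_self_sqrt hσ.le, Complex.ofReal_neg, Complex.ofReal_neg, neg_smul, neg_smul]
      abel
    have h3 := hR.nonneg Z
    rw [h1, ip_smul_left, ip_self, ← Complex.ofReal_mul, Complex.ofReal_re] at h3
    have h4 : normSq Z = 0 := by
      have h5 := Real.sqrt_pos.2 hσ
      nlinarith [normSq_nonneg Z]
    exact sub_eq_zero.1 (eq_zero_of_ip_self (by rw [ip_self, h4, Complex.ofReal_zero]))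
  refine LinearMap.ext fun f => hD.ext_harmPart hpos fun n => ?_
  rw [harmPart_multiplier]
  refine IsHarmPart.harmPart_eq ⟨Submodule.smul_mem _ _ (harmPart_mem n f), fun Y hY => ?_⟩
  -- Self-adjointness moves R onto Y, where it is already known. Neither continuity of R nor its
  -- commuting with the projections is assumed.
  rw [hR.selfAdjoint, hRY n Y hY, ip_smul_right, ip_smul_left, ip_harmPart f hY,
    Complex.conj_ofReal]

theorem IsPseudoDiff.isPseudoDiff_sqrt {D : Schwartz d →ₗ[ℂ] Schwartz d} {σ : ℕ → ℝ} {p : ℝ}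
    (hD : IsPseudoDiff D σ p) (hpos : IsPosDef D) :
    IsPseudoDiff (multiplier (d := d) (fun n => √(σ n)) (hD.polyBounded_sqrt hpos)) (fun n => √(σ n))
      (p / 2) where
  series := tendsto_multiplier (hD.polyBounded_sqrt hpos)
  finite_zeros := by
    have : {n | |√(σ n)| = 0} = ∅ := by
      ext n
      simp [(hD.symbol_pos hpos n).not_ge, Real.sqrt_eq_zero']
    rw [this]
    exact finite_empty
  order_nonneg := by have := hD.order_nonneg; positivity
  growth := by
    simpa only [abs_of_nonneg (Real.sqrt_nonneg _)] using hD.isTheta_sqrt hpos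

/-! ### The embedding estimate -/

theorem sum_range_two_pow {M : Type*} [AddCommMonoid M] (u : ℕ → M) (J : ℕ) :
    ∑ n ∈ Finset.range (2 ^ J), u n =
      u 0 + ∑ j ∈ Finset.range J, ∑ n ∈ Finset.Ico (2 ^ j) (2 ^ (j + 1)), u n := by
  induction J with
  | zero => simp
  | succ J ih =>
    rw [Finset.sum_range_succ, ← add_assoc, ← ih, Finset.sum_range_add_sum_Ico _
      (Nat.pow_le_pow_right two_pos (Nat.le_succ J))]

/-- A multiplier of order `-p/2` with `p > d - 1` maps `ℒ²` boundedly into the continuous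
functions. -/
theorem exists_norm_toCont_multiplier_le {c : ℕ → ℝ} (hc : PolyBounded c) {p : ℝ}
    (hp : (d : ℝ) - 1 < p) (hO : c =O[atTop] fun n : ℕ => (n : ℝ) ^ (-(p / 2))) :
    ∃ C, ∀ φ : Schwartz d, ‖toCont d (multiplier c hc φ)‖ ≤ C * ‖toL2 d φ‖ := by
  obtain ⟨B, hB, hnik⟩ := exists_norm_sq_sum_le d
  obtain ⟨A, hA, hcA⟩ := Asymptotics.bound_of_isBigO_nat_atTop hO
  have hd1 : ((d - 1 : ℕ) : ℝ) = (d : ℝ) - 1 := by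
    rw [Nat.cast_sub (by have := (Fact.out : 2 ≤ d); omega), Nat.cast_one]
  have hd0 : (0 : ℝ) ≤ (d : ℝ) - 1 := by rw [← hd1]; positivity
  -- Block j gains 2^(j(d-1)/2) from the Nikolskii inequality and loses 2^(-jp/2) from the symbol,
  -- up to constants. The ratio q is less than 1 because p > d - 1.
  set q : ℝ := (2 : ℝ) ^ (((d : ℝ) - 1 - p) / 2) with hq
  have hq0 : 0 < q := by positivity
  have hq1 : q < 1 := Real.rpow_lt_one_of_one_lt_of_neg one_lt_two (by linarith)
  set K : ℝ := √(B * 2 ^ (d - 1)) * A with hK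
  have hK0 : 0 ≤ K := by positivity
  have hblock : ∀ (φ : Schwartz d) (r : Sph d) (j : ℕ),
      ‖∑ n ∈ Finset.Ico (2 ^ j) (2 ^ (j + 1)), ((c n : ℂ) • harmPart n φ) r‖ ≤
        K * ‖toL2 d φ‖ * q ^ j := by
    intro φ r j
    have h1 := hnik (2 ^ (j + 1)) Nat.one_le_two_pow (Finset.Ico (2 ^ j) (2 ^ (j + 1)))
      (fun n hn => (Finset.mem_Ico.1 hn).2.le) (fun n => (c n : ℂ) • harmPart n φ)
      (fun n _ => Submodule.smul_mem _ _ (harmPart_mem n φ)) r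
    have h2 : ∑ n ∈ Finset.Ico (2 ^ j) (2 ^ (j + 1)), normSq ((c n : ℂ) • harmPart n φ) ≤
        (A * (2 : ℝ) ^ (-(p / 2) * j)) ^ 2 * normSq φ := by
      refine le_trans ?_ (mul_le_mul_of_nonneg_left
        (sum_normSq_harmPart_le (Finset.Ico (2 ^ j) (2 ^ (j + 1))) φ) (sq_nonneg _))
      rw [Finset.mul_sum]
      refine Finset.sum_le_sum fun n hn => ?_
      rw [normSq_smul, Complex.norm_real]
      refine mul_le_mul_of_nonneg_right (pow_le_pow_left₀ (norm_nonneg _) ?_ 2) (normSq_nonneg _)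
      have hn1 : ((2 : ℝ) ^ j) ≤ n := by exact_mod_cast (Finset.mem_Ico.1 hn).1
      have hn0 : (0 : ℝ) < n := lt_of_lt_of_le (by positivity) hn1
      refine (hcA (x := n) (Real.rpow_pos_of_pos hn0 _).ne').trans
        (mul_le_mul_of_nonneg_left ?_ hA.le)
      rw [Real.norm_of_nonneg (by positivity), mul_comm, Real.rpow_mul zero_le_two,
        Real.rpow_natCast]
      exact Real.rpow_le_rpow_of_nonpos (by positivity) hn1 (by linarith)
    have h3 : ‖∑ n ∈ Finset.Ico (2 ^ j) (2 ^ (j + 1)), ((c n : ℂ) • harmPart n φ) r‖ ^ 2 ≤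
        (K * ‖toL2 d φ‖ * q ^ j) ^ 2 := by
      refine h1.trans ((mul_le_mul_of_nonneg_left h2 (by positivity)).trans_eq ?_)
      have e1 : (q ^ j) ^ 2 = ((2 : ℝ) ^ j) ^ (d - 1) * ((2 : ℝ) ^ (-(p / 2) * j)) ^ 2 := by
        rw [hq, ← Real.rpow_natCast _ j, ← Real.rpow_mul zero_le_two, ← pow_mul,
          ← Real.rpow_natCast, ← Real.rpow_mul zero_le_two, ← Real.rpow_natCast 2 (j * (d - 1)),
          ← Real.rpow_natCast _ 2, ← Real.rpow_mul zero_le_two, ← Real.rpow_add two_pos]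
        congr 1
        push_cast
        rw [hd1]
        ring
      rw [mul_pow (K * _), e1, hK, mul_pow (_ * A), mul_pow _ A, mul_pow A, Real.sq_sqrt (by positivity), norm_toL2_sq]
      push_cast
      ring
    exact (pow_le_pow_iff_left₀ (norm_nonneg _) (by positivity) two_ne_zero).1 h3
  -- Order 0 lies in no dyadic block and is not covered by the bound on the symbol, so it enters
  -- through |c 0|.
  have hzero : ∀ (φ : Schwartz d) (r : Sph d),
      ‖((c 0 : ℂ) • harmPart 0 φ) r‖ ≤ |c 0| * √B * ‖toL2 d φ‖ := by
    intro φ r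
    have h1 := hnik 1 le_rfl {0} (by simp) (fun n => harmPart n φ) (fun n _ => harmPart_mem n φ) r
    simp only [Finset.sum_singleton, Nat.cast_one, one_pow, mul_one] at h1
    have h2 : ‖harmPart 0 φ r‖ ≤ √B * ‖toL2 d φ‖ := by
      rw [norm_toL2, ← Real.sqrt_mul hB.le]
      exact Real.le_sqrt_of_sq_le (h1.trans
        (mul_le_mul_of_nonneg_left (normSq_harmPart_le 0 φ) hB.le))
    rw [Schwartz.smul_apply, norm_mul, Complex.norm_real, Real.norm_eq_abs, mul_assoc]
    exact mul_le_mul_of_nonneg_left h2 (abs_nonneg _)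
  refine ⟨|c 0| * √B + K * (1 - q)⁻¹, fun φ => ?_⟩
  have hq1' : 0 < 1 - q := by linarith
  rw [ContinuousMap.norm_le _ (by positivity)]
  intro r
  have hlim := (((rapidDecay_harmPart φ).smul hc).hasSum_apply r).tendsto_sum_nat
  have hpow : Tendsto (fun J : ℕ => 2 ^ J) atTop (atTop : Filter ℕ) :=
    tendsto_pow_atTop_atTop_of_one_lt one_lt_two
  -- The series converges, so it may be summed along N = 2^J, where partial sums split into complete
  -- blocks.
  refine le_of_tendsto' (hlim.comp hpow).norm fun J => ?_
  simp only [Function.comp_apply]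
  rw [sum_range_two_pow]
  have hgeo : ∑ j ∈ Finset.range J, q ^ j ≤ (1 - q)⁻¹ := by
    rw [← tsum_geometric_of_lt_one hq0.le hq1]
    exact (summable_geometric_of_lt_one hq0.le hq1).sum_le_tsum _ fun _ _ => by positivity
  calc ‖((c 0 : ℂ) • harmPart 0 φ) r + ∑ j ∈ Finset.range J,
        ∑ n ∈ Finset.Ico (2 ^ j) (2 ^ (j + 1)), ((c n : ℂ) • harmPart n φ) r‖
      ≤ |c 0| * √B * ‖toL2 d φ‖ + ∑ j ∈ Finset.range J, K * ‖toL2 d φ‖ * q ^ j :=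
        (norm_add_le _ _).trans (add_le_add (hzero φ r)
          (norm_sum_le_of_le _ fun j _ => hblock φ r j))
    _ ≤ |c 0| * √B * ‖toL2 d φ‖ + K * ‖toL2 d φ‖ * (1 - q)⁻¹ := by
        rw [← Finset.mul_sum]
        exact add_le_add le_rfl (mul_le_mul_of_nonneg_left hgeo (by positivity))
    _ = _ := by ring

end Spherical

namespace Spherical

variable {d : ℕ} [Fact (2 ≤ d)]

/-! ### Square-integrable functions as generalised functions -/

/-- Real smooth functions already suffice as test functions on the sphere, by the fundamental lemma
of the calculus of variations. -/
theorem eq_zero_of_ofL2_eq_zero {g : Lp ℂ 2 (surf d)} (h : ofL2 g = 0) : g = 0 := by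
  rw [Lp.eq_zero_iff_ae_eq_zero]
  refine ae_eq_zero_of_integral_contMDiff_smul_eq_zero (𝓡 (d - 1))
    ((Lp.memLp g).integrable (by norm_num)).locallyIntegrable fun u hu _ => ?_
  let φ : Schwartz d := ⟨fun r => (u r : ℂ),
    (Complex.ofRealCLM.contDiff.contMDiff (n := ∞)).comp hu⟩
  have h1 : ofL2 g φ = 0 := by rw [h]; rfl
  rw [ofL2_apply] at h1
  rw [← h1]
  refine integral_congr_ae (Eventually.of_forall fun r => ?_)
  exact (Complex.real_smul).trans (mul_comm _ _)

theorem ofL2_injective : Function.Injective (ofL2 (d := d)) := by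
  intro g g' h
  have h1 : ofL2 (g + (-1 : ℂ) • g') = 0 := by
    rw [ofL2_add, ofL2_smul, h]
    refine ContinuousLinearMap.ext fun φ => ?_
    change ofL2 g' φ + (-1 : ℂ) * ofL2 g' φ = 0
    ring
  have h2 := eq_zero_of_ofL2_eq_zero h1
  rwa [neg_one_smul, add_neg_eq_zero] at h2

theorem ofL2_eq_inner (g : Lp ℂ 2 (surf d)) (φ : Schwartz d) :
    ofL2 g φ = inner ℂ (toL2 d φ.conj) g := by
  rw [L2.inner_def, ofL2_apply]
  refine integral_congr_ae ?_
  filter_upwards [coeFn_toL2 φ.conj] with r hr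
  rw [hr]
  simp [Schwartz.conj_apply]

/-- A vector orthogonal to all smooth functions vanishes as a generalised function, hence in ℒ². -/
theorem denseRange_toL2 : DenseRange (toL2 d) := by
  have h : (LinearMap.range (toL2 d)).topologicalClosure = ⊤ := by
    rw [Submodule.topologicalClosure_eq_top_iff, Submodule.eq_bot_iff]
    intro g hg
    refine eq_zero_of_ofL2_eq_zero (ContinuousLinearMap.ext fun φ => ?_)
    rw [ofL2_eq_inner]
    exact hg _ ⟨_, rfl⟩
  have := Submodule.dense_iff_topologicalClosure_eq_top.2 h
  rwa [LinearMap.coe_range] at this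

theorem ofCont_eq_ofL2 (u : C(Sph d, ℂ)) :
    ofCont u = ofL2 (ContinuousMap.toLp 2 (surf d) ℂ u) := by
  ext φ
  rw [ofL2_apply]
  refine integral_congr_ae ?_
  filter_upwards [ContinuousMap.coeFn_toLp (p := 2) (𝕜 := ℂ) (surf d) u] with r hr
  rw [hr]
  rfl

theorem ofL2_toL2 (f φ : Schwartz d) : ofL2 (toL2 d f) φ = ip f φ.conj := by
  rw [ofL2_eq_inner, inner_toL2]

theorem continuous_ofL2_apply (φ : Schwartz d) : Continuous fun g => ofL2 g φ := by
  simp only [ofL2_eq_inner]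
  fun_prop

theorem continuous_ofCont_apply (φ : Schwartz d) : Continuous fun u => ofCont u φ := by
  simp only [ofCont_eq_ofL2]
  exact (continuous_ofL2_apply φ).comp (ContinuousMap.toLp 2 (surf d) ℂ).continuous

theorem ofCont_toCont (f φ : Schwartz d) : ofCont (toCont d f) φ = ip f φ.conj := by
  rw [ofCont_eq_ofL2]
  exact ofL2_toL2 f φ

theorem ofCont_add (u v : C(Sph d, ℂ)) : ofCont (u + v) = ofCont u + ofCont v := by
  simp only [ofCont_eq_ofL2, map_add, ofL2_add]

theorem ofCont_smul (a : ℂ) (u : C(Sph d, ℂ)) : ofCont (a • u) = a • ofCont u := by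
  simp only [ofCont_eq_ofL2, map_smul, ofL2_smul]

/-! ### The reproducing kernel Hilbert space -/

/-- `ρ` is a symmetric inverse of the real operator `R` which maps `ℒ²` boundedly into the
continuous functions. -/
structure IsSmoothingInverse (R ρ : Schwartz d →ₗ[ℂ] Schwartz d) : Prop where
  right_inv : ∀ φ, R (ρ φ) = φ
  left_inv : ∀ φ, ρ (R φ) = φ
  symm : ∀ f g, ip (ρ f) g = ip f (ρ g)
  map_conj : ∀ φ : Schwartz d, R φ.conj = (R φ).conj
  bound : ∃ C, ∀ φ, ‖toCont d (ρ φ)‖ ≤ C * ‖toL2 d φ‖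

/-- The extension of a smoothing operator to `ℒ²`, with values in the continuous functions. -/
noncomputable def smoothing (ρ : Schwartz d →ₗ[ℂ] Schwartz d) :
    Lp ℂ 2 (surf d) →L[ℂ] C(Sph d, ℂ) :=
  ((toCont d : Schwartz d →ₗ[ℂ] C(Sph d, ℂ)) ∘ₗ ρ).extendOfNorm (toL2 d)

namespace IsSmoothingInverse

variable {R ρ : Schwartz d →ₗ[ℂ] Schwartz d}

theorem inv_map_conj (h : IsSmoothingInverse R ρ) (φ : Schwartz d) : ρ φ.conj = (ρ φ).conj := by
  rw [← h.left_inv (ρ φ).conj, h.map_conj, h.right_inv]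

theorem smoothing_toL2 (h : IsSmoothingInverse R ρ) (φ : Schwartz d) :
    smoothing ρ (toL2 d φ) = toCont d (ρ φ) :=
  LinearMap.extendOfNorm_eq denseRange_toL2 h.bound φ

/-- This is R ρ g = g in the sense of 𝒮'. For smooth g it follows from symmetry of ρ and reality of
R; both sides are continuous in g, and density does the rest. -/
theorem ofCont_smoothing (h : IsSmoothingInverse R ρ) (g : Lp ℂ 2 (surf d)) (φ : Schwartz d) :
    ofCont (smoothing ρ g) (R φ) = ofL2 g φ := by
  refine denseRange_toL2.induction_on (p := fun g => ofCont (smoothing ρ g) (R φ) = ofL2 g φ) g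
    (isClosed_eq ((continuous_ofCont_apply _).comp (smoothing ρ).continuous)
      (continuous_ofL2_apply φ)) fun χ => ?_
  rw [h.smoothing_toL2, ofCont_toCont, ofL2_toL2, ← h.map_conj, h.symm, h.left_inv]

theorem actGen_ofCont_smoothing (h : IsSmoothingInverse R ρ) (g : Lp ℂ 2 (surf d)) :
    actGen R (ofCont (smoothing ρ g)) = (ofL2 g : Schwartz d →ₗ[ℂ] ℂ) :=
  LinearMap.ext fun φ => h.ofCont_smoothing g φ

/-- R is onto 𝒮, so R f determines f on every test function, without any continuity of R. -/
theorem eq_of_actGen_eq (h : IsSmoothingInverse R ρ) {f f' : GenFun d}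
    (hf : actGen R f = actGen R f') : f = f' := by
  ext φ
  rw [← h.right_inv φ]
  exact LinearMap.congr_fun hf (ρ φ)

/-- The Riesz potential isomorphism from `ℒ²` onto the generalised Sobolev space. -/
noncomputable def potential (h : IsSmoothingInverse R ρ) : Lp ℂ 2 (surf d) ≃ₗ[ℂ] Sobolev R :=
  LinearEquiv.ofBijective
    { toFun := fun g => (⟨ofCont (smoothing ρ g),
        show _ ∈ sobolev R from ⟨g, h.actGen_ofCont_smoothing g⟩⟩ : sobolev R)
      map_add' := fun g g' => Subtype.ext
        ((congrArg ofCont (map_add (smoothing ρ) g g')).trans (ofCont_add _ _))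
      map_smul' := fun a g => Subtype.ext
        ((congrArg ofCont (map_smul (smoothing ρ) a g)).trans (ofCont_smul _ _)) }
    ⟨fun g g' hg => by
      refine ofL2_injective (ContinuousLinearMap.ext fun φ => ?_)
      have h1 : ofCont (smoothing ρ g) = ofCont (smoothing ρ g') := congrArg Subtype.val hg
      rw [← h.ofCont_smoothing, ← h.ofCont_smoothing, h1],
    fun f => by
      obtain ⟨g, hg⟩ := f.2
      exact ⟨g, Subtype.ext (h.eq_of_actGen_eq ((h.actGen_ofCont_smoothing g).trans hg.symm))⟩⟩

theorem toGenFun_eq (h : IsSmoothingInverse R ρ) (f : Sobolev R) :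
    f.toGenFun = ofCont (smoothing ρ (h.potential.symm f)) :=
  (congrArg Sobolev.toGenFun (h.potential.apply_symm_apply f)).symm

theorem eq_potential_symm (h : IsSmoothingInverse R ρ) {f : Sobolev R} {g : Lp ℂ 2 (surf d)}
    (hg : actGen R f.toGenFun = (ofL2 g : Schwartz d →ₗ[ℂ] ℂ)) : g = h.potential.symm f := by
  refine ofL2_injective (ContinuousLinearMap.ext fun φ => ?_)
  rw [h.toGenFun_eq, h.actGen_ofCont_smoothing] at hg
  exact (LinearMap.congr_fun hg φ).symm

/-- The inner product `⟨f, f'⟩ = ⟨R f, R f'⟩` on the generalised Sobolev space. -/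
@[reducible]
noncomputable def core (h : IsSmoothingInverse R ρ) : InnerProductSpace.Core ℂ (Sobolev R) where
  inner f f' := inner ℂ (h.potential.symm f) (h.potential.symm f')
  conj_inner_symm f f' := inner_conj_symm _ _
  re_inner_nonneg f := inner_self_nonneg
  add_left f f' f'' := by rw [map_add, inner_add_left]
  smul_left f f' a := by rw [map_smul, inner_smul_left]
  definite f hf := by
    rwa [inner_self_eq_zero, LinearEquiv.map_eq_zero_iff] at hf

/-- The inner product makes `potential` an isometry, so completeness is that of ℒ². Evaluation at a
point is bounded because ρ is bounded from ℒ² into the continuous functions, and the pointwise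
values determine the element since they determine the generalised function. -/
theorem isSobolevRKHS (h : IsSmoothingInverse R ρ) : IsSobolevRKHS R := by
  refine ⟨h.core, fun f f' g g' hg hg' => ?_, ?_⟩
  · rw [h.eq_potential_symm hg, h.eq_potential_symm hg']
    rfl
  let _ : NormedAddCommGroup (Sobolev R) := h.core.toNormedAddCommGroup
  let _ : InnerProductSpace ℂ (Sobolev R) := InnerProductSpace.ofCore h.core.toCore
  let T : Sobolev R ≃ₗᵢ[ℂ] Lp ℂ 2 (surf d) := h.potential.symm.isometryOfInner fun _ _ => rfl
  have hinj : ∀ f f' : Sobolev R, smoothing ρ (T f) = smoothing ρ (T f') → f = f' := by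
    intro f f' hff
    refine Subtype.ext ?_
    have h1 := h.toGenFun_eq f
    have h2 := h.toGenFun_eq f'
    exact h1.trans ((congrArg ofCont hff).trans h2.symm)
  refine ⟨(T.toIsometryEquiv.isometry.isUniformInducing.completeSpace_congr T.surjective).2 inferInstance,
    { coeCLM := ContinuousLinearMap.pi fun r => (ContinuousMap.evalCLM ℂ r).comp
        ((smoothing ρ).comp (T : Sobolev R →L[ℂ] Lp ℂ 2 (surf d)))
      coeCLM_injective := fun f f' hff => hinj f f' (ContinuousMap.ext fun r => congrFun hff r) },
    fun f => ⟨smoothing ρ (T f), rfl, h.toGenFun_eq f⟩⟩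

theorem mem_sobolev_of_isSpline (h : IsSmoothingInverse R ρ) {D : Schwartz d →ₗ[ℂ] Schwartz d}
    (hRD : R ∘ₗ R = D) {s : GenFun d} (hs : IsSpline D s) : s ∈ sobolev R := by
  obtain ⟨M, r, α, hs⟩ := hs
  -- The amplitudes are conjugated because the bilinear pairing of the Riesz representative with φ
  -- is the conjugate of ℓ at the conjugate of φ.
  let ℓ : Lp ℂ 2 (surf d) →L[ℂ] ℂ :=
    ∑ i, conj (α i) • (ContinuousMap.evalCLM ℂ (r i)).comp (smoothing ρ)
  refine ⟨(InnerProductSpace.toDual ℂ _).symm ℓ, LinearMap.ext fun φ => ?_⟩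
  have h1 : s (R φ) = ∑ i, α i * ρ φ (r i) := by
    -- Since D = R², R φ is D applied to ρ φ, so the spline equation evaluates s there.
    have h2 : D (ρ φ) = R φ := by rw [← hRD, LinearMap.comp_apply, h.right_inv]
    have h3 := LinearMap.congr_fun hs (ρ φ)
    rw [← h2]
    refine h3.trans ?_
    simp only [ContinuousLinearMap.coe_coe, sum_apply]
    rfl
  have h4 : ofL2 ((InnerProductSpace.toDual ℂ _).symm ℓ) φ = ∑ i, α i * ρ φ (r i) := by
    rw [ofL2_eq_inner, ← inner_conj_symm, InnerProductSpace.toDual_symm_apply]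
    simp only [ℓ, sum_apply, map_sum]
    refine Finset.sum_congr rfl fun i _ => ?_
    have h5 : smoothing ρ (toL2 d φ.conj) (r i) = conj (ρ φ (r i)) := by
      rw [h.smoothing_toL2, h.inv_map_conj]
      rfl
    change conj (conj (α i) * smoothing ρ (toL2 d φ.conj) (r i)) = _
    rw [h5, map_mul, Complex.conj_conj, Complex.conj_conj]
  exact h1.trans h4.symm

end IsSmoothingInverse

theorem multiplier_conj {c : ℕ → ℝ} (hc : PolyBounded c) (φ : Schwartz d) :
    multiplier c hc φ.conj = (multiplier c hc φ).conj := by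
  refine DFunLike.ext _ _ fun r =>
    (((rapidDecay_harmPart φ.conj).smul hc).hasSum_apply r).unique ?_
  have h1 := (((rapidDecay_harmPart φ).smul hc).hasSum_apply r).mapL
    (Complex.conjCLE : ℂ →L[ℝ] ℂ)
  refine Eq.mp (congrArg (HasSum · _) (funext fun n => ?_)) h1
  rw [harmPart_conj]
  exact (map_mul (starRingEnd ℂ) _ _).trans (congrArg (· * _) (Complex.conj_ofReal _))

theorem IsPseudoDiff.isSmoothingInverse {D : Schwartz d →ₗ[ℂ] Schwartz d} {σ : ℕ → ℝ} {p : ℝ}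
    (hD : IsPseudoDiff D σ p) (hpos : IsPosDef D) (hp : (d : ℝ) - 1 < p) :
    IsSmoothingInverse (multiplier (d := d) (fun n => √(σ n)) (hD.polyBounded_sqrt hpos))
      (multiplier (d := d) (fun n => (√(σ n))⁻¹) (hD.polyBounded_inv_sqrt hpos)) where
  right_inv φ := by
    rw [hD.multiplier_comp hpos _ _ polyBounded_one fun n =>
      mul_inv_cancel₀ (Real.sqrt_pos.2 (hD.symbol_pos hpos n)).ne', hD.multiplier_one hpos]
  left_inv φ := by
    rw [hD.multiplier_comp hpos _ _ polyBounded_one fun n =>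
      inv_mul_cancel₀ (Real.sqrt_pos.2 (hD.symbol_pos hpos n)).ne', hD.multiplier_one hpos]
  symm := ip_multiplier _
  map_conj := multiplier_conj _
  bound := exists_norm_toCont_multiplier_le _ hp (hD.isBigO_inv_sqrt hpos)

end Spherical

theorem proposition9 (d : ℕ) [Fact (2 ≤ d)] (D : Schwartz d →ₗ[ℂ] Schwartz d)
    (σ : ℕ → ℝ) (p : ℝ) (hD : IsPseudoDiff D σ p) (hpos : IsPosDef D) (hp : (d : ℝ) - 1 < p) :
    (∃! R : Schwartz d →ₗ[ℂ] Schwartz d, IsHermitianSqrt D R) ∧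
    (∀ n, 0 < σ n) ∧
    ∀ R : Schwartz d →ₗ[ℂ] Schwartz d, IsHermitianSqrt D R →
      IsPseudoDiff R (fun n => √(σ n)) (p / 2) ∧
      IsSobolevRKHS R ∧
      ∀ s : GenFun d, IsSpline D s → s ∈ sobolev R := by
  refine ⟨⟨_, hD.isHermitianSqrt hpos, fun R hR => hR.eq_multiplier hD hpos⟩,
    hD.symbol_pos hpos, fun R hR => ?_⟩
  have h := hD.isSmoothingInverse hpos hp
  -- An arbitrary Hermitian root is the multiplier with symbol √σ_n, for which the smoothing inverse
  -- was built.
  obtain rfl := hR.eq_multiplier hD hpos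
  exact ⟨hD.isPseudoDiff_sqrt hpos, h.isSobolevRKHS,
    fun s hs => h.mem_sobolev_of_isSpline hR.sq hs⟩
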